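/- Let $e_1,e_2\in\mathbb R$ and $Q=(0,\infty)\times(0,\infty)$. With the digamma function $\psi=\Gamma'/\Gamma$ put, for $x>0$, $$f(x)=\psi\Big(\tfrac32-\sqrt{\tfrac94-x}\Big)+\psi\Big(\tfrac32+\sqrt{\tfrac94-x}\Big)\in\mathbb R ,$$ and define the massive consistency function $F:Q\to\mathbb R$ by $$F(x,h)=\Big(\frac{x^2}{4}-x+\frac{29}{30}\Big)h^2-\Big(\frac x2+\frac{e_2}{30}-1\Big)-\frac{e_1}{30\,h^2}-\Big(\frac x2-1\Big)\big(2\log h+f(x)\big).$$ Let $\mathcal S_{e_1,e_2}=\{(x,h)\in Q : F(x,h)=0\}$. Terminology. A *regular analytic curve* is an analytic map $\gamma:I\to Q$ on a nonempty open interval $I\subset\mathbb R$ (possibly unbounded) such that $|\gamma'|$ is bounded away from zero on $I$. It is *inextendible* if there are no regular analytic curve $\eta:J\to Q$ and analytic $\varphi:I\to J$ with nowhere vanishing derivative and $\varphi(I)\ne J$ such that $\gamma=\eta\circ\varphi$. "Connected" means path-connected, and components are path components. A set $\mathcal T\subset Q$ is *tree-like* if it is (nonempty and) connected and, for each $s\in\mathcal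 T$, the set $\mathcal T\setminus\{s\}$ is disconnected (it has at least two components) and has only finitely many components. **Theorem.** Suppose that for every $(x,h)\in Q$ we have $\nabla F(x,h)\neq 0$ or $\det(\mathrm{Hess}\,F(x,h))<0$. Then: 1. $\mathcal S_{e_1,e_2}$ is the union of the images of finitely many inextendible regular analytic curves. 2. Every inextendible regular analytic curve $\gamma:I\to Q$ with image in $\mathcal S_{e_1,e_2}$ leaves every compact subset of $Q$ at both ends: for every compact $K\subset Q$ there are $t_1,t_2\in I$ such that $\gamma(t)\in Q\setminus K$ for all $t\in(\inf I,t_1)\cup(t_2,\sup I)$. 3. $\mathcal S_{e_1,e_2}$ is a disjoint union of tree-like sets; more precisely, its connected components are tree-like. -/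

import Mathlib

open Set Topology

namespace DeSitter

noncomputable section

/-- The open quadrant `(0,∞) × (0,∞)`; its points are written `(x, h)`. -/
def quadrant : Set (ℝ × ℝ) := Ioi 0 ×ˢ Ioi 0

/-- `f(x) = ψ(3/2 - √(9/4 - x)) + ψ(3/2 + √(9/4 - x))` with the digamma function `ψ = Γ'/Γ`.
For `x > 9/4` the square root is imaginary. For real `x > 0` both arguments of `ψ` have positive
real part, and they are either real or complex conjugates of each other, so that the sum is real
and taking the real part only changes its type. -/
def f (x : ℝ) : ℝ :=
  (Complex.digamma (3 / 2 - ((9 / 4 - x : ℝ) : ℂ) ^ (1 / 2 : ℂ))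
    + Complex.digamma (3 / 2 + ((9 / 4 - x : ℝ) : ℂ) ^ (1 / 2 : ℂ))).re

def F₁ (e₁ e₂ : ℝ) (p : ℝ × ℝ) : ℝ :=
  (p.1 ^ 2 / 4 - p.1 + 29 / 30) * p.2 ^ 2 - (p.1 / 2 + e₂ / 30 - 1) - e₁ / 30 * (1 / p.2 ^ 2)

def F₂ (p : ℝ × ℝ) : ℝ := 2 * Real.log p.2 + f p.1

/-- The massive consistency function, relevant on `quadrant` only. -/
def F (e₁ e₂ : ℝ) (p : ℝ × ℝ) : ℝ := F₁ e₁ e₂ p - (p.1 / 2 - 1) * F₂ p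

/-- The solution set `𝒮_{e₁,e₂}`. -/
def solutionSet (e₁ e₂ : ℝ) : Set (ℝ × ℝ) := {p | p ∈ quadrant ∧ F e₁ e₂ p = 0}

/-- The Hessian matrix of second partial derivatives of a function of two real variables. -/
def hessian (G : ℝ × ℝ → ℝ) (p : ℝ × ℝ) : Matrix (Fin 2) (Fin 2) ℝ :=
  Matrix.of fun i j =>
    fderiv ℝ (fderiv ℝ G) p (![((1 : ℝ), (0 : ℝ)), (0, 1)] i) (![((1 : ℝ), (0 : ℝ)), (0, 1)] j)

/-- At every point of the quadrant, the gradient of `F` does not vanish or the Hessian of `F` has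
negative determinant. -/
def HessianAssumption (e₁ e₂ : ℝ) : Prop :=
  ∀ p ∈ quadrant, fderiv ℝ (F e₁ e₂) p ≠ 0 ∨ (hessian (F e₁ e₂) p).det < 0

/-- `γ`, restricted to `I`, is a regularly parameterized analytic curve in the quadrant: `I` is a
nonempty open interval (possibly unbounded), `γ` is analytic on `I` with values in the quadrant, and
`|γ'|` is bounded away from zero on `I`. -/
structure IsRegularCurve (I : Set ℝ) (γ : ℝ → ℝ × ℝ) : Prop where
  isOpen : IsOpen I
  ordConnected : I.OrdConnected
  nonempty : I.Nonempty
  mapsTo : MapsTo γ I quadrant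
  analytic : AnalyticOnNhd ℝ γ I
  regular : ∃ c > 0, ∀ t ∈ I, c ≤ ‖deriv γ t‖

/-- The curve `γ : I → quadrant` is, after a regular analytic change of parameter `φ`, a proper part
of a regularly parameterized analytic curve `η : J → quadrant`. -/
def IsExtendible (I : Set ℝ) (γ : ℝ → ℝ × ℝ) : Prop :=
  ∃ (J : Set ℝ) (η : ℝ → ℝ × ℝ) (φ : ℝ → ℝ), IsRegularCurve J η ∧
    AnalyticOnNhd ℝ φ I ∧ (∀ t ∈ I, deriv φ t ≠ 0) ∧ φ '' I ⊂ J ∧ ∀ t ∈ I, γ t = η (φ t)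

/-- An inextendible, regularly parameterized analytic curve `γ : I → quadrant`. -/
def IsInextendibleCurve (I : Set ℝ) (γ : ℝ → ℝ × ℝ) : Prop :=
  IsRegularCurve I γ ∧ ¬ IsExtendible I γ

/-- At both ends of its domain `I` the curve `γ` leaves every compact subset of the quadrant. -/
def LeavesCompacts (I : Set ℝ) (γ : ℝ → ℝ × ℝ) : Prop :=
  ∀ K : Set (ℝ × ℝ), IsCompact K → K ⊆ quadrant →
    ∃ t₁ ∈ I, ∃ t₂ ∈ I, ∀ t ∈ I, t < t₁ ∨ t₂ < t → γ t ∈ quadrant \ K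

/-- The set of all (path-)connected components of a subset of the plane. -/
def components (T : Set (ℝ × ℝ)) : Set (Set (ℝ × ℝ)) := pathComponentIn T '' T

/-- A tree-like subset of the quadrant: it is path-connected, and removing any one of its points
leaves a disconnected set (at least two path components) with finitely many path components. -/
def IsTreeLike (T : Set (ℝ × ℝ)) : Prop :=
  T ⊆ quadrant ∧ IsPathConnected T ∧
    ∀ s ∈ T, (components (T \ {s})).Nontrivial ∧ (components (T \ {s})).Finite

end

end DeSitter

/-! ### Analyticity of the consistency function on the quadrant. -/

namespace DeSitter
noncomputable section

/-! Locally, the assumption on gradient and Hessian puts `F - F p` into one of two normal forms: in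
suitable analytic coordinates centred at `p` it is one coordinate, or the product of both
(`nonempty_levelChart`, the second case by factoring an indefinite quadratic form). Hence near each
of its points the solution set is an analytic arc or a pair of transversally crossing arcs, and `F`
has no local extremum.

Globally, the absence of extrema forbids loops. If `L` is a compact part of the solution set, a
bounded component of its complement containing a point with `F ≠ 0` would lie in the quadrant and
contain an extremum of `F` (`not_isBounded_component`). It follows that two different rays of the
solution set at `p` cannot be joined inside the solution set without `p`
(`LevelChart.rays_separated`). Logarithms replace the Jordan curve theorem here. Let `q`, `q'` be
the ends of a short segment through `p` that separates the two rays. Both lie in unbounded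
components of the complement, so `(z - q) / (z - q')` has a continuous logarithm on `L`. But if `L`
without `p` is connected, the argument has to jump by `2π` at `p` (`not_hasLogOn`).

The separation of rays has three consequences. An inextendible solution curve is injective, since a
first return to a point would join two of its rays. It leaves compact sets, since at an accumulation
point it would contain a whole branch and, by injectivity, pass that point only once. Removing a
point from a component separates its rays, of which there are at most four, and every other point of
the component is joined to one of them.

Finiteness is where the special form of `F` enters. A vertical line meets the solution set in at
most three points (`no_four_zeros`), so the abscissa of a curve has a limit at its forward end; by
`vertically_bounded` this limit is `0`, `∞` or one of finitely many exceptional values. Curves with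
the same kind of end all cross a common vertical line, in at most three points with at most two
branches each. -/

lemma analyticAt_digamma {s : ℂ} (hs : 0 < s.re) : AnalyticAt ℂ Complex.digamma s := by
  have hopen : IsOpen {z : ℂ | 0 < z.re} := isOpen_lt continuous_const Complex.continuous_re
  have hG : AnalyticAt ℂ Complex.Gamma s := by
    refine DifferentiableOn.analyticAt (s := {z : ℂ | 0 < z.re}) (fun z hz => ?_)
      (hopen.mem_nhds hs)
    refine (Complex.differentiableAt_Gamma z fun m hm => ?_).differentiableWithinAt
    have : 0 < z.re := hz
    rw [hm] at this
    simp at this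
    have h2 : (0 : ℝ) ≤ m := m.cast_nonneg
    linarith
  exact hG.deriv.div hG (Complex.Gamma_ne_zero_of_re_pos hs)

/-- The sum of two digamma values symmetric about `3 / 2`. -/
def digammaSum (w : ℂ) : ℂ := Complex.digamma (3 / 2 - w) + Complex.digamma (3 / 2 + w)

lemma digammaSum_neg (w : ℂ) : digammaSum (-w) = digammaSum w := by
  simp only [digammaSum, sub_neg_eq_add, ← sub_eq_add_neg]
  ring

lemma digammaSum_eq_of_sq_eq {w w' : ℂ} (h : w ^ 2 = w' ^ 2) : digammaSum w = digammaSum w' := by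
  rcases sq_eq_sq_iff_eq_or_eq_neg.1 h with rfl | rfl
  · rfl
  · exact digammaSum_neg w'

lemma analyticAt_digammaSum {w : ℂ} (hw : |w.re| < 3 / 2) : AnalyticAt ℂ digammaSum w := by
  rw [abs_lt] at hw
  have e : (3 / 2 : ℂ).re = 3 / 2 := by norm_num
  have h1 : AnalyticAt ℂ (fun w : ℂ => 3 / 2 - w) w := by fun_prop
  have h2 : AnalyticAt ℂ (fun w : ℂ => 3 / 2 + w) w := by fun_prop
  refine AnalyticAt.add ?_ ?_
  · refine AnalyticAt.fun_comp (analyticAt_digamma ?_) h1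
    rw [Complex.sub_re, e]; linarith [hw.2]
  · refine AnalyticAt.fun_comp (analyticAt_digamma ?_) h2
    rw [Complex.add_re, e]; linarith [hw.1]

lemma cpow_half_sq (z : ℂ) : (z ^ (1 / 2 : ℂ)) ^ 2 = z := by
  rw [one_div]; exact Complex.cpow_nat_inv_pow z two_ne_zero

lemma cpow_half_re_sq_le (z : ℂ) : (z ^ (1 / 2 : ℂ)).re ^ 2 * 2 = ‖z‖ + z.re := by
  set w := z ^ (1 / 2 : ℂ) with hw
  have h : w ^ 2 = z := cpow_half_sq z
  have h1 : ‖z‖ = w.re ^ 2 + w.im ^ 2 := by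
    rw [← h, norm_pow, ← Complex.normSq_eq_norm_sq, Complex.normSq_apply]; ring
  have h2 : z.re = w.re ^ 2 - w.im ^ 2 := by rw [← h, pow_two]; simp; ring
  rw [h1, h2]; ring

/-- `digammaSum` is even, so only the square of its argument matters: on the branch cut of the root,
`I * √(-z)` may replace `√z`. The bound on `z` says that the root has real part of modulus below `3
/ 2`, which keeps both digamma arguments in the right half-plane. -/
lemma analyticAt_digammaSum_sqrt_of_ne {z : ℂ} (hz : ‖z‖ + z.re < 9 / 2) (h0 : z ≠ 0) :
    AnalyticAt ℂ (fun z : ℂ => digammaSum (z ^ (1 / 2 : ℂ))) z := by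
  have key : |(z ^ (1 / 2 : ℂ)).re| < 3 / 2 := by
    rw [← sq_lt_sq₀ (abs_nonneg _) (by norm_num), sq_abs]
    linarith [cpow_half_re_sq_le z]
  by_cases hs : z ∈ Complex.slitPlane
  · refine AnalyticAt.fun_comp (analyticAt_digammaSum key) ?_
    exact AnalyticAt.cpow analyticAt_id analyticAt_const hs
  · have hs' : -z ∈ Complex.slitPlane := by
      rw [Complex.mem_slitPlane_iff, not_or, not_lt, not_not] at hs
      refine Complex.mem_slitPlane_iff.2 (Or.inl ?_)
      rw [Complex.neg_re, neg_pos]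
      exact lt_of_le_of_ne hs.1 fun h => h0 (Complex.ext h hs.2)
    have e : (fun z : ℂ => digammaSum (z ^ (1 / 2 : ℂ)))
        = fun z : ℂ => digammaSum (Complex.I * (-z) ^ (1 / 2 : ℂ)) := by
      funext z
      refine digammaSum_eq_of_sq_eq ?_
      rw [mul_pow, cpow_half_sq, cpow_half_sq, Complex.I_sq]; ring
    have e2 : (Complex.I * (-z) ^ (1 / 2 : ℂ)) ^ 2 = (z ^ (1 / 2 : ℂ)) ^ 2 := by
      rw [mul_pow, cpow_half_sq, cpow_half_sq, Complex.I_sq]; ring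
    rw [e]
    refine AnalyticAt.fun_comp (analyticAt_digammaSum ?_) ?_
    · rcases sq_eq_sq_iff_eq_or_eq_neg.1 e2 with h | h
      · rw [h]; exact key
      · rw [h, Complex.neg_re, abs_neg]; exact key
    · exact analyticAt_const.mul (AnalyticAt.cpow analyticAt_id.neg analyticAt_const hs')

lemma analyticAt_digammaSum_sqrt {z : ℂ} (hz : ‖z‖ + z.re < 9 / 2) :
    AnalyticAt ℂ (fun z : ℂ => digammaSum (z ^ (1 / 2 : ℂ))) z := by
  by_cases h0 : z = 0
  · subst h0
    -- The root is not analytic at `0`, but it is continuous there, so the singularity of the even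
    -- combination is removable.
    apply Complex.analyticAt_of_differentiable_on_punctured_nhds_of_continuousAt
    · have hopen : IsOpen {z : ℂ | ‖z‖ + z.re < 9 / 2} :=
        isOpen_lt (continuous_norm.add Complex.continuous_re) continuous_const
      filter_upwards [self_mem_nhdsWithin, mem_nhdsWithin_of_mem_nhds (hopen.mem_nhds hz)]
        with z h1 h2
      exact (analyticAt_digammaSum_sqrt_of_ne h2 h1).differentiableAt
    · refine ContinuousAt.comp' (f := fun z : ℂ => z ^ (1 / 2 : ℂ)) ?_ ?_
      · refine (analyticAt_digammaSum ?_).continuousAt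
        rw [Complex.zero_cpow (by norm_num)]; norm_num
      · exact Complex.continuousAt_cpow_const_of_re_pos (by simp) (by norm_num)
  · exact analyticAt_digammaSum_sqrt_of_ne hz h0

lemma analyticAt_f {x : ℝ} (hx : 0 < x) : AnalyticAt ℝ f x := by
  have hz : ‖((9 / 4 - x : ℝ) : ℂ)‖ + ((9 / 4 - x : ℝ) : ℂ).re < 9 / 2 := by
    rw [Complex.norm_real, Complex.ofReal_re, Real.norm_eq_abs]
    rcases abs_cases (9 / 4 - x) with h | h <;> linarith
  have h1 := (analyticAt_digammaSum_sqrt hz).restrictScalars (𝕜 := ℝ)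
  have h2 : AnalyticAt ℝ (fun x : ℝ => ((9 / 4 - x : ℝ) : ℂ)) x := by
    have : AnalyticAt ℝ (fun x : ℝ => 9 / 4 - x) x := by fun_prop
    exact AnalyticAt.fun_comp (Complex.ofRealCLM.analyticAt _) this
  exact AnalyticAt.fun_comp (g := Complex.reCLM) (Complex.reCLM.analyticAt _)
    (AnalyticAt.fun_comp (f := fun x : ℝ => ((9 / 4 - x : ℝ) : ℂ)) h1 h2)

lemma isOpen_quadrant : IsOpen quadrant := isOpen_Ioi.prod isOpen_Ioi

lemma analyticAt_F (e₁ e₂ : ℝ) {p : ℝ × ℝ} (hp : p ∈ quadrant) : AnalyticAt ℝ (F e₁ e₂) p := by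
  have h1 : 0 < p.1 := hp.1
  have h2 : 0 < p.2 := hp.2
  have a1 : AnalyticAt ℝ (fun q : ℝ × ℝ => f q.1) p := AnalyticAt.fun_comp (analyticAt_f h1) analyticAt_fst
  have a2 : AnalyticAt ℝ (fun q : ℝ × ℝ => Real.log q.2) p :=
    AnalyticAt.fun_comp (analyticAt_log h2) analyticAt_snd
  have a3 : AnalyticAt ℝ (fun q : ℝ × ℝ => 1 / q.2 ^ 2) p :=
    analyticAt_const.div (analyticAt_snd.pow 2) (by positivity)
  have b1 : AnalyticAt ℝ (fun q : ℝ × ℝ => q.1) p := analyticAt_fst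
  have b2 : AnalyticAt ℝ (fun q : ℝ × ℝ => q.2) p := analyticAt_snd
  unfold F F₁ F₂
  fun_prop

end
end DeSitter

/-! ### Vertical lines: number of solutions and bounds on `h`. -/

open Set Topology Filter
namespace DeSitter
noncomputable section

lemma exists_deriv_zeros {g g' : ℝ → ℝ} (hg : ∀ u > 0, HasDerivAt g (g' u) u) {a b : ℝ}
    (ha : 0 < a) (hab : a < b) (h : g a = g b) : ∃ u ∈ Ioo a b, g' u = 0 :=
  exists_hasDerivAt_eq_zero hab
    (fun x hx => (hg x (ha.trans_le hx.1)).continuousAt.continuousWithinAt) h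
    (fun x hx => hg x (ha.trans hx.1))

/-- With `u = h ^ 2`, the function `h ^ 2 * F` becomes `g u`, whose second derivative is `2 * A - c
/ u`. By Rolle, four zeros of `g` give two zeros of the latter, which forces `A = c = 0`; but `A = c
^ 2 - 1 / 30`. -/
lemma no_four_zeros (e₁ e₂ x : ℝ) {h : Fin 4 → ℝ} (hm : StrictMono h) (h0 : 0 < h 0)
    (hz : ∀ i, F e₁ e₂ (x, h i) = 0) : False := by
  set A : ℝ := x ^ 2 / 4 - x + 29 / 30
  set B : ℝ := x / 2 + e₂ / 30 - 1
  set c : ℝ := x / 2 - 1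
  set g : ℝ → ℝ := fun u => A * u ^ 2 - B * u - e₁ / 30 - c * (u * Real.log u + f x * u)
  set g1 : ℝ → ℝ := fun u => A * (2 * u) - B - c * (Real.log u + 1 + f x)
  have hg : ∀ u > 0, HasDerivAt g (g1 u) u := by
    intro u hu
    have h1 := (((hasDerivAt_pow 2 u).const_mul A).sub ((hasDerivAt_id u).const_mul B)).sub_const
      (e₁ / 30)
    have h2 := ((Real.hasDerivAt_mul_log hu.ne').add ((hasDerivAt_id u).const_mul (f x))).const_mul c
    refine (h1.sub h2).congr_deriv ?_
    simp [g1]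
  have hg1 : ∀ u > 0, HasDerivAt g1 (2 * A - c * u⁻¹) u := by
    intro u hu
    have h1 := (((hasDerivAt_id u).const_mul 2).const_mul A).sub_const B
    have h2 := ((((Real.hasDerivAt_log hu.ne').add_const 1).add_const (f x))).const_mul c
    refine (h1.sub h2).congr_deriv ?_
    simp; ring
  have hpos : ∀ i, 0 < h i := fun i => h0.trans_le (hm.monotone (Fin.zero_le i))
  have hzero : ∀ i, g (h i ^ 2) = 0 := by
    intro i
    have e : g (h i ^ 2) = h i ^ 2 * F e₁ e₂ (x, h i) := by
      have := (hpos i).ne'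
      simp only [g, F, F₁, F₂, Real.log_pow, A, B, c]
      field_simp
      push_cast
      ring
    rw [e, hz, mul_zero]
  have sq : ∀ {i j}, i < j → h i ^ 2 < h j ^ 2 := fun {i j} hij =>
    pow_lt_pow_left₀ (hm hij) (hpos i).le two_ne_zero
  have hp2 : ∀ i, 0 < h i ^ 2 := fun i => pow_pos (hpos i) 2
  obtain ⟨u, hu, hu0⟩ := exists_deriv_zeros hg (hp2 0) (sq (show (0 : Fin 4) < 1 by decide))
    ((hzero 0).trans (hzero 1).symm)
  obtain ⟨v, hv, hv0⟩ := exists_deriv_zeros hg (hp2 1) (sq (show (1 : Fin 4) < 2 by decide))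
    ((hzero 1).trans (hzero 2).symm)
  obtain ⟨w, hw, hw0⟩ := exists_deriv_zeros hg (hp2 2) (sq (show (2 : Fin 4) < 3 by decide))
    ((hzero 2).trans (hzero 3).symm)
  have pu := (hp2 0).trans hu.1
  have pv := (hp2 1).trans hv.1
  obtain ⟨y, hy, hy0⟩ := exists_deriv_zeros hg1 pu (hu.2.trans hv.1) (hu0.trans hv0.symm)
  obtain ⟨z, hz, hz0⟩ := exists_deriv_zeros hg1 pv (hv.2.trans hw.1) (hv0.trans hw0.symm)
  have py := pu.trans hy.1
  have pz := pv.trans hz.1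
  have hyz : y < z := hy.2.trans hz.1
  have ey : 2 * A * y = c := by field_simp at hy0; linarith
  have ez : 2 * A * z = c := by field_simp at hz0; linarith
  have hA : A = 0 := by
    have : A * (z - y) = 0 := by linarith
    rcases mul_eq_zero.1 this with h | h
    · exact h
    · linarith
  have hc : c = 0 := by rw [← ey, hA]; ring
  have : A = c ^ 2 - 1 / 30 := by simp only [A, c]; ring
  rw [hA, hc] at this
  norm_num at this

/-- Each vertical line meets the solution set in at most three points. -/
lemma encard_vertical_le (e₁ e₂ x : ℝ) :
    (solutionSet e₁ e₂ ∩ {p | p.1 = x}).encard ≤ 3 := by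
  by_contra! hlt
  obtain ⟨t, ht, hcard⟩ := Set.exists_subset_encard_eq
    (show (4 : ℕ∞) ≤ (solutionSet e₁ e₂ ∩ {p | p.1 = x}).encard from Order.add_one_le_of_lt hlt)
  have hfin : t.Finite := Set.finite_of_encard_eq_coe (k := 4) hcard
  have hinj : InjOn Prod.snd t := fun p hp q hq h =>
    Prod.ext ((ht hp).2.trans (ht hq).2.symm) h
  have hc2 : (hfin.toFinset.image Prod.snd).card = 4 := by
    rw [Finset.card_image_of_injOn (by simpa using hinj)]
    rw [hfin.encard_eq_coe_toFinset_card] at hcard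
    exact_mod_cast hcard
  set h : Fin 4 → ℝ := fun i => (hfin.toFinset.image Prod.snd).orderEmbOfFin hc2 i
  have hmem : ∀ i, (x, h i) ∈ solutionSet e₁ e₂ := by
    intro i
    have := (hfin.toFinset.image Prod.snd).orderEmbOfFin_mem hc2 i
    obtain ⟨p, hp, hpi⟩ := Finset.mem_image.1 this
    have hp' := ht (hfin.mem_toFinset.1 hp)
    have : (x, h i) = p := Prod.ext hp'.2.symm hpi.symm
    rw [this]; exact hp'.1
  exact no_four_zeros e₁ e₂ x (h := h)
    (fun _ _ hij => ((hfin.toFinset.image Prod.snd).orderEmbOfFin hc2).strictMono hij) (hmem 0).1.2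
    fun i => (hmem i).2

/-- The abscissas near which the solution set can escape to `h = 0` or `h = ∞`. -/
def exceptionalSet : Set ℝ := {x | (x / 2 - 1) * (x ^ 2 / 4 - x + 29 / 30) = 0}

lemma finite_exceptionalSet : exceptionalSet.Finite := by
  refine Set.Finite.subset (s := {2, 2 - 2 / √30, 2 + 2 / √30}) (by simp) ?_
  intro x hx
  have h30 : (√30) ^ 2 = (30 : ℝ) := Real.sq_sqrt (by norm_num)
  have hpos : 0 < √(30 : ℝ) := by positivity
  have : (x - 2) * ((x - (2 - 2 / √30)) * (x - (2 + 2 / √30))) = 0 := by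
    have e : (x - (2 - 2 / √30)) * (x - (2 + 2 / √30)) = 4 * (x ^ 2 / 4 - x + 29 / 30) := by
      have : (2 / √30) ^ 2 = 4 / 30 := by rw [div_pow, h30]; norm_num
      linear_combination -this
    rw [e]
    have : (x / 2 - 1) * (x ^ 2 / 4 - x + 29 / 30) = 0 := hx
    linear_combination 8 * this
  simp only [mul_eq_zero, sub_eq_zero] at this
  simpa using this

/-- Away from the exceptional abscissas, the solution set is locally vertically bounded. -/
lemma vertically_bounded (e₁ e₂ : ℝ) {x₀ : ℝ} (h0 : 0 < x₀) (hx₀ : x₀ ∉ exceptionalSet) :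
    ∃ a > 0, ∃ b, ∀ᶠ x in 𝓝 x₀, ∀ h > 0, F e₁ e₂ (x, h) = 0 → h ∈ Icc a b := by
  set A : ℝ → ℝ := fun x => x ^ 2 / 4 - x + 29 / 30
  set B : ℝ → ℝ := fun x => x / 2 + e₂ / 30 - 1
  set c : ℝ → ℝ := fun x => x / 2 - 1
  have hA0 : A x₀ ≠ 0 := fun h => hx₀ (by show c x₀ * A x₀ = 0; rw [h, mul_zero])
  have hc0 : c x₀ ≠ 0 := fun h => hx₀ (by show c x₀ * A x₀ = 0; rw [h, zero_mul])
  have cA : Continuous A := by fun_prop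
  have cB : Continuous B := by fun_prop
  have cc : Continuous c := by fun_prop
  have cf : ContinuousAt f x₀ := (analyticAt_f h0).continuousAt
  have key : ∀ x h : ℝ, 0 < h → F e₁ e₂ (x, h) = 0 →
      A x * h ^ 4 = B x * h ^ 2 + e₁ / 30 + c x * (2 * (h ^ 2 * Real.log h) + f x * h ^ 2) := by
    intro x h hh hF
    have e : h ^ 2 * F e₁ e₂ (x, h) = A x * h ^ 4 - B x * h ^ 2 - e₁ / 30
        - c x * (2 * (h ^ 2 * Real.log h) + f x * h ^ 2) := by
      simp only [F, F₁, F₂, A, B, c]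
      field_simp
    rw [hF, mul_zero] at e
    linarith
  have tx : ∀ (l : Filter ℝ) {g : ℝ → ℝ}, ContinuousAt g x₀ →
      Tendsto (fun p : ℝ × ℝ => g p.1) (𝓝 x₀ ×ˢ l) (𝓝 (g x₀)) := fun l g hg =>
    hg.tendsto.comp tendsto_fst
  have ty : ∀ {l : Filter ℝ} {g : ℝ → ℝ} {m : Filter ℝ}, Tendsto g l m →
      Tendsto (fun p : ℝ × ℝ => g p.2) (𝓝 x₀ ×ˢ l) m := fun hg => hg.comp tendsto_snd
  have hpos0 : ∀ᶠ p : ℝ × ℝ in 𝓝 x₀ ×ˢ 𝓝[>] (0 : ℝ), 0 < p.2 :=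
    tendsto_snd.eventually (eventually_mem_nhdsWithin)
  -- After division by `h ^ 4` every term except `A x` tends to `0`, and `A x₀ ≠ 0`.
  have top : ∀ᶠ p : ℝ × ℝ in 𝓝 x₀ ×ˢ atTop, F e₁ e₂ p ≠ 0 := by
    have i2 : Tendsto (fun h : ℝ => (h ^ 2)⁻¹) atTop (𝓝 0) :=
      (tendsto_pow_atTop two_ne_zero).inv_tendsto_atTop
    have i4 : Tendsto (fun h : ℝ => (h ^ 4)⁻¹) atTop (𝓝 0) :=
      (tendsto_pow_atTop (by norm_num)).inv_tendsto_atTop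
    have il : Tendsto (fun h : ℝ => Real.log h / h ^ 2) atTop (𝓝 0) := by
      simpa using (isLittleO_log_rpow_atTop (r := 2) (by norm_num)).tendsto_div_nhds_zero
    have lim := (((tx atTop cB.continuousAt).mul (ty i2)).add ((ty i4).const_mul (e₁ / 30))).add
      ((tx atTop cc.continuousAt).mul (((ty il).const_mul 2).add ((tx atTop cf).mul (ty i2))))
    simp only [mul_zero, add_zero] at lim
    have ne := (((tx atTop cA.continuousAt).sub lim).eventually_ne (by simpa using hA0))
    filter_upwards [ne, tendsto_snd.eventually (eventually_gt_atTop (0 : ℝ))]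
      with p hp hp0 hF
    apply hp
    have := key p.1 p.2 hp0 hF
    field_simp
    linear_combination 30 * this
  have bot : ∀ᶠ p : ℝ × ℝ in 𝓝 x₀ ×ˢ 𝓝[>] (0 : ℝ), F e₁ e₂ p ≠ 0 := by
    have j : ∀ n : ℕ, n ≠ 0 → Tendsto (fun h : ℝ => h ^ n) (𝓝[>] (0 : ℝ)) (𝓝 0) := fun n hn => by
      simpa [hn] using ((continuous_pow n).tendsto (0 : ℝ)).mono_left nhdsWithin_le_nhds
    -- If `e₁ ≠ 0`, the constant term of `h ^ 2 * F` dominates as `h → 0`. If `e₁ = 0`, the dominant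
    -- term of `F` is the logarithm, whose coefficient does not vanish because `c x₀ ≠ 0`.
    by_cases he : e₁ = 0
    · have il : Tendsto (fun h : ℝ => (Real.log h)⁻¹) (𝓝[>] (0 : ℝ)) (𝓝 0) :=
        Real.tendsto_log_nhdsGT_zero.inv_tendsto_atBot
      have lim := ((((tx (𝓝[>] 0) cA.continuousAt).mul (ty (j 2 two_ne_zero))).sub
        (tx (𝓝[>] 0) cB.continuousAt)).sub ((tx (𝓝[>] 0) cc.continuousAt).mul
          (tx (𝓝[>] 0) cf))).mul (ty il)
      simp only [mul_zero] at lim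
      have ne := (((tx (𝓝[>] 0) cc.continuousAt).const_mul 2).sub lim).eventually_ne
        (show 2 * c x₀ - 0 ≠ 0 by simpa using hc0)
      filter_upwards [ne, hpos0, tendsto_snd.eventually
        (Real.tendsto_log_nhdsGT_zero.eventually (eventually_lt_atBot 0))] with p hp hp0 hl hF
      apply hp
      have h1 := key p.1 p.2 hp0 hF
      have hl' : Real.log p.2 ≠ 0 := hl.ne
      rw [he] at h1
      have h2 : A p.1 * p.2 ^ 2 = B p.1 + c p.1 * (2 * Real.log p.2 + f p.1) := by
        have : p.2 ^ 2 * (A p.1 * p.2 ^ 2) =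
            p.2 ^ 2 * (B p.1 + c p.1 * (2 * Real.log p.2 + f p.1)) := by linear_combination h1
        exact mul_left_cancel₀ (pow_pos hp0 2).ne' this
      field_simp
      linear_combination -h2
    · have il : Tendsto (fun h : ℝ => h ^ 2 * Real.log h) (𝓝[>] (0 : ℝ)) (𝓝 0) := by
        have := tendsto_log_mul_rpow_nhdsGT_zero (r := 2) (by norm_num)
        simpa [mul_comm] using this
      have lim := (((tx (𝓝[>] 0) cA.continuousAt).mul (ty (j 4 (by norm_num)))).sub
        ((tx (𝓝[>] 0) cB.continuousAt).mul (ty (j 2 two_ne_zero)))).sub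
        ((tx (𝓝[>] 0) cc.continuousAt).mul (((ty il).const_mul 2).add
          ((tx (𝓝[>] 0) cf).mul (ty (j 2 two_ne_zero)))))
      simp only [mul_zero, add_zero, sub_zero] at lim
      filter_upwards [lim.eventually_ne (show (0 : ℝ) ≠ e₁ / 30 by positivity), hpos0]
        with p hp hp0 hF
      apply hp
      linear_combination key p.1 p.2 hp0 hF
  obtain ⟨P, hP, R, hR, hPR⟩ := eventually_prod_iff.1 top
  obtain ⟨P', hP', R', hR', hPR'⟩ := eventually_prod_iff.1 bot
  obtain ⟨b, hb⟩ := eventually_atTop.1 hR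
  obtain ⟨a, ha, hab⟩ := (mem_nhdsGT_iff_exists_Ioo_subset).1 hR'
  refine ⟨a, ha, b, ?_⟩
  filter_upwards [hP, hP'] with x hx hx' h hh hF
  refine ⟨?_, ?_⟩
  · by_contra! hlt
    exact hPR' hx' (hab ⟨hh, hlt⟩) hF
  · by_contra! hlt
    exact hPR hx (hb h hlt.le) hF

end
end DeSitter

/-! ### Local normal forms of an analytic function of two variables. -/

namespace DeSitter
noncomputable section
open Filter Metric

/-- Hadamard's lemma for analytic functions. -/
lemma exists_hadamard {E G : Type*} [NormedAddCommGroup E] [NormedSpace ℝ E]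
    [NormedAddCommGroup G] [NormedSpace ℝ G] [CompleteSpace G] {g : E → G} {x : E}
    (hg : AnalyticAt ℝ g x) :
    ∃ L : E → E →L[ℝ] G, AnalyticAt ℝ L x ∧ ∀ᶠ y in 𝓝 x, g y = g x + L y (y - x) := by
  obtain ⟨p, r, hp⟩ := hg
  -- `L` is the sum of the shifted power series, in which one argument of each multilinear term is
  -- left open.
  have hrad : 0 < p.shift.radius := by
    rw [FormalMultilinearSeries.radius_shift]; exact hp.r_pos.trans_le hp.r_le
  have h1 := (p.shift.hasFPowerSeriesOnBall hrad).comp_sub x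
  rw [zero_add] at h1
  have h2 := (h1.unshift (z := g x)).hasFPowerSeriesAt
  have h3 : p.shift.unshift (g x) = p := by
    ext n v
    cases n with
    | zero => 
      have := hp.coeff_zero v
      simp [FormalMultilinearSeries.unshift, this]
    | succ n =>
      simp [FormalMultilinearSeries.unshift, FormalMultilinearSeries.shift]
  rw [h3] at h2
  refine ⟨_, h1.analyticAt, ?_⟩
  filter_upwards [hp.hasFPowerSeriesAt.eventually_hasSum_sub, h2.eventually_hasSum_sub]
    with y hy hy'
  exact hy.unique hy'

lemma fderiv_of_hadamard {E G : Type*} [NormedAddCommGroup E] [NormedSpace ℝ E]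
    [NormedAddCommGroup G] [NormedSpace ℝ G] [CompleteSpace G] {g : E → G} {x : E}
    {L : E → E →L[ℝ] G} (hL : AnalyticAt ℝ L x)
    (h : ∀ᶠ y in 𝓝 x, g y = g x + L y (y - x)) :
    ∀ᶠ y in 𝓝 x, fderiv ℝ g y = (fderiv ℝ L y).flip (y - x) + L y := by
  filter_upwards [h.eventually_nhds, hL.eventually_analyticAt] with y hy hLy
  have h1 : HasFDerivAt (fun y => g x + L y (y - x)) ((fderiv ℝ L y).flip (y - x) + L y) y := by
    have := (hLy.differentiableAt.hasFDerivAt.clm_apply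
      ((hasFDerivAt_id y).sub_const x)).const_add (g x)
    refine this.congr_fderiv ?_
    ext v
    simp [add_comm]
  exact (h1.congr_of_eventuallyEq hy).fderiv

/-- An analytic self-map of the plane with injective derivative at `p` is a local analytic
diffeomorphism onto a ball. -/
lemma exists_analytic_chart {G : ℝ × ℝ → ℝ × ℝ} {p : ℝ × ℝ} (hG : AnalyticAt ℝ G p)
    (hinj : ∀ v, fderiv ℝ G p v = 0 → v = 0) {N : Set (ℝ × ℝ)} (hN : N ∈ 𝓝 p) :
    ∃ Φ : OpenPartialHomeomorph (ℝ × ℝ) (ℝ × ℝ), ∃ δ > 0, p ∈ Φ.source ∧ Φ.source ⊆ N ∧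
      ⇑Φ = G ∧ Φ.target = ball (G p) δ ∧ AnalyticOnNhd ℝ G Φ.source ∧
      AnalyticOnNhd ℝ Φ.symm Φ.target := by
  have hinj' : Function.Injective (fderiv ℝ G p : (ℝ × ℝ) →ₗ[ℝ] (ℝ × ℝ)) :=
    (injective_iff_map_eq_zero _).2 hinj
  let i : (ℝ × ℝ) ≃L[ℝ] (ℝ × ℝ) := (LinearEquiv.ofInjectiveEndo _ hinj').toContinuousLinearEquiv
  have hi : fderiv ℝ G p = i := by ext <;> rfl
  have hs : HasStrictFDerivAt G (i : (ℝ × ℝ) →L[ℝ] (ℝ × ℝ)) p := hi ▸ hG.hasStrictFDerivAt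
  let R := hs.toOpenPartialHomeomorph G
  -- Invertible operators form an open set, so the derivative stays invertible near `p`; this makes
  -- the inverse analytic on the whole target and not only at `G p`.
  have hgood : ∀ᶠ q in 𝓝 p, q ∈ N ∧ AnalyticAt ℝ G q ∧
      ∃ j : (ℝ × ℝ) ≃L[ℝ] (ℝ × ℝ), fderiv ℝ G q = j := by
    have h1 : ∀ᶠ q in 𝓝 p, fderiv ℝ G q ∈ range ((↑) : ((ℝ × ℝ) ≃L[ℝ] (ℝ × ℝ)) → _) := by
      have := hG.fderiv.continuousAt
      exact this (by rw [hi]; exact ContinuousLinearEquiv.nhds i)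
    filter_upwards [hN, hG.eventually_analyticAt, h1] with q a b c
    exact ⟨a, b, c.imp fun j hj => hj.symm⟩
  obtain ⟨M, hM, hMo, hpM⟩ := _root_.mem_nhds_iff.1 hgood
  let R1 := R.restrOpen M hMo
  have hpR : p ∈ R1.source := ⟨hs.mem_toOpenPartialHomeomorph_source, hpM⟩
  have hR1 : ⇑R1 = G := rfl
  obtain ⟨δ, hδ, hball⟩ := Metric.isOpen_iff.1 R1.open_target (G p) (R1.map_source hpR)
  let Φ := (R1.symm.restrOpen (ball (G p) δ) isOpen_ball).symm
  have htarget : Φ.target = ball (G p) δ := by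
    show R1.target ∩ ball (G p) δ = _
    exact inter_eq_right.2 hball
  have hsub : Φ.source ⊆ R1.source := by
    intro q hq
    have := Φ.map_source hq
    have h2 : q = R1.symm (Φ q) := (Φ.left_inv hq).symm
    rw [h2]
    exact R1.map_target (hball (htarget ▸ this))
  have hpΦ : p ∈ Φ.source := by
    have : Φ.symm (G p) ∈ Φ.source := Φ.map_target (by rw [htarget]; exact mem_ball_self hδ)
    have e : Φ.symm (G p) = p := R1.left_inv hpR
    rwa [e] at this
  refine ⟨Φ, δ, hδ, hpΦ, fun q hq => (hM (hsub hq).2).1, rfl, htarget,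
    fun q hq => (hM (hsub hq).2).2.1, fun a ha => ?_⟩
  have hq := Φ.map_target ha
  obtain ⟨-, h1, j, hj⟩ := hM (hsub hq).2
  exact Φ.analyticAt_symm ha h1 hj

/-- At a critical point, an analytic function of the plane is a quadratic form with analytic
coefficients, given by the Hessian at the point itself. -/
lemma exists_quadratic_form {G : ℝ × ℝ → ℝ} {p : ℝ × ℝ} (hG : AnalyticAt ℝ G p)
    (h0 : fderiv ℝ G p = 0) : ∃ a b c : ℝ × ℝ → ℝ, AnalyticAt ℝ a p ∧ AnalyticAt ℝ b p ∧
      AnalyticAt ℝ c p ∧ (∀ᶠ q in 𝓝 p, G q = G p + (a q * (q.1 - p.1) ^ 2 +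
        b q * ((q.1 - p.1) * (q.2 - p.2)) + c q * (q.2 - p.2) ^ 2)) ∧
      (hessian G p).det = 4 * a p * c p - b p ^ 2 := by
  obtain ⟨L, hL, hLG⟩ := exists_hadamard hG
  obtain ⟨M, hM, hML⟩ := exists_hadamard hL
  have fG := fderiv_of_hadamard hL hLG
  have fL := fderiv_of_hadamard hM hML
  have hLp : L p = 0 := by simpa [h0] using fG.self_of_nhds.symm
  have hMp : fderiv ℝ L p = M p := by simpa using fL.self_of_nhds
  have e : ∀ v w, AnalyticAt ℝ (fun q => M q v w) p := fun v w =>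
    ((hM.contDiffAt.clm_apply contDiffAt_const).clm_apply contDiffAt_const).analyticAt
  refine ⟨fun q => M q (1, 0) (1, 0), fun q => M q (1, 0) (0, 1) + M q (0, 1) (1, 0),
    fun q => M q (0, 1) (0, 1), e _ _, (e _ _).add (e _ _), e _ _, ?_, ?_⟩
  · filter_upwards [hLG, hML] with q hq hq'
    have hv : q - p = (q.1 - p.1) • ((1 : ℝ), (0 : ℝ)) + (q.2 - p.2) • ((0 : ℝ), (1 : ℝ)) := by
      ext <;> simp
    rw [hq, hq', hLp, hv]
    simp only [map_add, map_smul, zero_add, add_apply, smul_apply, smul_eq_mul]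
    ring
  · have h2 : ∀ w u, fderiv ℝ (fderiv ℝ G) p w u = M p u w + M p w u := by
      intro w u
      have h3 := (hG.fderiv.differentiableAt.hasFDerivAt.clm_apply
        (hasFDerivAt_const u p)).fderiv
      have h4 := (((hL.fderiv.differentiableAt.hasFDerivAt.clm_apply
        (hasFDerivAt_const u p)).clm_apply ((hasFDerivAt_id p).sub_const p)).add
        (hL.differentiableAt.hasFDerivAt.clm_apply (hasFDerivAt_const u p)))
      have h5 : (fun y => fderiv ℝ G y u) =ᶠ[𝓝 p]
          fun y => fderiv ℝ L y u (y - p) + L y u := by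
        filter_upwards [fG] with y hy
        rw [hy]; rfl
      have h6 := (h4.congr_of_eventuallyEq h5).fderiv.symm.trans h3
      have h7 := DFunLike.congr_fun h6 w
      simpa [hMp] using h7.symm
    have hH : ∀ i j, hessian G p i j = M p (![((1 : ℝ), (0 : ℝ)), (0, 1)] j)
        (![((1 : ℝ), (0 : ℝ)), (0, 1)] i) + M p (![((1 : ℝ), (0 : ℝ)), (0, 1)] i)
        (![((1 : ℝ), (0 : ℝ)), (0, 1)] j) := by
      intro i j
      simp only [hessian, Matrix.of_apply, h2]
    rw [Matrix.det_fin_two, hH, hH, hH, hH]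
    simp
    ring

/-- A local analytic diffeomorphism straightening the level set of `G` through `p` to a line or to
a pair of crossing lines. -/
structure LevelChart (G : ℝ × ℝ → ℝ) (p : ℝ × ℝ) (N : Set (ℝ × ℝ)) where
  Φ : OpenPartialHomeomorph (ℝ × ℝ) (ℝ × ℝ)
  δ : ℝ
  δ_pos : 0 < δ
  mem_source : p ∈ Φ.source
  source_subset : Φ.source ⊆ N
  map_base : Φ p = 0
  target_eq : Φ.target = ball 0 δ
  analytic : AnalyticOnNhd ℝ Φ Φ.source
  analytic_symm : AnalyticOnNhd ℝ Φ.symm Φ.target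
  normal_form : (∀ q ∈ Φ.source, G q = G p + (Φ q).2) ∨
    ∀ q ∈ Φ.source, G q = G p + (Φ q).1 * (Φ q).2

/-- The coordinates of the chart are `g₁` and `g₂`; the determinant condition makes the derivative
of the pair injective. -/
lemma nonempty_levelChart_aux {G g₁ g₂ : ℝ × ℝ → ℝ} {p : ℝ × ℝ} {N : Set (ℝ × ℝ)}
    (hN : N ∈ 𝓝 p) (a₁ : AnalyticAt ℝ g₁ p) (a₂ : AnalyticAt ℝ g₂ p) (z₁ : g₁ p = 0)
    (z₂ : g₂ p = 0) (hdet : fderiv ℝ g₁ p (1, 0) * fderiv ℝ g₂ p (0, 1) ≠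
      fderiv ℝ g₁ p (0, 1) * fderiv ℝ g₂ p (1, 0))
    (hG : (∀ᶠ q in 𝓝 p, G q = G p + g₂ q) ∨ ∀ᶠ q in 𝓝 p, G q = G p + g₁ q * g₂ q) :
    Nonempty (LevelChart G p N) := by
  have hf : fderiv ℝ (fun q => (g₁ q, g₂ q)) p = (fderiv ℝ g₁ p).prod (fderiv ℝ g₂ p) :=
    (a₁.differentiableAt.hasFDerivAt.prodMk a₂.differentiableAt.hasFDerivAt).fderiv
  have hinj : ∀ v, fderiv ℝ (fun q => (g₁ q, g₂ q)) p v = 0 → v = 0 := by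
    rintro ⟨x, y⟩ hv
    rw [hf, show (x, y) = x • ((1 : ℝ), (0 : ℝ)) + y • ((0 : ℝ), (1 : ℝ)) by simp] at hv
    obtain ⟨h1, h2⟩ := Prod.mk_eq_zero.1 hv
    rw [map_add, map_smul, map_smul, smul_eq_mul, smul_eq_mul] at h1 h2
    have hd := sub_ne_zero.2 hdet
    have hx : (fderiv ℝ g₁ p (1, 0) * fderiv ℝ g₂ p (0, 1) -
      fderiv ℝ g₁ p (0, 1) * fderiv ℝ g₂ p (1, 0)) * x = 0 := by
      linear_combination fderiv ℝ g₂ p (0, 1) * h1 - fderiv ℝ g₁ p (0, 1) * h2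
    have hy : (fderiv ℝ g₁ p (1, 0) * fderiv ℝ g₂ p (0, 1) -
      fderiv ℝ g₁ p (0, 1) * fderiv ℝ g₂ p (1, 0)) * y = 0 := by
      linear_combination fderiv ℝ g₁ p (1, 0) * h2 - fderiv ℝ g₂ p (1, 0) * h1
    rw [(mul_eq_zero.1 hx).resolve_left hd, (mul_eq_zero.1 hy).resolve_left hd]
    rfl
  have hz : (g₁ p, g₂ p) = 0 := by rw [z₁, z₂]; rfl
  rcases hG with hG | hG
  all_goals
    obtain ⟨Φ, δ, hδ, hp, hsub, hcoe, ht, an, an'⟩ :=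
      exists_analytic_chart (a₁.prod a₂) hinj (inter_mem hN hG)
    refine ⟨⟨Φ, δ, hδ, hp, fun q hq => (hsub hq).1, by rw [hcoe]; exact hz, by rw [ht, hz],
      hcoe ▸ an, an', ?_⟩⟩
  · exact Or.inl fun q hq => by rw [(hsub hq).2, hcoe]
  · exact Or.inr fun q hq => by rw [(hsub hq).2, hcoe]

theorem nonempty_levelChart {G : ℝ × ℝ → ℝ} {p : ℝ × ℝ} (hG : AnalyticAt ℝ G p)
    (h : fderiv ℝ G p ≠ 0 ∨ (hessian G p).det < 0) {N : Set (ℝ × ℝ)} (hN : N ∈ 𝓝 p) :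
    Nonempty (LevelChart G p N) := by
  have fst' : ∀ v, fderiv ℝ (fun q : ℝ × ℝ => q.1 - p.1) p v = v.1 := fun v => by
    rw [((hasFDerivAt_fst (p := p)).sub_const p.1).fderiv]; rfl
  have snd' : ∀ v, fderiv ℝ (fun q : ℝ × ℝ => q.2 - p.2) p v = v.2 := fun v => by
    rw [((hasFDerivAt_snd (p := p)).sub_const p.2).fderiv]; rfl
  have an1 : AnalyticAt ℝ (fun q : ℝ × ℝ => q.1 - p.1) p := analyticAt_fst.sub analyticAt_const
  have an2 : AnalyticAt ℝ (fun q : ℝ × ℝ => q.2 - p.2) p := analyticAt_snd.sub analyticAt_const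
  by_cases h0 : fderiv ℝ G p = 0
  · have hdet := h.resolve_left (not_not.2 h0)
    obtain ⟨a, b, c, ha, hb, hc, hq, hH⟩ := exists_quadratic_form hG h0
    rw [hH] at hdet
    have hdisc : 0 < b p ^ 2 - 4 * a p * c p := by linarith
    -- `D` is a root of the discriminant. Its sign is chosen to agree with that of `b p`, so that no
    -- cancellation occurs in `κ = (b + D) / 2` and `κ p ≠ 0`.
    obtain ⟨D, hD, hD2, hDb⟩ : ∃ D : ℝ × ℝ → ℝ, AnalyticAt ℝ D p ∧
        (∀ᶠ q in 𝓝 p, D q ^ 2 = b q ^ 2 - 4 * a q * c q) ∧ 0 ≤ b p * D p := by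
      have an : AnalyticAt ℝ (fun q => b q ^ 2 - 4 * a q * c q) p := by fun_prop
      have hs : AnalyticAt ℝ (fun q => √(b q ^ 2 - 4 * a q * c q)) p :=
        AnalyticAt.fun_comp (g := Real.sqrt) (Real.contDiffAt_sqrt (n := ⊤) hdisc.ne').analyticAt an
      have hp : ∀ᶠ q in 𝓝 p, √(b q ^ 2 - 4 * a q * c q) ^ 2 = b q ^ 2 - 4 * a q * c q := by
        filter_upwards [an.continuousAt.eventually (eventually_gt_nhds hdisc)] with q hq
        exact Real.sq_sqrt hq.le
      rcases le_total 0 (b p) with hb0 | hb0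
      · exact ⟨_, hs, hp, by positivity⟩
      · exact ⟨_, hs.neg, by simpa using hp,
          mul_nonneg_of_nonpos_of_nonpos hb0 (neg_nonpos.2 (Real.sqrt_nonneg _))⟩
    have hDp := hD2.self_of_nhds
    have hDp0 : D p ≠ 0 := by
      intro h; rw [h] at hDp; linarith
    set κ : ℝ × ℝ → ℝ := fun q => (b q + D q) / 2 with hκ
    have hκa : AnalyticAt ℝ κ p := by
      have : AnalyticAt ℝ (fun q => (b q + D q) * 2⁻¹) p := by fun_prop
      simpa [hκ, div_eq_mul_inv] using this
    have hκ0 : κ p ≠ 0 := by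
      intro h
      have h1 : b p = - D p := by simp only [hκ] at h; linarith
      have : 0 < D p ^ 2 := by positivity
      rw [h1] at hDb; linarith
    have ea : AnalyticAt ℝ (fun q => a q / κ q) p := ha.div hκa hκ0
    -- With `X`, `Y` the centred coordinates, `a X² + b X Y + c Y² = (Y + (a / κ) X) (κ X + c Y)`,
    -- because `κ² - b κ + a c = 0`.
    set g₁ : ℝ × ℝ → ℝ := fun q => (q.2 - p.2) + a q / κ q * (q.1 - p.1)
    set g₂ : ℝ × ℝ → ℝ := fun q => κ q * (q.1 - p.1) + c q * (q.2 - p.2)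
    have d1 : ∀ v, fderiv ℝ g₁ p v = v.2 + a p / κ p * v.1 := by
      intro v
      have := (an2.differentiableAt.hasFDerivAt).add
        (ea.differentiableAt.hasFDerivAt.mul an1.differentiableAt.hasFDerivAt)
      rw [show fderiv ℝ g₁ p = _ from this.fderiv]
      simp [fst', snd']
    have d2 : ∀ v, fderiv ℝ g₂ p v = κ p * v.1 + c p * v.2 := by
      intro v
      have := (hκa.differentiableAt.hasFDerivAt.mul an1.differentiableAt.hasFDerivAt).add
        (hc.differentiableAt.hasFDerivAt.mul an2.differentiableAt.hasFDerivAt)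
      rw [show fderiv ℝ g₂ p = _ from this.fderiv]
      simp [fst', snd']
    refine nonempty_levelChart_aux (g₁ := g₁) (g₂ := g₂) hN (by fun_prop) (by fun_prop)
      (by simp [g₁]) (by simp [g₂]) ?_ (Or.inr ?_)
    · rw [d1, d1, d2, d2]
      intro h
      apply hDp0
      -- Proportional differentials would mean `a c = κ²`, hence `D (b + D) = 0` at `p`, although
      -- neither factor vanishes.
      have h' : a p * c p = κ p ^ 2 := by
        field_simp at h
        linear_combination h
      simp only [hκ] at h'
      have hb' : D p * (b p + D p) = 0 := by linear_combination (1/2) * hDp - 2 * h'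
      rcases mul_eq_zero.1 hb' with h1 | h1
      · exact h1
      · exact absurd (by simp [hκ, h1]) hκ0
    · filter_upwards [hq, hD2, hκa.continuousAt.eventually_ne hκ0] with q h1 h2 h3
      rw [h1]
      simp only [g₁, g₂]
      have h4 : κ q ^ 2 - b q * κ q + a q * c q = 0 := by
        simp only [hκ]; linear_combination (1/4) * h2
      field_simp
      linear_combination -(q.1 - p.1) * (q.2 - p.2) * h4
  · have hnz : fderiv ℝ G p (1, 0) ≠ 0 ∨ fderiv ℝ G p (0, 1) ≠ 0 := by
      by_contra! hc
      exact h0 (by ext <;> simp [hc.1, hc.2])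
    have an : AnalyticAt ℝ (fun q => G q - G p) p := hG.sub analyticAt_const
    have hd : fderiv ℝ (fun q => G q - G p) p = fderiv ℝ G p := fderiv_sub_const _
    have hev : ∀ᶠ q in 𝓝 p, G q = G p + (G q - G p) := Eventually.of_forall fun q => by ring
    rcases hnz with hnz | hnz
    · refine nonempty_levelChart_aux hN an2 an (by simp) (by simp) ?_ (Or.inl hev)
      rw [snd', snd', hd]; simpa using hnz.symm
    · refine nonempty_levelChart_aux hN an1 an (by simp) (by simp) ?_ (Or.inl hev)
      rw [fst', fst', hd]; simpa using hnz

end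
end DeSitter

/-! ### Parametrization by Euclidean arclength. -/

namespace DeSitter
noncomputable section
open Filter Metric

/-- An antiderivative of an analytic function of one variable is analytic. -/
lemma analyticAt_of_hasDerivAt {s g : ℝ → ℝ} {t₀ : ℝ} (hg : AnalyticAt ℝ g t₀)
    (hs : ∀ᶠ t in 𝓝 t₀, HasDerivAt s (g t) t) : AnalyticAt ℝ s t₀ := by
  obtain ⟨p, hp⟩ := id hg
  obtain ⟨r, hr0, hr⟩ := ENNReal.lt_iff_exists_nnreal_btwn.1 hp.radius_pos
  obtain ⟨C, hC, hb⟩ := p.norm_mul_pow_le_of_lt_radius hr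
  -- Coefficients of the termwise integrated series. For `n = 0` the division by zero yields the
  -- constant term `0`.
  let a : ℕ → ℝ := fun n => p.coeff (n - 1) / n
  let q := FormalMultilinearSeries.ofScalars ℝ a
  have hqr : (r : ENNReal) ≤ q.radius := by
    refine q.le_radius_of_bound (C * r) fun n => ?_
    rw [FormalMultilinearSeries.ofScalars_norm]
    cases n with
    | zero => simp only [a]; simp; positivity
    | succ n =>
      have h1 := hb n
      rw [FormalMultilinearSeries.norm_apply_eq_norm_coef] at h1
      have h2 : ‖a (n + 1)‖ ≤ ‖p.coeff n‖ := by
        simp only [a, Nat.add_sub_cancel, norm_div, Real.norm_natCast]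
        exact div_le_self (norm_nonneg _) (by exact_mod_cast Nat.le_add_left 1 n)
      calc ‖a (n + 1)‖ * r ^ (n + 1) ≤ ‖p.coeff n‖ * r ^ (n + 1) := by gcongr
        _ = ‖p.coeff n‖ * r ^ n * r := by ring
        _ ≤ C * r := by gcongr
  have hW := ((q.hasFPowerSeriesOnBall (hr0.trans_le hqr)).comp_sub t₀).hasFPowerSeriesAt
  rw [zero_add] at hW
  set W : ℝ → ℝ := fun y => q.sum (y - t₀)
  have hWa : AnalyticAt ℝ W t₀ := ⟨q, hW⟩
  have e1 : ∀ n, iteratedDeriv n W t₀ = a n * n.factorial := by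
    intro n
    have := congrArg (fun f => FormalMultilinearSeries.coeff f n)
      (hW.eq_formalMultilinearSeries hWa.hasFPowerSeriesAt)
    simp only [q, FormalMultilinearSeries.coeff_ofScalars] at this
    rw [this]; field_simp
  have e2 : ∀ n, iteratedDeriv n g t₀ = p.coeff n * n.factorial := by
    intro n
    have := congrArg (fun f => FormalMultilinearSeries.coeff f n)
      (hp.eq_formalMultilinearSeries hg.hasFPowerSeriesAt)
    simp only [FormalMultilinearSeries.coeff_ofScalars] at this
    rw [this]; field_simp
  have e3 : ∀ n, iteratedDeriv n (deriv W) t₀ = iteratedDeriv n g t₀ := by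
    intro n
    rw [← iteratedDeriv_succ', e1, e2, Nat.factorial_succ]
    simp only [a, Nat.add_sub_cancel]
    push_cast
    field_simp
  -- Both sides are analytic with the same Taylor coefficients, so `s - W` is locally constant.
  have e4 : deriv W =ᶠ[𝓝 t₀] g := by
    have h1 := hWa.deriv.hasFPowerSeriesAt
    simp only [e3] at h1
    filter_upwards [h1.eventually_hasSum_sub, hg.hasFPowerSeriesAt.eventually_hasSum_sub]
      with y a b using a.unique b
  obtain ⟨ε, hε, hball⟩ := Metric.eventually_nhds_iff_ball.1
    ((hs.and e4).and hWa.eventually_analyticAt)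
  have hconst : ∀ t ∈ ball t₀ ε, s t = W t + (s t₀ - W t₀) := by
    intro t ht
    have := isOpen_ball.is_const_of_deriv_eq_zero (f := fun t => s t - W t)
      (convex_ball t₀ ε).isPreconnected
      (fun y hy => ((hball y hy).1.1.differentiableAt.sub
        (hball y hy).2.differentiableAt).differentiableWithinAt)
      (fun y hy => by
        have := (hball y hy).1.1.sub (hball y hy).2.differentiableAt.hasDerivAt
        rw [(hball y hy).1.2, sub_self] at this
        exact this.deriv) ht (mem_ball_self hε)
    linarith
  refine (hWa.add (analyticAt_const (v := s t₀ - W t₀))).congr ?_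
  filter_upwards [ball_mem_nhds t₀ hε] with t ht using (hconst t ht).symm

/-- An increasing analytic change of parameter on an open interval has an analytic inverse. -/
lemma exists_analytic_inverse {I : Set ℝ} (hI : IsOpen I) (hc : I.OrdConnected) {φ : ℝ → ℝ}
    (hφ : AnalyticOnNhd ℝ φ I) (hd : ∀ t ∈ I, 0 < deriv φ t) :
    StrictMonoOn φ I ∧ IsOpen (φ '' I) ∧ (φ '' I).OrdConnected ∧
      ∃ ψ : ℝ → ℝ, (∀ t ∈ I, ψ (φ t) = t) ∧ AnalyticOnNhd ℝ ψ (φ '' I) ∧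
        ∀ t ∈ I, deriv ψ (φ t) = (deriv φ t)⁻¹ := by
  have hmono : StrictMonoOn φ I := strictMonoOn_of_deriv_pos hc.convex hφ.continuousOn
    fun t ht => hd t (interior_subset ht)
  have hψ : ∀ t ∈ I, Function.invFunOn φ I (φ t) = t := fun t ht => hmono.injOn.leftInvOn_invFunOn ht
  have hopen : IsOpen (φ '' I) := by
    rw [isOpen_iff_mem_nhds]
    rintro _ ⟨t, ht, rfl⟩
    rw [← (hφ t ht).hasStrictDerivAt.map_nhds_eq (hd t ht).ne']
    exact image_mem_map (hI.mem_nhds ht)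
  have key : ∀ t (ht : t ∈ I), AnalyticAt ℝ (Function.invFunOn φ I) (φ t) ∧
      deriv (Function.invFunOn φ I) (φ t) = (deriv φ t)⁻¹ := by
    intro t ht
    have hst := (hφ t ht).hasStrictDerivAt
    have h1 := (hφ t ht).analyticAt_localInverse (hd t ht).ne'
    have hloc : hst.localInverse φ _ t (hd t ht).ne' (φ t) = t :=
      HasStrictFDerivAt.localInverse_apply_image ..
    have h2 : hst.localInverse φ _ t (hd t ht).ne' =ᶠ[𝓝 (φ t)] Function.invFunOn φ I := by
      have h3 : ∀ᶠ y in 𝓝 (φ t), hst.localInverse φ _ t (hd t ht).ne' y ∈ I :=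
        h1.continuousAt.eventually_mem (by rw [hloc]; exact hI.mem_nhds ht)
      filter_upwards [h3, HasStrictDerivAt.eventually_right_inverse hst (hd t ht).ne'] with y hy hy'
      conv_rhs => rw [← hy']
      exact (hψ _ hy).symm
    exact ⟨h1.congr h2, by rw [← h2.deriv_eq]; exact (hst.to_localInverse (hd t ht).ne').hasDerivAt.deriv⟩
  refine ⟨hmono, hopen, (hc.isPreconnected.image _ hφ.continuousOn).ordConnected,
    Function.invFunOn φ I, hψ, ?_, fun t ht => (key t ht).2⟩
  rintro _ ⟨t, ht, rfl⟩
  exact (key t ht).1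

/-- The square of the Euclidean speed. -/
def speedSq (γ : ℝ → ℝ × ℝ) (t : ℝ) : ℝ := (deriv γ t).1 ^ 2 + (deriv γ t).2 ^ 2

/-- An analytic curve in the quadrant, parameterized by Euclidean arclength. -/
structure IsUnitCurve (I : Set ℝ) (γ : ℝ → ℝ × ℝ) : Prop where
  isOpen : IsOpen I
  ordConnected : I.OrdConnected
  nonempty : I.Nonempty
  mapsTo : MapsTo γ I quadrant
  analytic : AnalyticOnNhd ℝ γ I
  speed : ∀ t ∈ I, speedSq γ t = 1

lemma speedSq_pos_of_ne {γ : ℝ → ℝ × ℝ} {t : ℝ} (h : deriv γ t ≠ 0) : 0 < speedSq γ t := by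
  unfold speedSq
  by_contra! hle
  apply h
  have h1 := sq_nonneg (deriv γ t).1
  have h2 := sq_nonneg (deriv γ t).2
  exact Prod.ext (pow_eq_zero_iff two_ne_zero |>.1 (by linarith))
    (pow_eq_zero_iff two_ne_zero |>.1 (by linarith))

lemma speedSq_comp {γ : ℝ → ℝ × ℝ} {φ : ℝ → ℝ} {t : ℝ} (hγ : DifferentiableAt ℝ γ (φ t))
    (hφ : DifferentiableAt ℝ φ t) :
    speedSq (fun t => γ (φ t)) t = deriv φ t ^ 2 * speedSq γ (φ t) := by
  have := (hγ.hasDerivAt.scomp t hφ.hasDerivAt).deriv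
  unfold speedSq
  rw [show deriv (fun t => γ (φ t)) t = deriv φ t • deriv γ (φ t) from this]
  simp; ring

lemma speedSq_congr {γ η : ℝ → ℝ × ℝ} {t : ℝ} (h : γ =ᶠ[𝓝 t] η) : speedSq γ t = speedSq η t := by
  unfold speedSq; rw [h.deriv_eq]

lemma IsUnitCurve.deriv_ne_zero {I : Set ℝ} {γ : ℝ → ℝ × ℝ} (h : IsUnitCurve I γ) {t : ℝ}
    (ht : t ∈ I) : deriv γ t ≠ 0 := by
  intro h0
  have := h.speed t ht
  simp [speedSq, h0] at this

lemma IsUnitCurve.isRegularCurve {I : Set ℝ} {γ : ℝ → ℝ × ℝ} (h : IsUnitCurve I γ) :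
    IsRegularCurve I γ := by
  -- The norm of `ℝ × ℝ` is the maximum norm; if it were below `1 / 2`, the squared Euclidean speed
  -- would be less than `1`.
  refine ⟨h.isOpen, h.ordConnected, h.nonempty, h.mapsTo, h.analytic, 1 / 2, by norm_num, ?_⟩
  intro t ht
  by_contra! hlt
  have h1 : |(deriv γ t).1| < 1 / 2 := (norm_fst_le (deriv γ t)).trans_lt hlt
  have h2 : |(deriv γ t).2| < 1 / 2 := (norm_snd_le (deriv γ t)).trans_lt hlt
  have h3 := h.speed t ht
  unfold speedSq at h3
  rw [← sq_abs (deriv γ t).1, ← sq_abs (deriv γ t).2] at h3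
  nlinarith [abs_nonneg (deriv γ t).1, abs_nonneg (deriv γ t).2]

lemma IsRegularCurve.deriv_ne_zero {I : Set ℝ} {γ : ℝ → ℝ × ℝ} (h : IsRegularCurve I γ) {t : ℝ}
    (ht : t ∈ I) : deriv γ t ≠ 0 := by
  obtain ⟨c, hc, hcI⟩ := h.regular
  intro h0
  have := hcI t ht
  rw [h0, norm_zero] at this
  linarith

/-- Reparametrization by arclength. -/
lemma exists_arclength {I : Set ℝ} {γ : ℝ → ℝ × ℝ} (hI : IsOpen I) (hc : I.OrdConnected)
    (hm : MapsTo γ I quadrant) (ha : AnalyticOnNhd ℝ γ I) (hd : ∀ t ∈ I, deriv γ t ≠ 0)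
    {t₀ : ℝ} (ht₀ : t₀ ∈ I) :
    ∃ (η : ℝ → ℝ × ℝ) (φ : ℝ → ℝ), IsUnitCurve (φ '' I) η ∧ AnalyticOnNhd ℝ φ I ∧
      (∀ t ∈ I, 0 < deriv φ t) ∧ StrictMonoOn φ I ∧ φ t₀ = 0 ∧ ∀ t ∈ I, γ t = η (φ t) := by
  -- The Euclidean speed is analytic because its square is positive; the maximum norm of the
  -- derivative need not be.
  set g : ℝ → ℝ := fun t => √(speedSq γ t)
  have hspos : ∀ t ∈ I, 0 < speedSq γ t := fun t ht => speedSq_pos_of_ne (hd t ht)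
  have hsa : ∀ t ∈ I, AnalyticAt ℝ (speedSq γ) t := by
    intro t ht
    have h1 := (ha t ht).deriv
    have f1 : AnalyticAt ℝ (fun t => (deriv γ t).1) t := analyticAt_fst.fun_comp h1
    have f2 : AnalyticAt ℝ (fun t => (deriv γ t).2) t := analyticAt_snd.fun_comp h1
    exact (f1.pow 2).add (f2.pow 2)
  have hga : AnalyticOnNhd ℝ g I := fun t ht => AnalyticAt.fun_comp (g := Real.sqrt)
    (Real.contDiffAt_sqrt (n := ⊤) (hspos t ht).ne').analyticAt (hsa t ht)
  set φ : ℝ → ℝ := fun t => ∫ x in t₀..t, g x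
  have hφd : ∀ t ∈ I, HasDerivAt φ (g t) t := by
    intro t ht
    refine intervalIntegral.integral_hasDerivAt_right ?_ ?_ (hga t ht).continuousAt
    · exact (hga.continuousOn.mono (hc.uIcc_subset ht₀ ht)).intervalIntegrable
    · exact hga.continuousOn.stronglyMeasurableAtFilter hI t ht
  have hφa : AnalyticOnNhd ℝ φ I := fun t ht => analyticAt_of_hasDerivAt (hga t ht) (by
    filter_upwards [hI.mem_nhds ht] with u hu using hφd u hu)
  have hφp : ∀ t ∈ I, 0 < deriv φ t := fun t ht => by
    rw [(hφd t ht).deriv]; exact Real.sqrt_pos.2 (hspos t ht)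
  obtain ⟨hmono, hop, hoc, ψ, hψ, hψa, hψd⟩ := exists_analytic_inverse hI hc hφa hφp
  refine ⟨fun s => γ (ψ s), φ, ⟨hop, hoc, ⟨_, mem_image_of_mem φ ht₀⟩, ?_, ?_, ?_⟩, hφa, hφp, hmono,
    by simp [φ], fun t ht => by simp only [hψ t ht]⟩
  · rintro _ ⟨t, ht, rfl⟩
    simpa only [hψ t ht] using hm ht
  · rintro _ ⟨t, ht, rfl⟩
    exact AnalyticAt.fun_comp (by rw [hψ t ht]; exact ha t ht) (hψa _ (mem_image_of_mem φ ht))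
  · rintro _ ⟨t, ht, rfl⟩
    rw [speedSq_comp (by rw [hψ t ht]; exact (ha t ht).differentiableAt)
      (hψa _ (mem_image_of_mem φ ht)).differentiableAt, hψ t ht, hψd t ht, (hφd t ht).deriv, inv_pow,
      Real.sq_sqrt (hspos t ht).le]
    exact inv_mul_cancel₀ (hspos t ht).ne'

/-- A change of parameter between arclength parameters is affine. -/
lemma exists_affine {J : Set ℝ} (hJ : IsOpen J) (hc : J.OrdConnected) {θ : ℝ → ℝ}
    (hθ : AnalyticOnNhd ℝ θ J) (h1 : ∀ t ∈ J, deriv θ t ^ 2 = 1) :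
    ∃ ε c : ℝ, ε ^ 2 = 1 ∧ ∀ t ∈ J, θ t = ε * t + c := by
  rcases J.eq_empty_or_nonempty with rfl | ⟨t₀, ht₀⟩
  · exact ⟨1, 0, by norm_num, by simp⟩
  have key : ∃ ε : ℝ, ε ^ 2 = 1 ∧ ∀ t ∈ J, deriv θ t = ε := by
    rcases hc.isPreconnected.eq_or_eq_neg_of_sq_eq (f := deriv θ) (g := fun _ => 1)
      (fun t ht => (hθ t ht).deriv.continuousAt.continuousWithinAt) continuousOn_const
      (fun t ht => by simpa using h1 t ht) (fun _ => by norm_num) with h | h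
    · exact ⟨1, by norm_num, fun t ht => h ht⟩
    · exact ⟨-1, by norm_num, fun t ht => by simpa using h ht⟩
  obtain ⟨ε, hε, hder⟩ := key
  refine ⟨ε, θ t₀ - ε * t₀, hε, fun t ht => ?_⟩
  have hdd : ∀ t ∈ J, HasDerivAt (fun t => θ t - ε * t) 0 t := fun t ht => by
    have := (hθ t ht).differentiableAt.hasDerivAt.sub ((hasDerivAt_id t).const_mul ε)
    refine this.congr_deriv ?_
    rw [hder t ht]; simp
  have := hJ.is_const_of_deriv_eq_zero (f := fun t => θ t - ε * t) hc.isPreconnected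
    (fun y hy => (hdd y hy).differentiableAt.differentiableWithinAt)
    (fun y hy => (hdd y hy).deriv) ht ht₀
  linarith

end
end DeSitter

/-! ### Gluing, maximal extension and inextendibility of arclength curves. -/

namespace DeSitter
noncomputable section
open Filter Metric

variable {I J : Set ℝ} {γ η : ℝ → ℝ × ℝ}

lemma IsUnitCurve.eqOn_inter (hγ : IsUnitCurve I γ) (hη : IsUnitCurve J η) {t₀ : ℝ}
    (hI : t₀ ∈ I) (hJ : t₀ ∈ J) (h : γ =ᶠ[𝓝 t₀] η) : EqOn γ η (I ∩ J) :=
  (hγ.analytic.mono inter_subset_left).eqOn_of_preconnected_of_eventuallyEq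
    (hη.analytic.mono inter_subset_right)
    (hγ.ordConnected.inter hη.ordConnected).isPreconnected ⟨hI, hJ⟩ h

lemma IsUnitCurve.congr (hγ : IsUnitCurve I γ) (h : EqOn γ η I) : IsUnitCurve I η := by
  have he : ∀ t ∈ I, γ =ᶠ[𝓝 t] η := fun t ht => by
    filter_upwards [hγ.isOpen.mem_nhds ht] with u hu using h hu
  refine ⟨hγ.isOpen, hγ.ordConnected, hγ.nonempty, hγ.mapsTo.congr h,
    fun t ht => (hγ.analytic t ht).congr (he t ht), fun t ht => ?_⟩
  rw [← speedSq_congr (he t ht), hγ.speed t ht]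

lemma isUnitCurve_iUnion {ι : Sort*} {I : ι → Set ℝ} (h : ∀ i, IsUnitCurve (I i) γ) {t₀ : ℝ}
    (i₀ : ι) (ht₀ : ∀ i, t₀ ∈ I i) : IsUnitCurve (⋃ i, I i) γ := by
  refine ⟨isOpen_iUnion fun i => (h i).isOpen, ?_, ⟨t₀, mem_iUnion.2 ⟨i₀, ht₀ i₀⟩⟩, ?_, ?_, ?_⟩
  · exact (isPreconnected_iUnion ⟨t₀, mem_iInter.2 ht₀⟩
      fun i => (h i).ordConnected.isPreconnected).ordConnected
  all_goals
    intro t ht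
    obtain ⟨i, hi⟩ := mem_iUnion.1 ht
  · exact (h i).mapsTo hi
  · exact (h i).analytic t hi
  · exact (h i).speed t hi

/-- Two arclength curves that agree near a common parameter can be glued. -/
lemma IsUnitCurve.exists_glue (hγ : IsUnitCurve I γ) (hη : IsUnitCurve J η) {t₀ : ℝ}
    (hI : t₀ ∈ I) (hJ : t₀ ∈ J) (h : γ =ᶠ[𝓝 t₀] η) :
    ∃ σ, IsUnitCurve (I ∪ J) σ ∧ EqOn σ γ I ∧ EqOn σ η J := by
  classical
  have e := hγ.eqOn_inter hη hI hJ h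
  have e1 : EqOn (I.piecewise γ η) γ I := I.piecewise_eqOn γ η
  have e2 : EqOn (I.piecewise γ η) η J := by
    intro t ht
    by_cases hti : t ∈ I
    · rw [piecewise_eq_of_mem _ _ _ hti]; exact e ⟨hti, ht⟩
    · rw [piecewise_eq_of_notMem _ _ _ hti]
  refine ⟨I.piecewise γ η, ?_, e1, e2⟩
  rw [union_eq_iUnion]
  refine isUnitCurve_iUnion (t₀ := t₀) ?_ true ?_
  · rintro (_ | _)
    · exact hη.congr e2.symm
    · exact hγ.congr e1.symm
  · rintro (_ | _)
    · exact hJ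
    · exact hI

/-- The unique maximal extension of an arclength curve. -/
lemma IsUnitCurve.exists_maximal {I₀ : Set ℝ} {γ₀ : ℝ → ℝ × ℝ} (h₀ : IsUnitCurve I₀ γ₀) {t₀ : ℝ}
    (ht₀ : t₀ ∈ I₀) : ∃ I γ, IsUnitCurve I γ ∧ I₀ ⊆ I ∧ EqOn γ γ₀ I₀ ∧
      ∀ J η, IsUnitCurve J η → t₀ ∈ J → η =ᶠ[𝓝 t₀] γ → J ⊆ I := by
  -- All arclength curves with the germ of `γ₀` at `t₀`. By the identity theorem any two agree on
  -- their common domain, so they have a union.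
  let ι := {c : Set ℝ × (ℝ → ℝ × ℝ) // IsUnitCurve c.1 c.2 ∧ t₀ ∈ c.1 ∧ c.2 =ᶠ[𝓝 t₀] γ₀}
  let i₀ : ι := ⟨(I₀, γ₀), h₀, ht₀, EventuallyEq.rfl⟩
  have hagree : ∀ i j : ι, EqOn i.1.2 j.1.2 (i.1.1 ∩ j.1.1) := fun i j =>
    i.2.1.eqOn_inter j.2.1 i.2.2.1 j.2.2.1 (i.2.2.2.trans j.2.2.2.symm)
  classical
  let γ : ℝ → ℝ × ℝ := fun t => if h : ∃ i : ι, t ∈ i.1.1 then h.choose.1.2 t else 0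
  have hγ : ∀ i : ι, EqOn γ i.1.2 i.1.1 := by
    intro i t ht
    have h : ∃ i : ι, t ∈ i.1.1 := ⟨i, ht⟩
    simp only [γ, dif_pos h]
    exact hagree _ _ ⟨h.choose_spec, ht⟩
  refine ⟨⋃ i : ι, i.1.1, γ, isUnitCurve_iUnion (t₀ := t₀) (fun i => i.2.1.congr (hγ i).symm) i₀
    fun i => i.2.2.1, subset_iUnion (fun i : ι => i.1.1) i₀, hγ i₀, ?_⟩
  intro J η hη hJ he
  have he' : γ =ᶠ[𝓝 t₀] γ₀ := by
    filter_upwards [h₀.isOpen.mem_nhds ht₀] with t ht using hγ i₀ ht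
  exact subset_iUnion (fun i : ι => i.1.1) ⟨(J, η), hη, hJ, he.trans he'⟩

lemma IsUnitCurve.comp_affine (hγ : IsUnitCurve I γ) {ε c : ℝ} (hε : ε ^ 2 = 1) :
    IsUnitCurve ((fun t => ε * t + c) ⁻¹' I) (fun t => γ (ε * t + c)) := by
  have hcont : Continuous fun t : ℝ => ε * t + c := by fun_prop
  have hd : ∀ t, HasDerivAt (fun t : ℝ => ε * t + c) ε t := fun t => by
    simpa using ((hasDerivAt_id t).const_mul ε).add_const c
  have ha : ∀ t, AnalyticAt ℝ (fun t : ℝ => ε * t + c) t := fun t => by fun_prop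
  refine ⟨hγ.isOpen.preimage hcont, ?_, ?_, fun t ht => hγ.mapsTo ht,
    fun t ht => AnalyticAt.fun_comp (f := fun t => ε * t + c) (hγ.analytic _ ht) (ha t), fun t ht => ?_⟩
  · rw [ordConnected_iff_uIcc_subset]
    intro x hx y hy z hz
    refine hγ.ordConnected.uIcc_subset hx hy ?_
    have h0 : (ε - 1) * (ε + 1) = 0 := by linear_combination hε
    rw [mem_uIcc] at hz ⊢
    rcases mul_eq_zero.1 h0 with h1 | h1
    · obtain rfl : ε = 1 := by linarith
      refine hz.imp ?_ ?_ <;> exact fun h => ⟨by linarith [h.1], by linarith [h.2]⟩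
    · obtain rfl : ε = -1 := by linarith
      refine hz.symm.imp ?_ ?_ <;> exact fun h => ⟨by linarith [h.2], by linarith [h.1]⟩
  · obtain ⟨t, ht⟩ := hγ.nonempty
    refine ⟨ε * (t - c), ?_⟩
    have : ε * (ε * (t - c)) + c = t := by linear_combination (t - c) * hε
    simpa only [mem_preimage, this] using ht
  · rw [speedSq_comp (φ := fun t => ε * t + c) (hγ.analytic _ ht).differentiableAt (hd t).differentiableAt, (hd t).deriv, hε,
      hγ.speed _ ht, one_mul]

/-- Inextendibility allows arbitrary analytic changes of parameter, but it suffices to test it on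
arclength curves: after parametrizing a larger curve by arclength, the change of parameter has
derivative `±1`, so it is affine and the larger curve can be pulled back to extend `γ` in its own
parameter. -/
lemma IsUnitCurve.isInextendible (hγ : IsUnitCurve I γ)
    (h : ∀ J η, IsUnitCurve J η → I ⊆ J → EqOn η γ I → J ⊆ I) : IsInextendibleCurve I γ := by
  refine ⟨hγ.isRegularCurve, ?_⟩
  rintro ⟨J, η, φ, hη, hφ, hφ0, hφJ, hγη⟩
  obtain ⟨s₀, hs₀⟩ := hη.nonempty
  obtain ⟨σ, ψ, hσ, hψ, hψd, hψm, -, hησ⟩ := exists_arclength hη.isOpen hη.ordConnected hη.mapsTo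
    hη.analytic (fun t ht => hη.deriv_ne_zero ht) hs₀
  have hmem : ∀ t ∈ I, φ t ∈ J := fun t ht => hφJ.1 (mem_image_of_mem φ ht)
  have hθ : AnalyticOnNhd ℝ (fun t => ψ (φ t)) I := fun t ht =>
    (hψ _ (hmem t ht)).fun_comp (hφ t ht)
  have hγσ : ∀ t ∈ I, γ t = σ (ψ (φ t)) := fun t ht => by rw [hγη t ht, hησ _ (hmem t ht)]
  obtain ⟨ε, c, hε, haff⟩ := exists_affine hγ.isOpen hγ.ordConnected hθ fun t ht => by
    have h1 := hγ.speed t ht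
    have hmψ := mem_image_of_mem ψ (hmem t ht)
    rw [speedSq_congr (η := fun t => σ (ψ (φ t))) (by
      filter_upwards [hγ.isOpen.mem_nhds ht] with u hu using hγσ u hu),
      speedSq_comp (γ := σ) (φ := fun t => ψ (φ t)) (hσ.analytic _ hmψ).differentiableAt
        (hθ t ht).differentiableAt, hσ.speed _ hmψ, mul_one] at h1
    exact h1
  have hsub := h _ _ (hσ.comp_affine (c := c) hε)
    (fun t ht => by
      rw [mem_preimage, ← haff t ht]; exact mem_image_of_mem ψ (hmem t ht))
    (fun t ht => by rw [← haff t ht, hγσ t ht])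
  refine hφJ.2 fun s hs => ?_
  have hi : ε * (ε * (ψ s - c)) + c = ψ s := by linear_combination (ψ s - c) * hε
  have ht : ε * (ψ s - c) ∈ I := hsub (by rw [mem_preimage, hi]; exact mem_image_of_mem ψ hs)
  refine ⟨_, ht, hψm.injOn (hmem _ ht) hs ?_⟩
  rw [haff _ ht, hi]

/-- An inextendible arclength curve contains every arclength curve with the same germ. -/
lemma IsUnitCurve.subset_of_inextendible (hγ : IsUnitCurve I γ) (hi : ¬ IsExtendible I γ)
    (hη : IsUnitCurve J η) {t₀ : ℝ} (hI : t₀ ∈ I) (hJ : t₀ ∈ J) (h : γ =ᶠ[𝓝 t₀] η) :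
    J ⊆ I ∧ EqOn γ η J := by
  have hsub : J ⊆ I := by
    by_contra hJI
    obtain ⟨σ, hσ, h1, -⟩ := hγ.exists_glue hη hI hJ h
    refine hi ⟨I ∪ J, σ, id, hσ.isRegularCurve, analyticOnNhd_id, by simp, ?_,
      fun t ht => (h1 ht).symm⟩
    rw [image_id]
    exact ssubset_iff_subset_ne.2 ⟨subset_union_left,
      fun he => hJI (he.symm ▸ subset_union_right)⟩
  exact ⟨hsub, fun t ht => hγ.eqOn_inter hη hI hJ h ⟨hsub ht, ht⟩⟩

/-- Arclength parametrization of an inextendible curve. -/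
lemma IsInextendibleCurve.exists_arclength (h : IsInextendibleCurve I γ) :
    ∃ (η : ℝ → ℝ × ℝ) (φ : ℝ → ℝ), IsUnitCurve (φ '' I) η ∧ ¬ IsExtendible (φ '' I) η ∧
      StrictMonoOn φ I ∧ ∀ t ∈ I, γ t = η (φ t) := by
  obtain ⟨hr, hn⟩ := h
  obtain ⟨t₀, ht₀⟩ := hr.nonempty
  obtain ⟨η, φ, hη, hφ, hφd, hφm, -, hγ⟩ := DeSitter.exists_arclength hr.isOpen hr.ordConnected
    hr.mapsTo hr.analytic (fun t ht => hr.deriv_ne_zero ht) ht₀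
  refine ⟨η, φ, hη, ?_, hφm, hγ⟩
  rintro ⟨J, σ, ψ, hσ, hψ, hψ0, hψJ, hησ⟩
  refine hn ⟨J, σ, fun t => ψ (φ t), hσ,
    fun t ht => (hψ _ (mem_image_of_mem φ ht)).fun_comp (hφ t ht), fun t ht => ?_, ?_,
    fun t ht => by rw [hγ t ht, hησ _ (mem_image_of_mem φ ht)]⟩
  · have h1 := ((hψ _ (mem_image_of_mem φ ht)).differentiableAt.hasDerivAt.comp t
      (hφ t ht).differentiableAt.hasDerivAt).deriv
    rw [show deriv (fun t => ψ (φ t)) t = _ from h1]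
    exact mul_ne_zero (hψ0 _ (mem_image_of_mem φ ht)) (hφd t ht).ne'
  · rwa [image_image] at hψJ

end
end DeSitter

/-! ### Plane separation by continuous logarithms, and the maximum principle. -/

namespace DeSitter
noncomputable section
open Filter Metric

/-- The identification of the real plane with the complex plane. -/
def toC : (ℝ × ℝ) ≃L[ℝ] ℂ := Complex.equivRealProdCLM.symm

@[simp] lemma toC_re (v : ℝ × ℝ) : (toC v).re = v.1 := by
  have := Complex.equivRealProdCLM.apply_symm_apply v
  exact congrArg Prod.fst this

@[simp] lemma toC_im (v : ℝ × ℝ) : (toC v).im = v.2 := by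
  have := Complex.equivRealProdCLM.apply_symm_apply v
  exact congrArg Prod.snd this

lemma norm_le_norm_toC (v : ℝ × ℝ) : ‖v‖ ≤ ‖toC v‖ := by
  rw [Prod.norm_def]
  refine max_le ?_ ?_
  · simpa using Complex.abs_re_le_norm (toC v)
  · simpa using Complex.abs_im_le_norm (toC v)

lemma toC_ne_zero {v : ℝ × ℝ} (h : v ≠ 0) : toC v ≠ 0 := by simpa using h

/-- The quotient `(z - q) / (z - q')` has a continuous logarithm on `L`. -/
def HasLogOn (L : Set (ℝ × ℝ)) (q q' : ℝ × ℝ) : Prop :=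
  ∃ g : ℝ × ℝ → ℂ, ContinuousOn g L ∧ ∀ z ∈ L, Complex.exp (g z) * toC (z - q') = toC (z - q)

variable {L : Set (ℝ × ℝ)}

lemma HasLogOn.symm {q q' : ℝ × ℝ} (h : HasLogOn L q q') : HasLogOn L q' q := by
  obtain ⟨g, hg, h⟩ := h
  refine ⟨fun z => -g z, hg.neg, fun z hz => ?_⟩
  rw [← h z hz, ← mul_assoc, ← Complex.exp_add, neg_add_cancel, Complex.exp_zero, one_mul]

lemma HasLogOn.trans {q q' q'' : ℝ × ℝ} (h : HasLogOn L q q') (h' : HasLogOn L q' q'') :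
    HasLogOn L q q'' := by
  obtain ⟨g, hg, h⟩ := h
  obtain ⟨g', hg', h'⟩ := h'
  refine ⟨fun z => g z + g' z, hg.add hg', fun z hz => ?_⟩
  rw [Complex.exp_add, mul_assoc, h' z hz, h z hz]

lemma hasLogOn_of_slitPlane {q q' : ℝ × ℝ} (hq : q ∉ L) (hq' : q' ∉ L)
    (h : ∀ z ∈ L, toC (z - q) / toC (z - q') ∈ Complex.slitPlane) : HasLogOn L q q' := by
  have hne : ∀ {p}, p ∉ L → ∀ z ∈ L, toC (z - p) ≠ 0 := fun hp z hz =>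
    toC_ne_zero (sub_ne_zero.2 fun e => hp (e ▸ hz))
  refine ⟨fun z => Complex.log (toC (z - q) / toC (z - q')), ?_, fun z hz => ?_⟩
  · refine ContinuousOn.clog (ContinuousOn.div ?_ ?_ (hne hq')) h <;>
      exact (toC.continuous.comp (by fun_prop)).continuousOn
  · rw [Complex.exp_log (div_ne_zero (hne hq z hz) (hne hq' z hz)), div_mul_cancel₀ _ (hne hq' z hz)]

/-- When `q` is closer to `q'` than `L` is, the quotient `(z - q) / (z - q')` stays within distance
less than `1` of `1`, where the principal logarithm is continuous. -/
lemma eventually_hasLogOn (hL : IsClosed L) {q' : ℝ × ℝ} (hq' : q' ∉ L) :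
    ∀ᶠ q in 𝓝 q', HasLogOn L q' q := by
  obtain ⟨ε, hε, hb⟩ := Metric.isOpen_iff.1 hL.isOpen_compl q' hq'
  have h1 : ∀ᶠ q in 𝓝 q', ‖toC (q' - q)‖ < ε := by
    have : ContinuousAt (fun q => ‖toC (q' - q)‖) q' :=
      (continuous_norm.comp (toC.continuous.comp (by fun_prop))).continuousAt
    exact this.eventually_lt continuousAt_const (by simpa using hε)
  filter_upwards [h1, hL.isOpen_compl.mem_nhds hq'] with q hq hqL
  refine (hasLogOn_of_slitPlane hqL hq' fun z hz => ?_).symm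
  have hz0 : toC (z - q') ≠ 0 := toC_ne_zero (sub_ne_zero.2 fun e => hq' (e ▸ hz))
  have hfar : ε ≤ ‖toC (z - q')‖ := by
    refine le_trans ?_ (norm_le_norm_toC _)
    by_contra! hlt
    exact hb (by rwa [mem_ball, dist_eq_norm]) hz
  have e : toC (z - q) / toC (z - q') = 1 + toC (q' - q) / toC (z - q') := by
    field_simp
    rw [← map_add]; congr 1; abel
  rw [e]
  refine Complex.mem_slitPlane_of_norm_lt_one ?_
  rw [norm_div, div_lt_one (norm_pos_iff.2 hz0)]
  exact hq.trans_le hfar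

/-- Having a logarithm is an equivalence relation on the complement of `L` with open classes. -/
lemma hasLogOn_of_preconnected (hL : IsClosed L) {W : Set (ℝ × ℝ)} (hW : IsPreconnected W)
    (hWL : W ⊆ Lᶜ) {q q' : ℝ × ℝ} (hq : q ∈ W) (hq' : q' ∈ W) : HasLogOn L q q' :=
  hW.induction₂ (HasLogOn L)
    (fun _ hx => (eventually_hasLogOn hL (hWL hx)).filter_mono nhdsWithin_le_nhds)
    (fun _ _ _ _ _ _ => HasLogOn.trans) (fun _ _ _ _ => HasLogOn.symm) hq hq'

/-- Here `z - q = -q * (1 - z / q)` with `|z / q| < 1` on `L`. -/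
lemma hasLogOn_far {R : ℝ} (hR : ∀ z ∈ L, ‖toC z‖ < R) {q : ℝ × ℝ} (hq : R ≤ ‖q‖) :
    ∃ g : ℝ × ℝ → ℂ, ContinuousOn g L ∧ ∀ z ∈ L, Complex.exp (g z) = toC (z - q) := by
  rcases L.eq_empty_or_nonempty with rfl | ⟨z₀, hz₀⟩
  · exact ⟨0, by simp, by simp⟩
  have hq0 : toC q ≠ 0 := by
    rw [← norm_pos_iff]
    exact ((norm_nonneg _).trans_lt (hR z₀ hz₀)).trans_le (hq.trans (norm_le_norm_toC q))
  have hslit : ∀ z ∈ L, 1 + -(toC z / toC q) ∈ Complex.slitPlane := fun z hz => by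
    refine Complex.mem_slitPlane_of_norm_lt_one ?_
    rw [norm_neg, norm_div, div_lt_one (norm_pos_iff.2 hq0)]
    exact (hR z hz).trans_le (hq.trans (norm_le_norm_toC q))
  refine ⟨fun z => Complex.log (1 + -(toC z / toC q)) + Complex.log (-toC q), ?_, fun z hz => ?_⟩
  · refine ContinuousOn.add (ContinuousOn.clog ?_ hslit) continuousOn_const
    exact (continuous_const.add (toC.continuous.div_const _).neg).continuousOn
  · rw [Complex.exp_add, Complex.exp_log (Complex.slitPlane_ne_zero (hslit z hz)),
      Complex.exp_log (neg_ne_zero.2 hq0), map_sub]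
    field_simp
    ring

/-- Each point can be moved within its component to a point far from `L`, where the linear factor
alone has a logarithm. -/
lemma hasLogOn_of_unbounded (hL : IsCompact L) {q q' : ℝ × ℝ} (hq : q ∉ L) (hq' : q' ∉ L)
    (h : ¬ Bornology.IsBounded (connectedComponentIn Lᶜ q))
    (h' : ¬ Bornology.IsBounded (connectedComponentIn Lᶜ q')) : HasLogOn L q q' := by
  obtain ⟨R, hR⟩ := (hL.image toC.continuous).isBounded.exists_norm_le
  have hR' : ∀ z ∈ L, ‖toC z‖ < R + 1 := fun z hz => by
    linarith [hR _ (mem_image_of_mem toC hz)]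
  have far : ∀ {q}, q ∉ L → ¬ Bornology.IsBounded (connectedComponentIn Lᶜ q) →
      ∃ y, R + 1 ≤ ‖y‖ ∧ HasLogOn L q y := by
    intro q hq h
    by_contra! hc
    refine h (isBounded_iff_forall_norm_le.2 ⟨R + 1, fun y hy => ?_⟩)
    by_contra! hlt
    exact hc y hlt.le (hasLogOn_of_preconnected hL.isClosed isPreconnected_connectedComponentIn
      (connectedComponentIn_subset _ _) (mem_connectedComponentIn hq) hy)
  obtain ⟨y, hy, hqy⟩ := far hq h
  obtain ⟨y', hy', hqy'⟩ := far hq' h'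
  refine (hqy.trans ?_).trans hqy'.symm
  obtain ⟨g, hg, he⟩ := hasLogOn_far hR' hy
  obtain ⟨g', hg', he'⟩ := hasLogOn_far hR' hy'
  refine ⟨fun z => g z - g' z, hg.sub hg', fun z hz => ?_⟩
  rw [Complex.exp_sub, he z hz, he' z hz, div_mul_cancel₀]
  rw [← he' z hz]; exact Complex.exp_ne_zero _

/-- The determinant of two vectors of the plane. -/
def cross (v w : ℝ × ℝ) : ℝ := v.1 * w.2 - v.2 * w.1

lemma im_quotient (κ w : ℝ × ℝ) :
    (toC (w - κ) / toC (w + κ)).im = 2 * cross κ w / Complex.normSq (toC (w + κ)) := by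
  rw [Complex.div_im]
  simp only [toC_re, toC_im, Prod.fst_sub, Prod.snd_sub, Prod.fst_add, Prod.snd_add, cross]
  ring

/-- If the quotient equals `-τ` with `τ ≥ 0`, then `w = ((1 - τ) / (1 + τ)) • κ` lies on the
segment. -/
lemma quotient_mem_slitPlane {κ w : ℝ × ℝ}
    (h : ∀ ρ ∈ Icc (-1 : ℝ) 1, w ≠ ρ • κ) :
    toC (w - κ) / toC (w + κ) ∈ Complex.slitPlane := by
  by_contra hn
  rw [Complex.mem_slitPlane_iff, not_or, not_lt, not_not] at hn
  have h0 : toC (w + κ) ≠ 0 := toC_ne_zero fun h0 => h (-1) (by norm_num)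
    (by rw [neg_one_smul]; exact eq_neg_of_add_eq_zero_left h0)
  set τ : ℝ := -(toC (w - κ) / toC (w + κ)).re
  have hτ : 0 ≤ τ := neg_nonneg.2 hn.1
  have e : toC (w - κ) / toC (w + κ) = ((-τ : ℝ) : ℂ) := by
    refine Complex.ext ?_ ?_
    · simp [τ]
    · rw [hn.2, Complex.ofReal_im]
  rw [div_eq_iff h0, ← Complex.real_smul, ← map_smul] at e
  have e' := toC.injective e
  have hτ1 : (1 + τ) ≠ 0 := by positivity
  refine h ((1 - τ) / (1 + τ)) ⟨?_, ?_⟩ ?_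
  · rw [le_div_iff₀ (by positivity)]; linarith
  · rw [div_le_one (by positivity)]; linarith
  · have e1 := congrArg Prod.fst e'
    have e2 := congrArg Prod.snd e'
    simp at e1 e2
    ext
    · simp; field_simp; linarith
    · simp; field_simp; linarith

/-- If `L` passes through `s` from one side of a segment to the other, meets the segment only
in `s`, and remains connected without `s`, then the quotient belonging to the endpoints of the
segment has no continuous logarithm on `L`. -/
lemma not_hasLogOn {s κ : ℝ × ℝ} (hs : s ∈ L) (hκ : κ ≠ 0)
    (hseg : ∀ ρ ∈ Icc (-1 : ℝ) 1, s + ρ • κ ∈ L → ρ = 0) (hconn : IsPreconnected (L \ {s}))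
    {α β : ℝ → ℝ × ℝ} (hα : Tendsto α (𝓝[>] 0) (𝓝 s)) (hβ : Tendsto β (𝓝[>] 0) (𝓝 s))
    (hαL : ∀ᶠ r in 𝓝[>] 0, α r ∈ L ∧ 0 < cross κ (α r - s))
    (hβL : ∀ᶠ r in 𝓝[>] 0, β r ∈ L ∧ cross κ (β r - s) < 0) :
    ¬ HasLogOn L (s + κ) (s - κ) := by
  rintro ⟨g, hg, he⟩
  set R : ℝ × ℝ → ℂ := fun z => toC (z - s - κ) / toC (z - s + κ) with hR
  have hne : ∀ z ∈ L, toC (z - s + κ) ≠ 0 := fun z hz => by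
    refine toC_ne_zero fun h => ?_
    have : z = s + (-1 : ℝ) • κ := by rw [neg_one_smul]; linear_combination (exp := 1) h
    have := hseg (-1) (by norm_num) (this ▸ hz)
    norm_num at this
  have hexp : ∀ z ∈ L, Complex.exp (g z) = R z := fun z hz => by
    have := he z hz
    rw [show z - (s - κ) = z - s + κ by abel, show z - (s + κ) = z - s - κ by abel] at this
    rw [hR, eq_div_iff (hne z hz), this]
  have hslit : ∀ z ∈ L \ {s}, R z ∈ Complex.slitPlane := fun z hz => by
    refine quotient_mem_slitPlane fun ρ hρ h => hz.2 ?_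
    have h1 : z = s + ρ • κ := by rw [← h]; abel
    have h2 := hseg ρ hρ (h1 ▸ hz.1)
    rw [h2, zero_smul, add_zero] at h1
    exact h1
  have hRc : ContinuousOn R L := by
    refine ContinuousOn.div ?_ ?_ hne <;> exact (toC.continuous.comp (by fun_prop)).continuousOn
  -- Off `s` the quotient avoids the cut, so `k` compares two continuous arguments of the same
  -- number. It takes values in `2πℤ`, hence is constant on the connected set `L \ {s}`.
  set k : ℝ × ℝ → ℝ := fun z => (g z).im - (R z).arg
  have hk : ContinuousOn k (L \ {s}) := by
    refine (Complex.continuous_im.comp_continuousOn (hg.mono sdiff_subset)).sub fun z hz => ?_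
    exact ContinuousAt.comp_continuousWithinAt (Complex.continuousAt_arg (hslit z hz))
      ((hRc.mono sdiff_subset) z hz)
  have hkint : ∀ z ∈ L \ {s}, ∃ n : ℤ, k z = n * (2 * Real.pi) := fun z hz => by
    have h1 : Complex.exp (g z) = Complex.exp (Complex.log (R z)) := by
      rw [hexp z hz.1, Complex.exp_log (Complex.slitPlane_ne_zero (hslit z hz))]
    obtain ⟨n, hn⟩ := Complex.exp_eq_exp_iff_exists_int.1 h1
    refine ⟨n, ?_⟩
    simp only [k]
    rw [hn]
    simp [Complex.log_im]
  have hconst : ∀ z ∈ L \ {s}, ∀ z' ∈ L \ {s}, k z = k z' := by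
    intro z hz z' hz'
    by_contra hne
    wlog hlt : k z < k z' generalizing z z'
    · exact this z' hz' z hz (Ne.symm hne) (lt_of_le_of_ne (not_lt.1 hlt) (Ne.symm hne))
    obtain ⟨n, hn⟩ := hkint z hz
    obtain ⟨n', hn'⟩ := hkint z' hz'
    have hpi := Real.pi_pos
    have hnn : (n : ℝ) < n' := by
      rw [hn, hn'] at hlt
      exact lt_of_mul_lt_mul_right hlt (by positivity)
    have hnn' : (n : ℝ) + 1 ≤ n' := by exact_mod_cast Int.add_one_le_of_lt (by exact_mod_cast hnn)
    obtain ⟨y, hy, hky⟩ := (hconn.image k hk).ordConnected.out (mem_image_of_mem k hz)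
      (mem_image_of_mem k hz')
      (show n * (2 * Real.pi) + Real.pi ∈ Icc (k z) (k z') from
        ⟨by rw [hn]; linarith, by rw [hn']; nlinarith⟩)
    obtain ⟨m, hm⟩ := hkint y hy
    rw [hky] at hm
    have : (2 * n + 1 : ℝ) = 2 * m := by
      have : (2 * n + 1 : ℝ) * Real.pi = 2 * m * Real.pi := by linarith
      exact mul_right_cancel₀ hpi.ne' this
    have : 2 * n + 1 = 2 * m := by exact_mod_cast this
    omega
  -- At `s` the quotient lies on the cut. The principal argument tends to `π` along `α` and to `-π`
  -- along `β`, while `(g z).im` is continuous at `s`.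
  have hRs : R s = -1 := by
    simp only [hR, sub_self, zero_sub, zero_add, map_neg]
    rw [neg_div, div_self (toC_ne_zero hκ)]
  have lim : ∀ {α : ℝ → ℝ × ℝ}, Tendsto α (𝓝[>] 0) (𝓝 s) → (∀ᶠ r in 𝓝[>] 0, α r ∈ L) →
      Tendsto (fun r => (g (α r)).im) (𝓝[>] 0) (𝓝 (g s).im) ∧
      Tendsto (fun r => R (α r)) (𝓝[>] 0) (𝓝 (-1)) := by
    intro α hα hαL
    have h1 : Tendsto α (𝓝[>] 0) (𝓝[L] s) := tendsto_nhdsWithin_iff.2 ⟨hα, hαL⟩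
    exact ⟨(Complex.continuous_im.tendsto _).comp ((hg s hs).tendsto.comp h1),
      hRs ▸ (hRc s hs).tendsto.comp h1⟩
  have him : ∀ z, (R z).im = 2 * cross κ (z - s) / Complex.normSq (toC (z - s + κ)) := fun z =>
    im_quotient κ (z - s)
  have hns : ∀ z ∈ L, 0 < Complex.normSq (toC (z - s + κ)) := fun z hz =>
    Complex.normSq_pos.2 (hne z hz)
  have hcs : ∀ z, cross κ (z - s) ≠ 0 → z ≠ s := by
    rintro z h rfl
    simp [cross] at h
  obtain ⟨r₀, hr₀⟩ := hαL.exists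
  set c := k (α r₀)
  have hc : ∀ z ∈ L \ {s}, (g z).im = (R z).arg + c := fun z hz => by
    have := hconst z hz (α r₀) ⟨hr₀.1, hcs _ hr₀.2.ne'⟩
    simp only [c, ← this, k]; ring
  obtain ⟨a1, a2⟩ := lim hα (hαL.mono fun _ h => h.1)
  obtain ⟨b1, b2⟩ := lim hβ (hβL.mono fun _ h => h.1)
  have l1 : Tendsto (fun r => (g (α r)).im) (𝓝[>] 0) (𝓝 (Real.pi + c)) := by
    have h1 : Tendsto (fun r => R (α r)) (𝓝[>] 0) (𝓝[{z : ℂ | 0 ≤ z.im}] (-1)) := by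
      refine tendsto_nhdsWithin_iff.2 ⟨a2, ?_⟩
      filter_upwards [hαL] with r hr
      show 0 ≤ (R (α r)).im
      rw [him]
      exact div_nonneg (by linarith [hr.2]) (hns _ hr.1).le
    have h2 := (Complex.continuousWithinAt_arg_of_re_neg_of_im_zero (z := -1) (by simp)
      (by simp)).tendsto.comp h1
    rw [Complex.arg_neg_one] at h2
    refine (h2.add_const c).congr' ?_
    filter_upwards [hαL] with r hr
    exact (hc _ ⟨hr.1, hcs _ hr.2.ne'⟩).symm
  have l2 : Tendsto (fun r => (g (β r)).im) (𝓝[>] 0) (𝓝 (-Real.pi + c)) := by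
    have h1 : Tendsto (fun r => R (β r)) (𝓝[>] 0) (𝓝[{z : ℂ | z.im < 0}] (-1)) := by
      refine tendsto_nhdsWithin_iff.2 ⟨b2, ?_⟩
      filter_upwards [hβL] with r hr
      show (R (β r)).im < 0
      rw [him]
      exact div_neg_of_neg_of_pos (by linarith [hr.2]) (hns _ hr.1)
    have h2 := (Complex.tendsto_arg_nhdsWithin_im_neg_of_re_neg_of_im_zero (z := -1) (by simp)
      (by simp)).comp h1
    refine (h2.add_const c).congr' ?_
    filter_upwards [hβL] with r hr
    exact (hc _ ⟨hr.1, hcs _ hr.2.ne⟩).symm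
  have e1 := tendsto_nhds_unique a1 l1
  have e2 := tendsto_nhds_unique b1 l2
  linarith [Real.pi_pos]

variable {e₁ e₂ : ℝ}

/-- Under the Hessian assumption the function has no local extrema. -/
lemma not_isLocalExtr (hF : HessianAssumption e₁ e₂) {p : ℝ × ℝ} (hp : p ∈ quadrant) :
    ¬ IsLocalExtr (F e₁ e₂) p := by
  obtain ⟨c⟩ := nonempty_levelChart (analyticAt_F e₁ e₂ hp) (hF p hp)
    (isOpen_quadrant.mem_nhds hp)
  have h0 : (0 : ℝ × ℝ) ∈ c.Φ.target := by rw [c.target_eq]; exact mem_ball_self c.δ_pos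
  have hsymm : c.Φ.symm 0 = p := by rw [← c.map_base, c.Φ.left_inv c.mem_source]
  have ht : Tendsto c.Φ.symm (𝓝 0) (𝓝 p) := by
    have := (c.Φ.continuousAt_symm h0).tendsto
    rwa [hsymm] at this
  -- In the chart, `F - F p` along `(r, σ * r)` is `σ * r` or `σ * r ^ 2`. The choices `σ = ±1` give
  -- both signs, whichever normal form applies.
  have hd : ∀ σ : ℝ, Tendsto (fun r : ℝ => (r, σ * r)) (𝓝[>] 0) (𝓝 0) := fun σ => by
    have : Continuous fun r : ℝ => (r, σ * r) := by fun_prop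
    have h := (this.tendsto 0).mono_left (nhdsWithin_le_nhds (s := Ioi 0))
    rw [mul_zero] at h
    exact h
  have key : ∀ σ : ℝ, ∀ᶠ r in 𝓝[>] (0 : ℝ), 0 < r ∧
      (F e₁ e₂ (c.Φ.symm (r, σ * r)) = F e₁ e₂ p + σ * r ∨
        F e₁ e₂ (c.Φ.symm (r, σ * r)) = F e₁ e₂ p + σ * r ^ 2) := fun σ => by
    filter_upwards [(hd σ).eventually (c.Φ.open_target.mem_nhds h0), self_mem_nhdsWithin]
      with r hr hr0
    refine ⟨hr0, ?_⟩
    have hm := c.Φ.map_target hr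
    rcases c.normal_form with h | h
    · exact Or.inl (by rw [h _ hm, c.Φ.right_inv hr])
    · exact Or.inr (by rw [h _ hm, c.Φ.right_inv hr]; ring)
  rintro (h | h)
  · obtain ⟨r, ⟨hr, h1⟩, h2⟩ := ((key (-1)).and ((ht.comp (hd (-1))).eventually h)).exists
    simp only [Function.comp] at h2
    have := pow_pos hr 2
    rcases h1 with h1 | h1 <;> linarith
  · obtain ⟨r, ⟨hr, h1⟩, h2⟩ := ((key 1).and ((ht.comp (hd 1)).eventually h)).exists
    simp only [Function.comp] at h2
    have := pow_pos hr 2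
    rcases h1 with h1 | h1 <;> linarith

/-- No component of the complement of a compact part of the solution set is bounded, by the
maximum principle. -/
lemma not_isBounded_component (hF : HessianAssumption e₁ e₂) (hL : IsCompact L)
    (hLS : L ⊆ solutionSet e₁ e₂) {q : ℝ × ℝ} (hFq : F e₁ e₂ q ≠ 0) :
    ¬ Bornology.IsBounded (connectedComponentIn Lᶜ q) := by
  intro hb
  set W := connectedComponentIn Lᶜ q
  have hqL : q ∈ Lᶜ := fun h => hFq (hLS h).2
  have hqW : q ∈ W := mem_connectedComponentIn hqL
  have hWo : IsOpen W := hL.isClosed.isOpen_compl.connectedComponentIn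
  have hWQ : W ⊆ quadrant := by
    intro y hy
    by_contra hyQ
    -- From a point outside the quadrant, the ray in direction `(-1, -1)` never enters the quadrant,
    -- so it misses `L` and would make `W` unbounded.
    have hray : (fun t : ℝ => y - t • ((1 : ℝ), (1 : ℝ))) '' Ici 0 ⊆ W := by
      have hWy : W = connectedComponentIn Lᶜ y := connectedComponentIn_eq hy
      rw [hWy]
      refine IsPreconnected.subset_connectedComponentIn
        (isPreconnected_Ici.image _ (by fun_prop)) ⟨0, by simp, by simp⟩ ?_
      rintro _ ⟨t, ht, rfl⟩ hmem
      have h1 := (hLS hmem).1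
      have ht0 : (0 : ℝ) ≤ t := ht
      apply hyQ
      have h2 : 0 < y.1 - t := by simpa using h1.1
      have h3 : 0 < y.2 - t := by simpa using h1.2
      exact ⟨show 0 < y.1 by linarith, show 0 < y.2 by linarith⟩
    obtain ⟨R, hR⟩ := (hb.subset hray).exists_norm_le
    have hy1 := norm_fst_le (y - (|y.1| + |R| + 1) • ((1 : ℝ), (1 : ℝ)))
    have h1 := hR _ (mem_image_of_mem (fun t : ℝ => y - t • ((1 : ℝ), (1 : ℝ)))
      (show |y.1| + |R| + 1 ∈ Ici (0 : ℝ) by rw [mem_Ici]; positivity))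
    have h2 : (y - (|y.1| + |R| + 1) • ((1 : ℝ), (1 : ℝ))).1 = y.1 - (|y.1| + |R| + 1) := by simp
    rw [h2, Real.norm_eq_abs] at hy1
    have h3 := neg_abs_le (y.1 - (|y.1| + |R| + 1))
    have h4 := le_abs_self y.1
    have h5 := le_abs_self R
    linarith
  have hcl : closure W ⊆ W ∪ L := by
    intro y hy
    by_contra hn
    rw [mem_union, not_or] at hn
    obtain ⟨z, hz1, hz2⟩ := mem_closure_iff.1 hy (connectedComponentIn Lᶜ y)
      hL.isClosed.isOpen_compl.connectedComponentIn (mem_connectedComponentIn hn.2)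
    have e1 : connectedComponentIn Lᶜ y = connectedComponentIn Lᶜ z := connectedComponentIn_eq hz1
    have e2 : W = connectedComponentIn Lᶜ z := connectedComponentIn_eq hz2
    exact hn.1 (e2.trans e1.symm ▸ mem_connectedComponentIn hn.2)
  have hclQ : closure W ⊆ quadrant :=
    hcl.trans (union_subset hWQ fun z hz => (hLS hz).1)
  have hcomp : IsCompact (closure W) := hb.isCompact_closure
  have hcont : ContinuousOn (F e₁ e₂) (closure W) := fun z hz =>
    (analyticAt_F e₁ e₂ (hclQ hz)).continuousAt.continuousWithinAt
  have hmem : ∀ z ∈ closure W, F e₁ e₂ z ≠ 0 → closure W ∈ 𝓝 z := fun z hz h0 => by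
    rcases hcl hz with h | h
    · exact mem_of_superset (hWo.mem_nhds h) subset_closure
    · exact absurd (hLS h).2 h0
  -- `F` vanishes on the part of `closure W` outside `W`, so an extreme value with the sign of `F q`
  -- is attained inside `W`.
  rcases lt_or_gt_of_ne hFq with hneg | hpos
  · obtain ⟨z, hz, hmin⟩ := hcomp.exists_isMinOn ⟨q, subset_closure hqW⟩ hcont
    have hz0 : F e₁ e₂ z ≠ 0 := ((hmin (subset_closure hqW)).trans_lt hneg).ne
    exact not_isLocalExtr hF (hclQ hz) (Or.inl (hmin.isLocalMin (hmem z hz hz0)))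
  · obtain ⟨z, hz, hmax⟩ := hcomp.exists_isMaxOn ⟨q, subset_closure hqW⟩ hcont
    have hz0 : F e₁ e₂ z ≠ 0 := (hpos.trans_le (hmax (subset_closure hqW))).ne'
    exact not_isLocalExtr hF (hclQ hz) (Or.inr (hmax.isLocalMax (hmem z hz hz0)))

lemma hasLogOn_of_solutionSet (hF : HessianAssumption e₁ e₂) (hL : IsCompact L)
    (hLS : L ⊆ solutionSet e₁ e₂) {q q' : ℝ × ℝ} (hFq : F e₁ e₂ q ≠ 0)
    (hFq' : F e₁ e₂ q' ≠ 0) : HasLogOn L q q' :=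
  hasLogOn_of_unbounded hL (fun h => hFq (hLS h).2) (fun h => hFq' (hLS h).2)
    (not_isBounded_component hF hL hLS hFq) (not_isBounded_component hF hL hLS hFq')

end
end DeSitter

/-! ### Separation of the rays of the solution set at a point. -/

namespace DeSitter
noncomputable section
open Filter Metric

variable {e₁ e₂ : ℝ} {p : ℝ × ℝ}

lemma cross_map (A : (ℝ × ℝ) →L[ℝ] (ℝ × ℝ)) (v w : ℝ × ℝ) :
    cross (A v) (A w) = cross (A (1, 0)) (A (0, 1)) * cross v w := by
  have h : ∀ v : ℝ × ℝ, A v = v.1 • A (1, 0) + v.2 • A (0, 1) := fun v => by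
    rw [← map_smul, ← map_smul, ← map_add]; congr 1; ext <;> simp
  rw [h v, h w]
  simp [cross]
  ring

lemma cross_basis_ne_zero {A B : (ℝ × ℝ) →L[ℝ] (ℝ × ℝ)} (h : ∀ v, B (A v) = v) :
    cross (A (1, 0)) (A (0, 1)) ≠ 0 := by
  intro h0
  have := cross_map B (A (1, 0)) (A (0, 1))
  rw [h, h, h0, mul_zero] at this
  simp [cross] at this

lemma eventually_pos_of_hasDerivAt {g : ℝ → ℝ} {g' : ℝ} (h : HasDerivAt g g' 0) (h0 : g 0 = 0)
    (hg : 0 < g') : ∀ᶠ r in 𝓝[>] (0 : ℝ), 0 < g r := by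
  have h1 := (hasDerivAt_iff_tendsto_slope.1 h).mono_left
    (nhdsWithin_mono 0 (fun r (hr : 0 < r) => hr.ne' : Ioi (0 : ℝ) ⊆ {0}ᶜ))
  filter_upwards [h1.eventually (eventually_gt_nhds hg), self_mem_nhdsWithin] with r hr hr0
  have hr0' : 0 < r := hr0
  rw [slope_def_field, h0, sub_zero, sub_zero] at hr
  exact (div_pos_iff_of_pos_right hr0').1 hr

lemma hasDerivAt_fst' {g : ℝ → ℝ × ℝ} {g' : ℝ × ℝ} {t : ℝ} (h : HasDerivAt g g' t) :
    HasDerivAt (fun x => (g x).1) g'.1 t :=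
  (ContinuousLinearMap.fst ℝ ℝ ℝ).hasFDerivAt.comp_hasDerivAt t h

lemma hasDerivAt_snd' {g : ℝ → ℝ × ℝ} {g' : ℝ × ℝ} {t : ℝ} (h : HasDerivAt g g' t) :
    HasDerivAt (fun x => (g x).2) g'.2 t :=
  (ContinuousLinearMap.snd ℝ ℝ ℝ).hasFDerivAt.comp_hasDerivAt t h

namespace LevelChart

variable {G : ℝ × ℝ → ℝ} {N : Set (ℝ × ℝ)} (c : LevelChart G p N)

lemma zero_mem_target : (0 : ℝ × ℝ) ∈ c.Φ.target := by
  rw [c.target_eq]; exact mem_ball_self c.δ_pos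

lemma symm_zero : c.Φ.symm 0 = p := by rw [← c.map_base, c.Φ.left_inv c.mem_source]

/-- The differential of the inverse chart at the origin. -/
def A : (ℝ × ℝ) →L[ℝ] (ℝ × ℝ) := fderiv ℝ c.Φ.symm 0

lemma hasFDerivAt_symm : HasFDerivAt c.Φ.symm c.A 0 :=
  (c.analytic_symm 0 c.zero_mem_target).differentiableAt.hasFDerivAt

lemma fderiv_A (v : ℝ × ℝ) : fderiv ℝ c.Φ p (c.A v) = v := by
  have h1 : HasFDerivAt c.Φ (fderiv ℝ c.Φ p) (c.Φ.symm 0) := by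
    rw [c.symm_zero]
    exact (c.analytic p c.mem_source).differentiableAt.hasFDerivAt
  have h2 := h1.comp 0 c.hasFDerivAt_symm
  have h3 : HasFDerivAt (c.Φ ∘ c.Φ.symm) (ContinuousLinearMap.id ℝ (ℝ × ℝ)) 0 := by
    refine (hasFDerivAt_id 0).congr_of_eventuallyEq ?_
    filter_upwards [c.Φ.open_target.mem_nhds c.zero_mem_target] with y hy
    simp [c.Φ.right_inv hy]
  exact DFunLike.congr_fun (h2.unique h3) v

/-- The image under the inverse chart of the ray in direction `w`. -/
def ray (w : ℝ × ℝ) (r : ℝ) : ℝ × ℝ := c.Φ.symm (r • w)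

lemma smul_mem_target {w : ℝ × ℝ} (hw : ‖w‖ = 1) {r : ℝ} (hr : |r| < c.δ) :
    r • w ∈ c.Φ.target := by
  rwa [c.target_eq, mem_ball_zero_iff, norm_smul, hw, mul_one, Real.norm_eq_abs]

lemma map_ray {w : ℝ × ℝ} (hw : ‖w‖ = 1) {r : ℝ} (hr : |r| < c.δ) :
    c.Φ (c.ray w r) = r • w := c.Φ.right_inv (c.smul_mem_target hw hr)

lemma ray_mem_source {w : ℝ × ℝ} (hw : ‖w‖ = 1) {r : ℝ} (hr : |r| < c.δ) :
    c.ray w r ∈ c.Φ.source := c.Φ.map_target (c.smul_mem_target hw hr)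

@[simp] lemma ray_zero (w : ℝ × ℝ) : c.ray w 0 = p := by rw [ray, zero_smul, c.symm_zero]

lemma ray_ne {w : ℝ × ℝ} (hw : ‖w‖ = 1) {r : ℝ} (hr : |r| < c.δ) (h0 : r ≠ 0) :
    c.ray w r ≠ p := by
  intro h
  have h1 := c.map_ray hw hr
  rw [h, c.map_base] at h1
  rcases smul_eq_zero.1 h1.symm with h2 | h2
  · exact h0 h2
  · simp [h2] at hw

lemma analyticAt_ray {w : ℝ × ℝ} (hw : ‖w‖ = 1) {r : ℝ} (hr : |r| < c.δ) :
    AnalyticAt ℝ (c.ray w) r := by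
  have h1 : AnalyticAt ℝ (fun r : ℝ => r • w) r := by fun_prop
  exact AnalyticAt.fun_comp (f := fun r : ℝ => r • w)
    (c.analytic_symm _ (c.smul_mem_target hw hr)) h1

lemma hasDerivAt_ray (w : ℝ × ℝ) : HasDerivAt (c.ray w) (c.A w) 0 := by
  have h1 : HasDerivAt (fun r : ℝ => r • w) w 0 := by simpa using (hasDerivAt_id (0 : ℝ)).smul_const w
  have h2 : HasFDerivAt c.Φ.symm c.A ((0 : ℝ) • w) := by rw [zero_smul]; exact c.hasFDerivAt_symm
  exact h2.comp_hasDerivAt 0 h1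

lemma deriv_ray_ne_zero {w : ℝ × ℝ} (hw : ‖w‖ = 1) {r : ℝ} (hr : |r| < c.δ) :
    deriv (c.ray w) r ≠ 0 := by
  intro h0
  have h1 : HasDerivAt (c.ray w) 0 r := h0 ▸ (c.analyticAt_ray hw hr).differentiableAt.hasDerivAt
  have h2 := ((c.analytic _ (c.ray_mem_source hw hr)).differentiableAt.hasFDerivAt).comp_hasDerivAt
    r h1
  have h3 : HasDerivAt (c.Φ ∘ c.ray w) w r := by
    have : HasDerivAt (fun r : ℝ => r • w) w r := by simpa using (hasDerivAt_id r).smul_const w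
    refine this.congr_of_eventuallyEq ?_
    have hc : ContinuousAt (fun r : ℝ => |r|) r := continuous_abs.continuousAt
    filter_upwards [hc.eventually_lt continuousAt_const hr] with x hx
    exact c.map_ray hw hx
  have h4 := h2.unique h3
  rw [map_zero] at h4
  simp [← h4] at hw

end LevelChart

/-- The two coordinate directions. -/
def axis (i : Bool) : ℝ × ℝ := if i then (0, 1) else (1, 0)

lemma norm_smul_axis {σ : ℝ} (hσ : σ ^ 2 = 1) (i : Bool) : ‖σ • axis i‖ = 1 := by
  have h : |σ| = 1 := by rwa [← sq_eq_sq₀ (abs_nonneg _) zero_le_one, sq_abs, one_pow]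
  cases i <;> simp [axis, h, Prod.norm_def]

/-- Any two of the four half-axes lie on opposite sides of one of the two diagonals. -/
lemma exists_separating {i j : Bool} {σ τ : ℝ} (hσ : σ ^ 2 = 1) (hτ : τ ^ 2 = 1)
    (h : (i, σ) ≠ (j, τ)) :
    ∃ u : ℝ × ℝ, u.1 ≠ 0 ∧ u.2 ≠ 0 ∧ cross u (σ • axis i) * cross u (τ • axis j) < 0 := by
  have key : ∀ {x : ℝ}, x ^ 2 = 1 → x = 1 ∨ x = -1 := fun hx => sq_eq_one_iff.1 hx
  rcases key hσ with rfl | rfl <;> rcases key hτ with rfl | rfl <;> cases i <;> cases j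
  all_goals first
    | exact absurd rfl h
    | (refine ⟨(1, 1), ?_, ?_, ?_⟩ <;> norm_num [cross, axis]; done)
    | (refine ⟨(1, -1), ?_, ?_, ?_⟩ <;> norm_num [cross, axis])

/-- `B` lists the coordinate axes contained in the zero set: only the horizontal one in the regular
case, both at a crossing. -/
lemma LevelChart.exists_zero_set {N : Set (ℝ × ℝ)} (c : LevelChart (F e₁ e₂) p N)
    (hp : F e₁ e₂ p = 0) : ∃ B : Set Bool, false ∈ B ∧
      ∀ q ∈ c.Φ.source, F e₁ e₂ q = 0 ↔ ∃ i ∈ B, ∃ r : ℝ, c.Φ q = r • axis i := by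
  rcases c.normal_form with h | h
  · refine ⟨{false}, rfl, fun q hq => ?_⟩
    rw [h q hq, hp, zero_add]
    constructor
    · exact fun h0 => ⟨false, rfl, (c.Φ q).1, by ext <;> simp [axis, h0]⟩
    · rintro ⟨i, rfl, r, hr⟩
      simp [hr, axis]
  · refine ⟨univ, trivial, fun q hq => ?_⟩
    rw [h q hq, hp, zero_add]
    constructor
    · intro h0
      rcases mul_eq_zero.1 h0 with h1 | h1
      · exact ⟨true, trivial, (c.Φ q).2, by ext <;> simp [axis, h1]⟩
      · exact ⟨false, trivial, (c.Φ q).1, by ext <;> simp [axis, h1]⟩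
    · rintro ⟨i, -, r, hr⟩
      cases i <;> simp [hr, axis]

/-- Distinct rays of the solution set emanating from `p` are not connected to each other within
the solution set without `p`. -/
lemma LevelChart.rays_separated (hF : HessianAssumption e₁ e₂) (c : LevelChart (F e₁ e₂) p quadrant)
    {B : Set Bool}
    (hB : ∀ q ∈ c.Φ.source, F e₁ e₂ q = 0 ↔ ∃ i ∈ B, ∃ r : ℝ, c.Φ q = r • axis i)
    {i j : Bool} (hi : i ∈ B) (hj : j ∈ B) {σ τ : ℝ} (hσ : σ ^ 2 = 1) (hτ : τ ^ 2 = 1)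
    (hij : (i, σ) ≠ (j, τ)) {C : Set (ℝ × ℝ)} (hC : IsCompact C) (hCc : IsPreconnected C)
    (hCS : C ⊆ solutionSet e₁ e₂ \ {p}) {r r' : ℝ} (hr : 0 < r) (hrδ : r < c.δ) (hr' : 0 < r')
    (hrδ' : r' < c.δ) (hrC : c.ray (σ • axis i) r ∈ C) (hrC' : c.ray (τ • axis j) r' ∈ C) :
    False := by
  have hw := norm_smul_axis hσ i
  have hw' := norm_smul_axis hτ j
  have abs_lt' : ∀ {x y : ℝ}, 0 ≤ x → x ≤ y → y < c.δ → |x| < c.δ := fun h0 h1 h2 => by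
    rw [abs_of_nonneg h0]; exact h1.trans_lt h2
  have hrayS : ∀ {k : Bool} {υ : ℝ}, k ∈ B → υ ^ 2 = 1 → ∀ {x}, |x| < c.δ →
      c.ray (υ • axis k) x ∈ solutionSet e₁ e₂ := fun {k υ} hk hυ x hx => by
    have h1 := c.ray_mem_source (norm_smul_axis hυ k) hx
    refine ⟨c.source_subset h1, (hB _ h1).2 ⟨k, hk, x * υ, ?_⟩⟩
    rw [c.map_ray (norm_smul_axis hυ k) hx, smul_smul]
  obtain ⟨u, hu1, hu2, hcr⟩ := exists_separating hσ hτ hij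
  set K := c.A u with hK
  have hdet := cross_basis_ne_zero c.fderiv_A
  have hK0 : K ≠ 0 := fun h => by
    have := c.fderiv_A u
    rw [← hK, h, map_zero] at this
    exact hu1 (by rw [← this]; rfl)
  have hline : HasDerivAt (fun ρ : ℝ => p + ρ • K) K 0 := by
    simpa using ((hasDerivAt_id (0 : ℝ)).smul_const K).const_add p
  have hΦl : HasDerivAt (fun ρ : ℝ => c.Φ (p + ρ • K)) u 0 := by
    have h1 : HasFDerivAt c.Φ (fderiv ℝ c.Φ p) (p + (0 : ℝ) • K) := by
      rw [zero_smul, add_zero]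
      exact (c.analytic p c.mem_source).differentiableAt.hasFDerivAt
    have h2 := h1.comp_hasDerivAt 0 hline
    rw [hK, c.fderiv_A] at h2
    exact h2
  -- To first order the chart maps the line through `p` in direction `K` to the diagonal spanned by
  -- `u`, so near `p` and away from it both coordinates are nonzero and the line misses the axes.
  have hseg : ∀ᶠ ρ in 𝓝[≠] (0 : ℝ), F e₁ e₂ (p + ρ • K) ≠ 0 := by
    have f1 : HasDerivAt (fun ρ : ℝ => (c.Φ (p + ρ • K)).1) u.1 0 := hasDerivAt_fst' hΦl
    have f2 : HasDerivAt (fun ρ : ℝ => (c.Φ (p + ρ • K)).2) u.2 0 := hasDerivAt_snd' hΦl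
    have hsrc : ∀ᶠ ρ in 𝓝 (0 : ℝ), p + ρ • K ∈ c.Φ.source :=
      hline.continuousAt.eventually_mem (by
        rw [zero_smul, add_zero]; exact c.Φ.open_source.mem_nhds c.mem_source)
    filter_upwards [f1.eventually_ne (c := 0) hu1, f2.eventually_ne (c := 0) hu2,
      hsrc.filter_mono nhdsWithin_le_nhds] with ρ h1 h2 h3 h4
    obtain ⟨k, -, x, hx⟩ := (hB _ h3).1 h4
    cases k
    · exact h2 (by rw [hx]; simp [axis])
    · exact h1 (by rw [hx]; simp [axis])
  obtain ⟨ε, hε, hεb⟩ := Metric.eventually_nhds_iff_ball.1 (eventually_nhdsWithin_iff.1 hseg)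
  set κ := (ε / 2) • K with hκ
  have hκ0 : κ ≠ 0 := smul_ne_zero (by positivity) hK0
  have hsegκ : ∀ ρ ∈ Icc (-1 : ℝ) 1, ρ ≠ 0 → F e₁ e₂ (p + ρ • κ) ≠ 0 := fun ρ hρ h0 => by
    rw [hκ, smul_smul]
    refine hεb _ ?_ (mul_ne_zero h0 (by positivity))
    rw [mem_ball_zero_iff, Real.norm_eq_abs, abs_mul, abs_of_pos (by positivity : 0 < ε / 2)]
    nlinarith [abs_le.2 hρ]
  -- `C` closed up by the two pieces of rays. Removing `p` leaves it connected, because both rays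
  -- end in `C`.
  set L := C ∪ (c.ray (σ • axis i) '' Icc 0 r ∪ c.ray (τ • axis j) '' Icc 0 r') with hL
  have cont : ∀ {k : Bool} {υ : ℝ}, υ ^ 2 = 1 → ∀ {x : ℝ}, x < c.δ →
      ContinuousOn (c.ray (υ • axis k)) (Icc 0 x) := fun {k υ} hυ x hx y hy =>
    (c.analyticAt_ray (norm_smul_axis hυ k) (abs_lt' hy.1 hy.2 hx)).continuousAt.continuousWithinAt
  have hLc : IsCompact L := hC.union ((isCompact_Icc.image_of_continuousOn (cont hσ hrδ)).union
    (isCompact_Icc.image_of_continuousOn (cont hτ hrδ')))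
  have hLS : L ⊆ solutionSet e₁ e₂ := by
    refine union_subset (hCS.trans sdiff_subset) (union_subset ?_ ?_)
    · rintro _ ⟨x, hx, rfl⟩; exact hrayS hi hσ (abs_lt' hx.1 hx.2 hrδ)
    · rintro _ ⟨x, hx, rfl⟩; exact hrayS hj hτ (abs_lt' hx.1 hx.2 hrδ')
  have hpL : p ∈ L := Or.inr (Or.inl ⟨0, ⟨le_rfl, hr.le⟩, c.ray_zero _⟩)
  have hdiff : ∀ {k : Bool} {υ : ℝ}, υ ^ 2 = 1 → ∀ {x : ℝ}, 0 < x → x < c.δ →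
      c.ray (υ • axis k) '' Icc 0 x \ {p} = c.ray (υ • axis k) '' Ioc 0 x := fun {k υ} hυ x hx hxδ => by
    ext z
    constructor
    · rintro ⟨⟨y, hy, rfl⟩, hz⟩
      refine ⟨y, ⟨lt_of_le_of_ne hy.1 fun h => hz ?_, hy.2⟩, rfl⟩
      rw [← h]; exact c.ray_zero _
    · rintro ⟨y, hy, rfl⟩
      exact ⟨⟨y, ⟨hy.1.le, hy.2⟩, rfl⟩,
        c.ray_ne (norm_smul_axis hυ k) (abs_lt' hy.1.le hy.2 hxδ) hy.1.ne'⟩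
  have hconn : IsPreconnected (L \ {p}) := by
    have e : L \ {p} = C ∪ c.ray (σ • axis i) '' Ioc 0 r ∪ c.ray (τ • axis j) '' Ioc 0 r' := by
      rw [hL, union_sdiff_distrib, union_sdiff_distrib, hdiff hσ hr hrδ, hdiff hτ hr' hrδ',
        sdiff_singleton_eq_self (fun h => (hCS h).2 rfl), union_assoc]
    rw [e]
    refine IsPreconnected.union _ (Or.inl hrC') ⟨r', ⟨hr', le_rfl⟩, rfl⟩
      (IsPreconnected.union _ hrC ⟨r, ⟨hr, le_rfl⟩, rfl⟩ hCc ?_) ?_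
    · exact isPreconnected_Ioc.image _ ((cont hσ hrδ).mono Ioc_subset_Icc_self)
    · exact isPreconnected_Ioc.image _ ((cont hτ hrδ').mono Ioc_subset_Icc_self)
  have hlog : HasLogOn L (p + κ) (p - κ) := by
    refine hasLogOn_of_solutionSet hF hLc hLS ?_ ?_
    · simpa using hsegκ 1 (by norm_num) one_ne_zero
    · simpa [sub_eq_add_neg] using hsegκ (-1) (by norm_num) (by norm_num)
  have hsegL : ∀ ρ ∈ Icc (-1 : ℝ) 1, p + ρ • κ ∈ L → ρ = 0 := fun ρ hρ h => by
    by_contra h0; exact hsegκ ρ hρ h0 (hLS h).2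
  have tend : ∀ w, Tendsto (c.ray w) (𝓝[>] 0) (𝓝 p) := fun w => by
    have := (c.hasDerivAt_ray w).continuousAt.tendsto
    rw [c.ray_zero] at this
    exact this.mono_left nhdsWithin_le_nhds
  have evL : (∀ᶠ x in 𝓝[>] 0, c.ray (σ • axis i) x ∈ L) ∧
      ∀ᶠ x in 𝓝[>] 0, c.ray (τ • axis j) x ∈ L := by
    constructor
    · filter_upwards [Ioc_mem_nhdsGT hr] with x hx
      exact Or.inr (Or.inl ⟨x, ⟨hx.1.le, hx.2⟩, rfl⟩)
    · filter_upwards [Ioc_mem_nhdsGT hr'] with x hx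
      exact Or.inr (Or.inr ⟨x, ⟨hx.1.le, hx.2⟩, rfl⟩)
  have hder : ∀ w, HasDerivAt (fun x => cross κ (c.ray w x - p)) (cross κ (c.A w)) 0 := fun w => by
    have h1 := (c.hasDerivAt_ray w).sub_const p
    have f1 : HasDerivAt (fun x => (c.ray w x - p).1) (c.A w).1 0 := hasDerivAt_fst' h1
    have f2 : HasDerivAt (fun x => (c.ray w x - p).2) (c.A w).2 0 := hasDerivAt_snd' h1
    exact (f2.const_mul κ.1).sub (f1.const_mul κ.2)
  have h00 : ∀ w, cross κ (c.ray w 0 - p) = 0 := fun w => by simp [cross]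
  have pos : ∀ w, 0 < cross κ (c.A w) → ∀ᶠ x in 𝓝[>] 0, 0 < cross κ (c.ray w x - p) :=
    fun w hw => eventually_pos_of_hasDerivAt (hder w) (h00 w) hw
  have neg : ∀ w, cross κ (c.A w) < 0 → ∀ᶠ x in 𝓝[>] 0, cross κ (c.ray w x - p) < 0 :=
    fun w hw => by
      filter_upwards [eventually_pos_of_hasDerivAt (hder w).neg (by simp [cross]) (neg_pos.2 hw)]
        with x hx using neg_pos.1 hx
  -- The inverse chart multiplies `cross` by its determinant at the origin. This factor enters
  -- squared in the product below, so the rays remain on opposite sides of the segment.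
  have hval : ∀ w, cross κ (c.A w) = ε / 2 * (cross (c.A (1, 0)) (c.A (0, 1)) * cross u w) :=
    fun w => by rw [← cross_map, hκ]; simp only [cross, Prod.smul_fst, Prod.smul_snd, smul_eq_mul, hK]; ring
  have hprod : cross κ (c.A (σ • axis i)) * cross κ (c.A (τ • axis j)) < 0 := by
    rw [hval, hval]
    have : 0 < (ε / 2 * cross (c.A (1, 0)) (c.A (0, 1))) ^ 2 := by positivity
    nlinarith
  rcases mul_neg_iff.1 hprod with ⟨h1, h2⟩ | ⟨h1, h2⟩
  · exact not_hasLogOn hpL hκ0 hsegL hconn (tend _) (tend _) (evL.1.and (pos _ h1))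
      (evL.2.and (neg _ h2)) hlog
  · exact not_hasLogOn hpL hκ0 hsegL hconn (tend _) (tend _) (evL.2.and (pos _ h2))
      (evL.1.and (neg _ h1)) hlog

end
end DeSitter

/-! ### Local branches at a solution point. -/

namespace DeSitter
noncomputable section
open Filter Metric

variable {e₁ e₂ : ℝ} {p : ℝ × ℝ}

/-- The local branches of the solution set at one of its points, parameterized by arclength. -/
structure Branches (e₁ e₂ : ℝ) (p : ℝ × ℝ) where
  B : Set Bool
  false_mem : false ∈ B
  U : Set (ℝ × ℝ)
  isOpen : IsOpen U
  mem : p ∈ U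
  J : Bool → Set ℝ
  η : Bool → ℝ → ℝ × ℝ
  unit : ∀ i, IsUnitCurve (J i) (η i)
  zero_mem : ∀ i, (0 : ℝ) ∈ J i
  base : ∀ i, η i 0 = p
  mapsTo : ∀ i ∈ B, MapsTo (η i) (J i) (solutionSet e₁ e₂)
  cover : ∀ q ∈ U, q ∈ solutionSet e₁ e₂ → ∃ i ∈ B, ∃ r ∈ J i, η i r = q
  small : ∀ i, ∀ ε > 0, ∀ᶠ q in 𝓝 p, ∀ r ∈ J i, η i r = q → |r| < ε
  rigid : ∀ I γ, IsUnitCurve I γ → MapsTo γ I U → MapsTo γ I (solutionSet e₁ e₂) →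
    ∃ i ∈ B, ∃ ε c : ℝ, ε ^ 2 = 1 ∧ ∀ t ∈ I, ε * t + c ∈ J i ∧ γ t = η i (ε * t + c)
  separated : ∀ i ∈ B, ∀ j ∈ B, ∀ σ τ : ℝ, σ ^ 2 = 1 → τ ^ 2 = 1 → (i, σ) ≠ (j, τ) →
    ∀ C, IsCompact C → IsPreconnected C → C ⊆ solutionSet e₁ e₂ \ {p} →
    ∀ r ∈ J i, 0 < σ * r → η i r ∈ C → ∀ r' ∈ J j, 0 < τ * r' → η j r' ∉ C

/-- An analytic curve in a cross cannot turn from one axis to the other: once the second coordinate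
is nonzero at some parameter, the first vanishes near it, hence everywhere by the identity theorem.
-/
lemma axis_coord {c : LevelChart (F e₁ e₂) p quadrant} {B : Set Bool}
    (hB : ∀ q ∈ c.Φ.source, F e₁ e₂ q = 0 ↔ ∃ i ∈ B, ∃ r : ℝ, c.Φ q = r • axis i)
    {I : Set ℝ} {γ : ℝ → ℝ × ℝ} (hγ : IsUnitCurve I γ) (hU : MapsTo γ I c.Φ.source)
    (hS : MapsTo γ I (solutionSet e₁ e₂)) :
    ∃ i ∈ B, ∃ θ : ℝ → ℝ, AnalyticOnNhd ℝ θ I ∧ ∀ t ∈ I, c.Φ (γ t) = θ t • axis i := by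
  have hΦγ : ∀ t ∈ I, AnalyticAt ℝ (fun t => c.Φ (γ t)) t := fun t ht =>
    (c.analytic _ (hU ht)).fun_comp (hγ.analytic t ht)
  have hX : AnalyticOnNhd ℝ (fun t => (c.Φ (γ t)).1) I := fun t ht =>
    analyticAt_fst.fun_comp (hΦγ t ht)
  have hY : AnalyticOnNhd ℝ (fun t => (c.Φ (γ t)).2) I := fun t ht =>
    analyticAt_snd.fun_comp (hΦγ t ht)
  have hz : ∀ t ∈ I, ∃ i ∈ B, ∃ r : ℝ, c.Φ (γ t) = r • axis i := fun t ht =>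
    (hB _ (hU ht)).1 (hS ht).2
  have hpc := hγ.ordConnected.isPreconnected
  obtain ⟨t₀, ht₀⟩ := hγ.nonempty
  by_cases hall : ∀ t ∈ I, (c.Φ (γ t)).2 = 0
  · by_cases hf : false ∈ B
    · exact ⟨false, hf, _, hX, fun t ht => by ext <;> simp [axis, hall t ht]⟩
    · refine ⟨true, ?_, _, hY, fun t ht => ?_⟩
      · obtain ⟨i, hi, -⟩ := hz t₀ ht₀
        cases i
        · exact absurd hi hf
        · exact hi
      · obtain ⟨i, hi, r, hr⟩ := hz t ht
        cases i
        · exact absurd hi hf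
        · rw [hr]; ext <;> simp [axis]
  · push Not at hall
    obtain ⟨t₁, ht₁, hne⟩ := hall
    have htrue : ∀ t ∈ I, (c.Φ (γ t)).2 ≠ 0 → true ∈ B ∧ (c.Φ (γ t)).1 = 0 := fun t ht h => by
      obtain ⟨i, hi, r, hr⟩ := hz t ht
      cases i
      · simp [hr, axis] at h
      · exact ⟨hi, by simp [hr, axis]⟩
    have hev : (fun t => (c.Φ (γ t)).1) =ᶠ[𝓝 t₁] 0 := by
      filter_upwards [(hY t₁ ht₁).continuousAt.eventually_ne hne, hγ.isOpen.mem_nhds ht₁]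
        with t h1 h2 using (htrue t h2 h1).2
    have hX0 := hX.eqOn_zero_of_preconnected_of_eventuallyEq_zero hpc ht₁ hev
    refine ⟨true, (htrue t₁ ht₁ hne).1, _, hY, fun t ht => ?_⟩
    have : (c.Φ (γ t)).1 = 0 := hX0 ht
    ext <;> simp [axis, this]

/-- The branches are the axes of a level chart, parametrized by arclength from `p`. Any arclength
solution curve in the chart follows one axis, with an affine change of parameter of slope `±1`. -/
theorem nonempty_branches (hF : HessianAssumption e₁ e₂) (hp : p ∈ solutionSet e₁ e₂) :
    Nonempty (Branches e₁ e₂ p) := by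
  obtain ⟨c⟩ := nonempty_levelChart (analyticAt_F e₁ e₂ hp.1) (hF p hp.1)
    (isOpen_quadrant.mem_nhds hp.1)
  obtain ⟨B, hBf, hB⟩ := c.exists_zero_set hp.2
  have hw : ∀ i, ‖axis i‖ = 1 := fun i => by simpa using norm_smul_axis (one_pow 2) i
  set D : Set ℝ := Ioo (-c.δ) c.δ
  have hD : ∀ {r}, r ∈ D ↔ |r| < c.δ := fun {r} => abs_lt.symm
  have h0D : (0 : ℝ) ∈ D := hD.2 (by simpa using c.δ_pos)
  have hray : ∀ i, ∃ (η : ℝ → ℝ × ℝ) (φ : ℝ → ℝ), IsUnitCurve (φ '' D) η ∧ AnalyticOnNhd ℝ φ D ∧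
      (∀ t ∈ D, 0 < deriv φ t) ∧ StrictMonoOn φ D ∧ φ 0 = 0 ∧
        ∀ t ∈ D, c.ray (axis i) t = η (φ t) := fun i =>
    exists_arclength isOpen_Ioo ordConnected_Ioo
      (fun r hr => c.source_subset (c.ray_mem_source (hw i) (hD.1 hr)))
      (fun r hr => c.analyticAt_ray (hw i) (hD.1 hr))
      (fun r hr => c.deriv_ray_ne_zero (hw i) (hD.1 hr)) h0D
  choose η φ hη hφ hφd hφm hφ0 hηr using hray
  have hrayS : ∀ i ∈ B, ∀ r ∈ D, c.ray (axis i) r ∈ solutionSet e₁ e₂ := fun i hi r hr => by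
    have h1 := c.ray_mem_source (hw i) (hD.1 hr)
    exact ⟨c.source_subset h1, (hB _ h1).2 ⟨i, hi, r, c.map_ray (hw i) (hD.1 hr)⟩⟩
  have hcoord : ∀ {q i r}, q ∈ c.Φ.source → c.Φ q = r • axis i → r ∈ D ∧ c.ray (axis i) r = q := by
    intro q i r hq h
    have h1 := c.Φ.map_source hq
    rw [h, c.target_eq, mem_ball_zero_iff, norm_smul, hw, mul_one] at h1
    exact ⟨hD.2 h1, by rw [LevelChart.ray, ← h, c.Φ.left_inv hq]⟩
  have hsign : ∀ i, ∀ σ : ℝ, σ ^ 2 = 1 → ∀ r ∈ D, 0 < σ * φ i r → 0 < σ * r := by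
    intro i σ hσ r hr h
    rcases sq_eq_one_iff.1 hσ with rfl | rfl
    · rw [one_mul] at h ⊢
      rw [← hφ0 i] at h
      exact ((hφm i).lt_iff_lt h0D hr).1 h
    · rw [neg_one_mul, neg_pos] at h ⊢
      rw [← hφ0 i] at h
      exact ((hφm i).lt_iff_lt hr h0D).1 h
  refine ⟨⟨B, hBf, c.Φ.source, c.Φ.open_source, c.mem_source, fun i => φ i '' D, η, hη,
    fun i => ⟨0, h0D, hφ0 i⟩, fun i => ?_, ?_, ?_, ?_, ?_, ?_⟩⟩
  · rw [← hφ0 i, ← hηr i 0 h0D, c.ray_zero]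
  · rintro i hi _ ⟨r, hr, rfl⟩
    rw [← hηr i r hr]; exact hrayS i hi r hr
  · intro q hqU hq
    obtain ⟨i, hi, r, hr⟩ := (hB q hqU).1 hq.2
    obtain ⟨h1, h2⟩ := hcoord hqU hr
    exact ⟨i, hi, φ i r, mem_image_of_mem _ h1, by rw [← hηr i r h1, h2]⟩
  · intro i ε hε
    have h1 : ∀ᶠ x in 𝓝 (0 : ℝ), |φ i x| < ε := by
      have : ContinuousAt (fun x => |φ i x|) 0 := (hφ i 0 h0D).continuousAt.abs
      exact this.eventually_lt continuousAt_const (by simpa [hφ0] using hε)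
    obtain ⟨ρ, hρ, hb⟩ := Metric.eventually_nhds_iff_ball.1 h1
    have h2 : ∀ᶠ q in 𝓝 p, ‖c.Φ q‖ < ρ := by
      have : ContinuousAt (fun q => ‖c.Φ q‖) p := (c.Φ.continuousAt c.mem_source).norm
      exact this.eventually_lt continuousAt_const (by simpa [c.map_base] using hρ)
    filter_upwards [h2] with q hq
    rintro _ ⟨x, hx, rfl⟩ hηq
    rw [← hηr i x hx] at hηq
    rw [← hηq, c.map_ray (hw i) (hD.1 hx), norm_smul, hw, mul_one] at hq
    exact hb x (by rwa [mem_ball_zero_iff])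
  · intro I γ hγ hU hS
    obtain ⟨i, hi, θ, hθ, hθγ⟩ := axis_coord hB hγ hU hS
    have hθD : ∀ t ∈ I, θ t ∈ D ∧ c.ray (axis i) (θ t) = γ t := fun t ht =>
      hcoord (hU ht) (hθγ t ht)
    have hγη : ∀ t ∈ I, γ t = η i (φ i (θ t)) := fun t ht => by
      rw [← hηr i _ (hθD t ht).1, (hθD t ht).2]
    have hcomp : AnalyticOnNhd ℝ (fun t => φ i (θ t)) I := fun t ht =>
      (hφ i _ (hθD t ht).1).fun_comp (hθ t ht)
    obtain ⟨ε, b, hε, haff⟩ := exists_affine hγ.isOpen hγ.ordConnected hcomp fun t ht => by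
      have h1 := hγ.speed t ht
      have hm := mem_image_of_mem (φ i) (hθD t ht).1
      rw [speedSq_congr (η := fun t => η i (φ i (θ t))) (by
        filter_upwards [hγ.isOpen.mem_nhds ht] with u hu using hγη u hu),
        speedSq_comp (γ := η i) (φ := fun t => φ i (θ t))
          ((hη i).analytic _ hm).differentiableAt (hcomp t ht).differentiableAt,
        (hη i).speed _ hm, mul_one] at h1
      exact h1
    refine ⟨i, hi, ε, b, hε, fun t ht => ?_⟩
    rw [← haff t ht]
    exact ⟨mem_image_of_mem _ (hθD t ht).1, hγη t ht⟩
  · rintro i hi j hj σ τ hσ hτ hij C hC hCc hCS _ ⟨r, hr, rfl⟩ hpos hrC _ ⟨r', hr', rfl⟩ hpos' hrC'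
    have conv : ∀ {k : Bool} {υ x : ℝ}, υ ^ 2 = 1 → x ∈ D → 0 < υ * φ k x →
        0 < υ * x ∧ υ * x < c.δ ∧ c.ray (υ • axis k) (υ * x) = η k (φ k x) := by
      intro k υ x hυ hx h
      have h1 := hsign k υ hυ x hx h
      have h2 : |υ * x| = |x| := by
        rw [abs_mul, show |υ| = 1 by rwa [← sq_eq_sq₀ (abs_nonneg _) zero_le_one, sq_abs, one_pow],
          one_mul]
      refine ⟨h1, (le_abs_self _).trans_lt (h2 ▸ hD.1 hx), ?_⟩
      rw [← hηr k x hx, LevelChart.ray, LevelChart.ray, smul_smul]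
      congr 2
      linear_combination x * hυ
    obtain ⟨a1, a2, a3⟩ := conv hσ hr hpos
    obtain ⟨b1, b2, b3⟩ := conv hτ hr' hpos'
    exact c.rays_separated hF hB hi hj hσ hτ hij hC hCc hCS a1 a2 b1 b2 (a3 ▸ hrC) (b3 ▸ hrC')

end
end DeSitter

/-! ### Inextendible solution curves are injective and leave compact sets. -/

namespace DeSitter
noncomputable section
open Filter Metric

variable {e₁ e₂ : ℝ} {p : ℝ × ℝ} {I : Set ℝ} {γ : ℝ → ℝ × ℝ}

lemma Branches.eq_zero_of_eq_base (b : Branches e₁ e₂ p) {i : Bool} {r : ℝ} (hr : r ∈ b.J i)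
    (h : b.η i r = p) : r = 0 := by
  by_contra h0
  exact lt_irrefl _ ((b.small i |r| (abs_pos.2 h0)).self_of_nhds r hr h)

lemma IsUnitCurve.mono (h : IsUnitCurve I γ) {J : Set ℝ} (hJ : J ⊆ I) (ho : IsOpen J)
    (hc : J.OrdConnected) (hn : J.Nonempty) : IsUnitCurve J γ :=
  ⟨ho, hc, hn, h.mapsTo.mono_left hJ, h.analytic.mono hJ, fun t ht => h.speed t (hJ ht)⟩

/-- An inextendible solution curve, parameterized by arclength. -/
structure IsMaxCurve (e₁ e₂ : ℝ) (I : Set ℝ) (γ : ℝ → ℝ × ℝ) : Prop extends IsUnitCurve I γ where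
  not_extendible : ¬ IsExtendible I γ
  solution : MapsTo γ I (solutionSet e₁ e₂)

/-- An inextendible solution curve that enters the neighbourhood of a point contains a whole local
branch there. -/
lemma IsMaxCurve.exists_branch (h : IsMaxCurve e₁ e₂ I γ) (b : Branches e₁ e₂ p) {t : ℝ}
    (ht : t ∈ I) (htU : γ t ∈ b.U) : ∃ i ∈ b.B, ∃ ε c : ℝ, ε ^ 2 = 1 ∧ ε * t + c ∈ b.J i ∧
      ∀ u, ε * u + c ∈ b.J i → u ∈ I ∧ γ u = b.η i (ε * u + c) := by
  have hev : ∀ᶠ u in 𝓝 t, u ∈ I ∧ γ u ∈ b.U :=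
    (h.isOpen.eventually_mem ht).and
      ((h.analytic t ht).continuousAt.eventually_mem (b.isOpen.mem_nhds htU))
  obtain ⟨δ, hδ, hball⟩ := Metric.eventually_nhds_iff_ball.1 hev
  have hsub : ball t δ ⊆ I := fun u hu => (hball u hu).1
  obtain ⟨i, hi, ε, c, hε, hic⟩ := b.rigid (ball t δ) γ
    (h.toIsUnitCurve.mono hsub isOpen_ball (convex_ball t δ).ordConnected ⟨t, mem_ball_self hδ⟩)
    (fun u hu => (hball u hu).2) (h.solution.mono_left hsub)
  have htJ := (hic t (mem_ball_self hδ)).1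
  obtain ⟨h1, h2⟩ := h.toIsUnitCurve.subset_of_inextendible h.not_extendible
    ((b.unit i).comp_affine (c := c) hε) ht (t₀ := t) htJ (by
      filter_upwards [ball_mem_nhds t hδ] with u hu using (hic u hu).2)
  exact ⟨i, hi, ε, c, hε, htJ, fun u hu => ⟨h1 hu, h2 hu⟩⟩

/-- If the branch passes the base point at parameter `a`, then its parameter is `ε * (u - a)`. -/
lemma IsMaxCurve.exists_branch_at (h : IsMaxCurve e₁ e₂ I γ) (b : Branches e₁ e₂ p) {a : ℝ}
    (ha : a ∈ I) (hap : γ a = p) : ∃ i ∈ b.B, ∃ ε : ℝ, ε ^ 2 = 1 ∧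
      ∀ ρ, ε * ρ ∈ b.J i → a + ρ ∈ I ∧ γ (a + ρ) = b.η i (ε * ρ) := by
  obtain ⟨i, hi, ε, c, hε, h1, h2⟩ := h.exists_branch b ha (hap ▸ b.mem)
  have h0 : ε * a + c = 0 := b.eq_zero_of_eq_base h1 (by rw [← (h2 a h1).2, hap])
  refine ⟨i, hi, ε, hε, fun ρ hρ => ?_⟩
  have e : ε * (a + ρ) + c = ε * ρ := by linear_combination h0
  simpa only [e] using h2 (a + ρ) (by rwa [e])

/-- The symmetry spreads to a neighbourhood of the midpoint of `a` and `b` by the identity theorem;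
there it reverses the derivative, which would have to vanish. -/
lemma IsUnitCurve.not_symmetric (h : IsUnitCurve I γ) {a b : ℝ} (ha : a ∈ I) (hb : b ∈ I)
    (he : ∀ᶠ ρ in 𝓝 (0 : ℝ), γ (a + ρ) = γ (b - ρ)) : False := by
  have hrev := h.comp_affine (ε := -1) (c := a + b) (by norm_num)
  have hnear : γ =ᶠ[𝓝 a] fun t => γ (-1 * t + (a + b)) := by
    have ht : Tendsto (fun t : ℝ => t - a) (𝓝 a) (𝓝 0) := by
      have : Continuous fun t : ℝ => t - a := by fun_prop
      simpa using this.tendsto a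
    filter_upwards [ht.eventually he] with t ht
    rw [add_sub_cancel] at ht
    rw [ht]; congr 1; ring
  have haI : a ∈ (fun t => -1 * t + (a + b)) ⁻¹' I := by
    rw [mem_preimage, show -1 * a + (a + b) = b by ring]; exact hb
  have heq := h.eqOn_inter hrev ha haI hnear
  set m := (a + b) / 2 with hm
  have hmI : m ∈ I := h.ordConnected.uIcc_subset ha hb (by
    rw [mem_uIcc]
    rcases le_total a b with hab | hab
    · left; constructor <;> linarith
    · right; constructor <;> linarith)
  have hmm : -1 * m + (a + b) = m := by rw [hm]; ring
  have hmI' : m ∈ (fun t => -1 * t + (a + b)) ⁻¹' I := by rw [mem_preimage, hmm]; exact hmI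
  have h1 : γ =ᶠ[𝓝 m] fun t => γ (-1 * t + (a + b)) := by
    filter_upwards [h.isOpen.mem_nhds hmI, hrev.isOpen.mem_nhds hmI'] with t a b using heq ⟨a, b⟩
  have d1 := (h.analytic m hmI).differentiableAt.hasDerivAt
  have d2 : HasDerivAt (fun t => γ (-1 * t + (a + b))) ((-1 : ℝ) • deriv γ m) m := by
    have hg : HasDerivAt γ (deriv γ m) (-1 * m + (a + b)) := by rw [hmm]; exact d1
    have hl : HasDerivAt (fun t : ℝ => -1 * t + (a + b)) (-1) m := by
      simpa using ((hasDerivAt_id m).const_mul (-1)).add_const (a + b)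
    exact hg.scomp m hl
  have d3 := d1.unique (d2.congr_of_eventuallyEq h1)
  refine h.deriv_ne_zero hmI ?_
  rw [neg_one_smul] at d3
  exact self_eq_neg.1 d3

lemma IsMaxCurve.injOn (hF : HessianAssumption e₁ e₂) (h : IsMaxCurve e₁ e₂ I γ) : InjOn γ I := by
  suffices key : ∀ a ∈ I, ∀ b ∈ I, a < b → γ a ≠ γ b by
    intro a ha b hb hab
    rcases lt_trichotomy a b with hlt | rfl | hlt
    · exact absurd hab (key a ha b hb hlt)
    · rfl
    · exact absurd hab.symm (key b hb a ha hlt)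
  intro a ha b₀ hb₀ hlt hab
  set s := γ a with hs
  obtain ⟨B⟩ := nonempty_branches hF (h.solution ha)
  obtain ⟨i, hi, ε, hε, hiε⟩ := h.exists_branch_at B ha rfl
  obtain ⟨δ, hδ, hδJ⟩ : ∃ δ > 0, ∀ k, ball 0 δ ⊆ B.J k := by
    obtain ⟨δ, hδ, h1⟩ := Metric.isOpen_iff.1 ((B.unit false).isOpen.inter (B.unit true).isOpen) 0
      ⟨B.zero_mem _, B.zero_mem _⟩
    refine ⟨δ, hδ, fun k x hx => ?_⟩
    cases k
    · exact (h1 hx).1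
    · exact (h1 hx).2
  have hJ : ∀ {k : Bool} {υ ρ : ℝ}, υ ^ 2 = 1 → |ρ| < δ → υ * ρ ∈ B.J k := fun {k υ ρ} hυ hρ => by
    refine hδJ k ?_
    rwa [mem_ball_zero_iff, Real.norm_eq_abs, abs_mul,
      show |υ| = 1 by rwa [← sq_eq_sq₀ (abs_nonneg _) zero_le_one, sq_abs, one_pow], one_mul]
  have hIcc : ∀ {x y}, x ∈ I → y ∈ I → Icc x y ⊆ I := fun hx hy => h.ordConnected.out hx hy
  -- the first return
  set d := min (δ / 2) (b₀ - a) with hd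
  have hd0 : 0 < d := lt_min (by positivity) (by linarith)
  have hdδ : d < δ := (min_le_left _ _).trans_lt (by linarith)
  have hdb : a + d ≤ b₀ := by linarith [min_le_right (δ / 2) (b₀ - a)]
  have hsubI : Icc (a + d) b₀ ⊆ I := (Icc_subset_Icc_left (by linarith)).trans (hIcc ha hb₀)
  have hret : IsCompact (Icc (a + d) b₀ ∩ γ ⁻¹' {s}) :=
    isCompact_Icc.of_isClosed_subset ((h.analytic.continuousOn.mono hsubI).preimage_isClosed_of_isClosed
      isClosed_Icc isClosed_singleton) inter_subset_left
  obtain ⟨b, ⟨hbmem, hbs⟩, hbmin⟩ := hret.exists_isLeast ⟨b₀, ⟨hdb, le_rfl⟩, hab.symm⟩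
  have hbI : b ∈ I := hsubI hbmem
  have hab' : a < b := by linarith [hbmem.1]
  have hfirst : ∀ t, a < t → t < b → γ t ≠ s := by
    intro t h1 h2 h3
    -- Before `a + d` the curve follows its branch at `s`, which passes `s` only at parameter `0`.
    by_cases htd : t < a + d
    · have hρ : |t - a| < δ := by rw [abs_of_pos (by linarith)]; linarith
      have h4 := (hiε (t - a) (hJ hε hρ)).2
      rw [add_sub_cancel, h3] at h4
      have h5 := B.eq_zero_of_eq_base (hJ hε hρ) h4.symm
      rcases mul_eq_zero.1 h5 with h6 | h6
      · rw [h6] at hε; norm_num at hε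
      · linarith
    · exact not_lt.2 (hbmin ⟨⟨not_lt.1 htd, h2.le.trans hbmem.2⟩, h3⟩) h2
  obtain ⟨j, hj, τ, hτ, hjτ⟩ := h.exists_branch_at B hbI hbs
  -- The curve leaves `s` along the arm `(i, ε)` and returns along `(j, -τ)`. If these coincide, the
  -- curve retraces itself; if not, the arc in between joins two different arms off `s`.
  by_cases harm : (i, ε) = (j, -τ)
  · obtain ⟨rfl, rfl⟩ := Prod.mk.inj harm
    refine h.toIsUnitCurve.not_symmetric ha hbI ?_
    filter_upwards [ball_mem_nhds (0 : ℝ) hδ] with ρ hρ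
    rw [mem_ball_zero_iff, Real.norm_eq_abs] at hρ
    have e : -τ * ρ = τ * -ρ := by ring
    rw [(hiε ρ (hJ hε hρ)).2, sub_eq_add_neg, (hjτ (-ρ) (hJ hτ (by rwa [abs_neg]))).2, e]
  · set ρ := min (δ / 2) ((b - a) / 2) with hρdef
    have hρ0 : 0 < ρ := lt_min (by positivity) (by linarith)
    have hρδ : ρ < δ := (min_le_left _ _).trans_lt (by linarith)
    have hρab : ρ ≤ (b - a) / 2 := min_le_right _ _
    have habs : |ρ| < δ := by rwa [abs_of_pos hρ0]
    have hsub : Icc (a + ρ) (b - ρ) ⊆ I :=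
      (Icc_subset_Icc (by linarith) (by linarith)).trans (hIcc ha hbI)
    have hcont := h.analytic.continuousOn.mono hsub
    refine B.separated i hi j hj ε (-τ) hε (by rwa [neg_sq]) harm (γ '' Icc (a + ρ) (b - ρ))
      (isCompact_Icc.image_of_continuousOn hcont) (isPreconnected_Icc.image _ hcont) ?_
      (ε * ρ) (hJ hε habs) (by rw [← mul_assoc, ← pow_two, hε, one_mul]; exact hρ0)
      ⟨a + ρ, ⟨le_rfl, by linarith⟩, (hiε ρ (hJ hε habs)).2⟩
      (τ * -ρ) (hJ hτ (by rwa [abs_neg])) ?_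
      ⟨b - ρ, ⟨by linarith, le_rfl⟩, ?_⟩
    · rintro _ ⟨t, ht, rfl⟩
      exact ⟨h.solution (hsub ht), hfirst t (by linarith [ht.1]) (by linarith [ht.2])⟩
    · have : -τ * (τ * -ρ) = τ ^ 2 * ρ := by ring
      rw [this, hτ, one_mul]; exact hρ0
    · rw [sub_eq_add_neg]; exact (hjτ (-ρ) (hJ hτ (by rwa [abs_neg]))).2

/-- An inextendible solution curve leaves compact sets along any filter leaving its domain. -/
lemma IsMaxCurve.eventually_notMem (hF : HessianAssumption e₁ e₂) (h : IsMaxCurve e₁ e₂ I γ)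
    {l : Filter I} (hl : ∀ r ∈ I, ∃ ρ > 0, ∀ᶠ t : I in l, ρ ≤ |(t : ℝ) - r|) {K : Set (ℝ × ℝ)}
    (hK : IsCompact K) (hKQ : K ⊆ quadrant) : ∀ᶠ t : I in l, γ t ∉ K := by
  by_contra hfr
  have hfr' : ∃ᶠ t : I in l, γ t ∈ K := hfr
  obtain ⟨p, hpK, hp⟩ := hK.exists_mapClusterPt_of_frequently hfr'
  have hpQ := hKQ hpK
  have hpS : p ∈ solutionSet e₁ e₂ := by
    refine ⟨hpQ, ?_⟩
    by_contra hne
    obtain ⟨t, ht⟩ := (hp.frequently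
      ((analyticAt_F e₁ e₂ hpQ).continuousAt.eventually_ne hne)).exists
    exact ht (h.solution t.2).2
  obtain ⟨b⟩ := nonempty_branches hF hpS
  -- Whenever the curve is close to `p`, it contains the whole branch there and so meets `p` at a
  -- nearby parameter. By injectivity this parameter is always the same, whereas `l` stays away from
  -- every point of `I`.
  have key : ∀ ε > 0, ∃ᶠ t : I in l, ∃ r ∈ I, γ r = p ∧ |(t : ℝ) - r| < ε := fun ε hε => by
    have hev : ∀ᶠ q in 𝓝 p, q ∈ b.U ∧ ∀ i, ∀ r ∈ b.J i, b.η i r = q → |r| < ε := by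
      filter_upwards [b.isOpen.mem_nhds b.mem, b.small false ε hε, b.small true ε hε] with q h1 h2 h3
      refine ⟨h1, fun i => ?_⟩
      cases i
      · exact h2
      · exact h3
    refine (hp.frequently hev).mono fun t ht => ?_
    obtain ⟨i, hi, σ, c, hσ, h1, h2⟩ := h.exists_branch b t.2 ht.1
    have e : σ * (-(σ * c)) + c = 0 := by linear_combination -c * hσ
    obtain ⟨h3, h4⟩ := h2 (-(σ * c)) (by rw [e]; exact b.zero_mem i)
    refine ⟨_, h3, by rw [h4, e, b.base], ?_⟩
    have h5 := ht.2 i _ h1 (h2 _ h1).2.symm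
    have h6 : (t : ℝ) - -(σ * c) = σ * (σ * t + c) := by linear_combination -(t : ℝ) * hσ
    rwa [h6, abs_mul,
      show |σ| = 1 by rwa [← sq_eq_sq₀ (abs_nonneg _) zero_le_one, sq_abs, one_pow], one_mul]
  obtain ⟨-, r, hr, hrp, -⟩ := (key 1 one_pos).exists
  obtain ⟨ρ, hρ, hev⟩ := hl r hr
  obtain ⟨t, ⟨r', hr', hrp', hlt⟩, hge⟩ := ((key ρ hρ).and_eventually hev).exists
  rw [h.injOn hF hr' hr (hrp'.trans hrp.symm)] at hlt
  linarith

lemma IsUnitCurve.exists_gt (h : IsUnitCurve I γ) {r : ℝ} (hr : r ∈ I) : ∃ t ∈ I, r < t := by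
  obtain ⟨ε, hε, hb⟩ := Metric.isOpen_iff.1 h.isOpen r hr
  refine ⟨r + ε / 2, hb ?_, by linarith⟩
  rw [mem_ball, Real.dist_eq, add_sub_cancel_left, abs_of_pos (by positivity)]
  linarith

lemma IsUnitCurve.exists_lt (h : IsUnitCurve I γ) {r : ℝ} (hr : r ∈ I) : ∃ t ∈ I, t < r := by
  obtain ⟨ε, hε, hb⟩ := Metric.isOpen_iff.1 h.isOpen r hr
  refine ⟨r - ε / 2, hb ?_, by linarith⟩
  rw [mem_ball, Real.dist_eq, sub_sub_cancel_left, abs_neg, abs_of_pos (by positivity)]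
  linarith

lemma IsMaxCurve.leaves_atTop (hF : HessianAssumption e₁ e₂) (h : IsMaxCurve e₁ e₂ I γ)
    {K : Set (ℝ × ℝ)} (hK : IsCompact K) (hKQ : K ⊆ quadrant) :
    ∀ᶠ t : I in atTop, γ t ∉ K := by
  refine h.eventually_notMem hF (fun r hr => ?_) hK hKQ
  obtain ⟨t, ht, hrt⟩ := h.exists_gt hr
  refine ⟨t - r, by linarith, (eventually_ge_atTop (⟨t, ht⟩ : I)).mono fun u hu => ?_⟩
  have : t ≤ u := hu
  exact le_trans (by linarith) (le_abs_self _)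

lemma IsMaxCurve.leaves_atBot (hF : HessianAssumption e₁ e₂) (h : IsMaxCurve e₁ e₂ I γ)
    {K : Set (ℝ × ℝ)} (hK : IsCompact K) (hKQ : K ⊆ quadrant) :
    ∀ᶠ t : I in atBot, γ t ∉ K := by
  refine h.eventually_notMem hF (fun r hr => ?_) hK hKQ
  obtain ⟨t, ht, hrt⟩ := h.exists_lt hr
  refine ⟨r - t, by linarith, (eventually_le_atBot (⟨t, ht⟩ : I)).mono fun u hu => ?_⟩
  have : (u : ℝ) ≤ t := hu
  exact le_trans (by linarith) (neg_le_abs _)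

theorem leavesCompacts (hF : HessianAssumption e₁ e₂) (h : IsInextendibleCurve I γ)
    (hS : γ '' I ⊆ solutionSet e₁ e₂) : LeavesCompacts I γ := by
  obtain ⟨η, φ, hη, hne, hφ, hγ⟩ := h.exists_arclength
  have hmax : IsMaxCurve e₁ e₂ (φ '' I) η := ⟨hη, hne, by
    rintro _ ⟨t, ht, rfl⟩
    rw [← hγ t ht]; exact hS (mem_image_of_mem γ ht)⟩
  intro K hK hKQ
  have : Nonempty (φ '' I) := hη.nonempty.to_subtype
  obtain ⟨⟨_, t₂, ht₂, rfl⟩, h2⟩ := eventually_atTop.1 (hmax.leaves_atTop hF hK hKQ)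
  obtain ⟨⟨_, t₁, ht₁, rfl⟩, h1⟩ := eventually_atBot.1 (hmax.leaves_atBot hF hK hKQ)
  refine ⟨t₁, ht₁, t₂, ht₂, fun t ht hor => ⟨h.1.mapsTo ht, ?_⟩⟩
  rw [hγ t ht]
  rcases hor with hlt | hlt
  · exact h1 ⟨_, t, ht, rfl⟩ (hφ ht ht₁ hlt).le
  · exact h2 ⟨_, t, ht, rfl⟩ (hφ ht₂ ht hlt).le

end
end DeSitter

/-! ### Finiteness of the set of inextendible solution curves. -/

namespace DeSitter
noncomputable section
open Filter Metric

variable {e₁ e₂ : ℝ} {p : ℝ × ℝ} {I I' : Set ℝ} {γ γ' : ℝ → ℝ × ℝ}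

/-- Two curves that contain the same branch differ there by an affine change of parameter. After
this change `γ` has a germ in common with `γ'`, whose inextendibility absorbs all of it. -/
lemma IsMaxCurve.image_subset (h : IsMaxCurve e₁ e₂ I γ) (h' : IsMaxCurve e₁ e₂ I' γ')
    (b : Branches e₁ e₂ p) {i : Bool} {ε c ε' c' : ℝ} (hε : ε ^ 2 = 1) (hε' : ε' ^ 2 = 1)
    (hb : ∀ u, ε * u + c ∈ b.J i → u ∈ I ∧ γ u = b.η i (ε * u + c))
    (hb' : ∀ u, ε' * u + c' ∈ b.J i → u ∈ I' ∧ γ' u = b.η i (ε' * u + c')) :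
    γ '' I ⊆ γ' '' I' := by
  have e0 : ∀ u, ε * (ε * ε' * u + ε * (c' - c)) + c = ε' * u + c' := fun u => by
    linear_combination (ε' * u + (c' - c)) * hε
  have hu₀ : ε' * (-(ε' * c')) + c' ∈ b.J i := by
    have : ε' * (-(ε' * c')) + c' = 0 := by linear_combination -c' * hε'
    rw [this]; exact b.zero_mem i
  have hκ : (ε * ε') ^ 2 = 1 := by rw [mul_pow, hε, hε', one_mul]
  have hmem : ∀ u, ε' * u + c' ∈ b.J i → ε * ε' * u + ε * (c' - c) ∈ I ∧
      γ (ε * ε' * u + ε * (c' - c)) = γ' u := fun u hu => by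
    have h1 := hb (ε * ε' * u + ε * (c' - c)) (by rwa [e0])
    rw [e0] at h1
    exact ⟨h1.1, h1.2.trans (hb' u hu).2.symm⟩
  have hcont : Continuous fun u : ℝ => ε' * u + c' := by fun_prop
  obtain ⟨h1, h2⟩ := h'.toIsUnitCurve.subset_of_inextendible h'.not_extendible
    (h.toIsUnitCurve.comp_affine (c := ε * (c' - c)) hκ) (hb' _ hu₀).1 (hmem _ hu₀).1 (by
      filter_upwards [hcont.continuousAt.eventually_mem ((b.unit i).isOpen.mem_nhds hu₀)] with u hu
      exact (hmem u hu).2.symm)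
  rintro _ ⟨t, ht, rfl⟩
  have e1 : ε * ε' * (ε * ε' * (t - ε * (c' - c))) + ε * (c' - c) = t := by
    linear_combination (t - ε * (c' - c)) * hκ
  have h3 : ε * ε' * (t - ε * (c' - c)) ∈
      (fun t => ε * ε' * t + ε * (c' - c)) ⁻¹' I := by rwa [mem_preimage, e1]
  exact ⟨_, h1 h3, by rw [h2 h3]; simp only [e1]⟩

/-- The images of the inextendible solution curves. -/
def curveImages (e₁ e₂ : ℝ) : Set (Set (ℝ × ℝ)) :=
  {T | ∃ I γ, IsMaxCurve e₁ e₂ I γ ∧ T = γ '' I}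

/-- `T` is the image of an inextendible solution curve that contains the `i`-th branch at `p`. -/
def ContainsBranch (b : Branches e₁ e₂ p) (i : Bool) (T : Set (ℝ × ℝ)) : Prop :=
  ∃ I γ, IsMaxCurve e₁ e₂ I γ ∧ T = γ '' I ∧ ∃ ε c : ℝ, ε ^ 2 = 1 ∧
    ∀ u, ε * u + c ∈ b.J i → u ∈ I ∧ γ u = b.η i (ε * u + c)

lemma ContainsBranch.unique {b : Branches e₁ e₂ p} {i : Bool} {T T' : Set (ℝ × ℝ)}
    (h : ContainsBranch b i T) (h' : ContainsBranch b i T') : T = T' := by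
  obtain ⟨I, γ, h1, rfl, ε, c, hε, h2⟩ := h
  obtain ⟨I', γ', h1', rfl, ε', c', hε', h2'⟩ := h'
  exact (h1.image_subset h1' b hε hε' h2 h2').antisymm (h1'.image_subset h1 b hε' hε h2' h2)

lemma exists_containsBranch (b : Branches e₁ e₂ p) {T : Set (ℝ × ℝ)} (hT : T ∈ curveImages e₁ e₂)
    (hp : p ∈ T) : ∃ i, ContainsBranch b i T := by
  obtain ⟨I, γ, h, rfl⟩ := hT
  obtain ⟨t, ht, htp⟩ := hp
  obtain ⟨i, -, ε, c, hε, -, h2⟩ := h.exists_branch b ht (htp ▸ b.mem)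
  exact ⟨i, I, γ, h, rfl, ε, c, hε, h2⟩

/-- The maximal extension of a branch is inextendible, and it stays in the solution set by the
identity theorem for `F` along the curve. -/
lemma exists_curveImage (hF : HessianAssumption e₁ e₂) (hp : p ∈ solutionSet e₁ e₂) :
    ∃ T ∈ curveImages e₁ e₂, p ∈ T := by
  obtain ⟨b⟩ := nonempty_branches hF hp
  obtain ⟨I, γ, hγ, hsub, heq, hmax⟩ := (b.unit false).exists_maximal (b.zero_mem false)
  have hinext : IsInextendibleCurve I γ := hγ.isInextendible fun J η hη hIJ hηγ =>
    hmax J η hη (hIJ (hsub (b.zero_mem false))) (by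
      filter_upwards [hγ.isOpen.mem_nhds (hsub (b.zero_mem false))] with t ht using hηγ ht)
  have hsol : MapsTo γ I (solutionSet e₁ e₂) := by
    have han : AnalyticOnNhd ℝ (fun t => F e₁ e₂ (γ t)) I := fun t ht =>
      (analyticAt_F e₁ e₂ (hγ.mapsTo ht)).fun_comp (hγ.analytic t ht)
    have hz : (fun t => F e₁ e₂ (γ t)) =ᶠ[𝓝 0] 0 := by
      filter_upwards [(b.unit false).isOpen.mem_nhds (b.zero_mem false)] with t ht
      rw [heq ht]
      exact (b.mapsTo false b.false_mem ht).2
    have := han.eqOn_zero_of_preconnected_of_eventuallyEq_zero hγ.ordConnected.isPreconnected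
      (hsub (b.zero_mem false)) hz
    exact fun t ht => ⟨hγ.mapsTo ht, this ht⟩
  refine ⟨γ '' I, ⟨I, γ, ⟨hγ, hinext.2, hsol⟩, rfl⟩, 0, hsub (b.zero_mem false), ?_⟩
  rw [heq (b.zero_mem false), b.base]

/-- A filter on the line such that a continuous function tending to it has to pass through nearly
all points of the filter. -/
def IsOneSided (l : Filter ℝ) : Prop :=
  l.NeBot ∧ ∀ᶠ x in l, ∀ᶠ x' in l, ∀ᶠ y in l, x' ∈ uIcc x y

lemma isOneSided_nhdsGT (d : ℝ) : IsOneSided (𝓝[>] d) := by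
  refine ⟨inferInstance, ?_⟩
  filter_upwards [self_mem_nhdsWithin] with x hx
  filter_upwards [Ioo_mem_nhdsGT hx] with x' hx'
  filter_upwards [Ioo_mem_nhdsGT hx'.1] with y hy
  exact mem_uIcc.2 (Or.inr ⟨hy.2.le, hx'.2.le⟩)

lemma isOneSided_nhdsLT (d : ℝ) : IsOneSided (𝓝[<] d) := by
  refine ⟨inferInstance, ?_⟩
  filter_upwards [self_mem_nhdsWithin] with x hx
  filter_upwards [Ioo_mem_nhdsLT hx] with x' hx'
  filter_upwards [Ioo_mem_nhdsLT hx'.2] with y hy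
  exact mem_uIcc.2 (Or.inl ⟨hx'.1.le, hy.1.le⟩)

lemma isOneSided_atTop : IsOneSided atTop := by
  refine ⟨inferInstance, Eventually.of_forall fun x => ?_⟩
  filter_upwards [eventually_ge_atTop x] with x' hx'
  filter_upwards [eventually_ge_atTop x'] with y hy
  exact mem_uIcc.2 (Or.inl ⟨hx', hy⟩)

lemma IsUnitCurve.eventually_crosses (h : IsUnitCurve I γ) {l : Filter ℝ} (hl : IsOneSided l)
    (ht : Tendsto (fun t : I => (γ t).1) atTop l) : ∀ᶠ x in l, ∃ q ∈ γ '' I, q.1 = x := by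
  have : Nonempty I := h.nonempty.to_subtype
  have hl1 := hl.1
  obtain ⟨t, ht1⟩ := (ht.eventually hl.2).exists
  have hoc : ((fun t => (γ t).1) '' I).OrdConnected :=
    (h.ordConnected.isPreconnected.image _
      (continuous_fst.comp_continuousOn h.analytic.continuousOn)).ordConnected
  filter_upwards [ht1] with x hx
  obtain ⟨t', ht'⟩ := (ht.eventually hx).exists
  obtain ⟨u, hu, hux⟩ := hoc.uIcc_subset ⟨t, t.2, rfl⟩ ⟨t', t'.2, rfl⟩ ht'
  exact ⟨γ u, ⟨u, hu, rfl⟩, hux⟩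

/-- Only finitely many solution curves end at a given abscissa, from a given side. -/
lemma finite_curveImages_of_end (hF : HessianAssumption e₁ e₂) {l : Filter ℝ} (hl : IsOneSided l) :
    {T | ∃ I γ, IsMaxCurve e₁ e₂ I γ ∧ T = γ '' I ∧
      Tendsto (fun t : I => (γ t).1) atTop l}.Finite := by
  by_contra hinf
  -- Seven exceeds `3 * 2`: at most three solution points on a vertical line, with at most two
  -- branches through each.
  obtain ⟨s, hs, hcard⟩ := Set.Infinite.exists_subset_card_eq hinf 7
  have hl1 := hl.1
  have hall : ∀ᶠ x in l, ∀ T ∈ s, ∃ q ∈ T, q.1 = x := by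
    rw [Filter.eventually_all_finset]
    intro T hT
    obtain ⟨I, γ, h, rfl, ht⟩ := hs hT
    exact h.eventually_crosses hl ht
  obtain ⟨x, hx⟩ := hall.exists
  set P := solutionSet e₁ e₂ ∩ {p | p.1 = x}
  have hPle : P.encard ≤ 3 := encard_vertical_le e₁ e₂ x
  have hPfin : P.Finite := Set.finite_of_encard_le_coe (k := 3) hPle
  have hPcard : hPfin.toFinset.card ≤ 3 := by
    rw [hPfin.encard_eq_coe_toFinset_card] at hPle
    exact_mod_cast hPle
  -- One choice of branches is fixed for every point, so that a point and an index determine the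
  -- curve.
  let b : ∀ q ∈ solutionSet e₁ e₂, Branches e₁ e₂ q := fun q hq => (nonempty_branches hF hq).some
  have hT : ∀ T ∈ s, ∃ a : (ℝ × ℝ) × Bool, ∃ h : a.1 ∈ P, ContainsBranch (b a.1 h.1) a.2 T := by
    intro T hT
    obtain ⟨q, hqT, hqx⟩ := hx T hT
    obtain ⟨I, γ, h, rfl, -⟩ := hs hT
    have hqS : q ∈ solutionSet e₁ e₂ := by
      obtain ⟨t, ht, rfl⟩ := hqT
      exact h.solution ht
    obtain ⟨i, hi⟩ := exists_containsBranch (b q hqS) ⟨I, γ, h, rfl⟩ hqT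
    exact ⟨(q, i), ⟨hqS, hqx⟩, hi⟩
  choose! a haP ha using hT
  have huniq : ∀ v v' : (ℝ × ℝ) × Bool, v = v' → ∀ (h : v.1 ∈ P) (h' : v'.1 ∈ P) T T',
      ContainsBranch (b v.1 h.1) v.2 T → ContainsBranch (b v'.1 h'.1) v'.2 T' → T = T' := by
    rintro v _ rfl h h' T T' h1 h2
    exact h1.unique h2
  have hle := Finset.card_le_card_of_injOn (s := s) (t := hPfin.toFinset ×ˢ Finset.univ) a
    (fun T hT => by simpa using haP T hT) (by
      intro T hT T' hT' he
      exact huniq _ _ he (haP T hT) (haP T' hT') T T' (ha T hT) (ha T' hT'))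
  rw [hcard, Finset.card_product, Finset.card_univ, Fintype.card_bool] at hle
  omega

/-- The filters describing the possible ends of the abscissa of a solution curve. -/
def endFilters : Set (Filter ℝ) :=
  {atTop} ∪ (fun d => 𝓝[>] d) '' (insert 0 exceptionalSet) ∪ (fun d => 𝓝[<] d) '' exceptionalSet

lemma finite_endFilters : endFilters.Finite :=
  ((finite_singleton _).union ((finite_exceptionalSet.insert 0).image _)).union
    (finite_exceptionalSet.image _)

lemma isOneSided_of_mem_endFilters {l : Filter ℝ} (h : l ∈ endFilters) : IsOneSided l := by
  rcases h with (rfl | ⟨d, -, rfl⟩) | ⟨d, -, rfl⟩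
  · exact isOneSided_atTop
  · exact isOneSided_nhdsGT d
  · exact isOneSided_nhdsLT d

/-- A vertical line contains finitely many solutions, a compact set which the curve eventually
leaves; so the abscissa ends up on one side of each value and has a limit in `[0, ∞]`. At a positive
finite limit outside `exceptionalSet`, the curve would remain in a compact rectangle. -/
lemma IsMaxCurve.exists_end (hF : HessianAssumption e₁ e₂) (h : IsMaxCurve e₁ e₂ I γ) :
    ∃ l ∈ endFilters, Tendsto (fun t : I => (γ t).1) atTop l := by
  have : Nonempty I := h.nonempty.to_subtype
  have hpos : ∀ t : I, 0 < (γ t).1 := fun t => (h.mapsTo t.2).1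
  have hdich : ∀ x, 0 < x → (∀ᶠ t : I in atTop, x < (γ t).1) ∨ ∀ᶠ t : I in atTop, (γ t).1 < x := by
    intro x hx
    have hfin : (solutionSet e₁ e₂ ∩ {p | p.1 = x}).Finite :=
      Set.finite_of_encard_le_coe (k := 3) (encard_vertical_le e₁ e₂ x)
    obtain ⟨t₀, ht₀⟩ := eventually_atTop.1
      (h.leaves_atTop hF hfin.isCompact fun q hq => hq.1.1)
    have hne : ∀ t : I, t₀ ≤ t → (γ t).1 ≠ x := fun t ht he => ht₀ t ht ⟨h.solution t.2, he⟩
    have hoc : ((fun t => (γ t).1) '' (I ∩ Ici (t₀ : ℝ))).OrdConnected :=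
      ((h.ordConnected.inter ordConnected_Ici).isPreconnected.image _
        (continuous_fst.comp_continuousOn
          (h.analytic.continuousOn.mono inter_subset_left))).ordConnected
    have hav : ∀ t : I, t₀ ≤ t → x ∉ uIcc (γ t₀).1 (γ t).1 := fun t ht hmem => by
      obtain ⟨u, hu, hux⟩ := hoc.uIcc_subset ⟨t₀, ⟨t₀.2, self_mem_Ici⟩, rfl⟩
        ⟨t, ⟨t.2, mem_Ici.2 ht⟩, rfl⟩ hmem
      exact hne ⟨u, hu.1⟩ hu.2 hux
    rcases lt_or_gt_of_ne (hne t₀ le_rfl) with h0 | h0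
    · right
      filter_upwards [eventually_ge_atTop t₀] with t ht
      by_contra! hle
      exact hav t ht (mem_uIcc.2 (Or.inl ⟨h0.le, hle⟩))
    · left
      filter_upwards [eventually_ge_atTop t₀] with t ht
      by_contra! hle
      exact hav t ht (mem_uIcc.2 (Or.inr ⟨hle, h0.le⟩))
  -- The positive eventual strict lower bounds of the abscissa; the limit is their supremum, or `0`
  -- if there are none.
  set A : Set ℝ := {x | 0 < x ∧ ∀ᶠ t : I in atTop, x < (γ t).1}
  by_cases hbdd : BddAbove A
  · rcases A.eq_empty_or_nonempty with hA | ⟨x₀, hx₀⟩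
    · refine ⟨𝓝[>] 0, Or.inl (Or.inr ⟨0, mem_insert _ _, rfl⟩), tendsto_nhdsWithin_iff.2
        ⟨tendsto_order.2 ⟨fun x hx => Eventually.of_forall fun t => hx.trans (hpos t), fun x hx => ?_⟩,
          Eventually.of_forall hpos⟩⟩
      refine (hdich x hx).resolve_left fun hev => ?_
      have : x ∈ A := ⟨hx, hev⟩
      rw [hA] at this
      exact this
    · set d := sSup A
      have hd : 0 < d := hx₀.1.trans_le (le_csSup hbdd hx₀)
      have hlim : Tendsto (fun t : I => (γ t).1) atTop (𝓝 d) := by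
        refine tendsto_order.2 ⟨fun x hx => ?_, fun x hx => ?_⟩
        · obtain ⟨y, hy, hxy⟩ := exists_lt_of_lt_csSup ⟨x₀, hx₀⟩ hx
          exact hy.2.mono fun t ht => hxy.trans ht
        · refine (hdich x (hd.trans hx)).resolve_left fun hev => ?_
          exact not_lt.2 (le_csSup hbdd ⟨hd.trans hx, hev⟩) hx
      have hexc : d ∈ exceptionalSet := by
        by_contra hn
        obtain ⟨a, ha, b, hev⟩ := vertically_bounded e₁ e₂ hd hn
        obtain ⟨ε, hε, hball⟩ := Metric.eventually_nhds_iff_ball.1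
          (hev.and (eventually_gt_nhds hd))
        have hK : IsCompact (Icc (d - ε / 2) (d + ε / 2) ×ˢ Icc a b) := isCompact_Icc.prod isCompact_Icc
        have hin : ∀ {x}, x ∈ Icc (d - ε / 2) (d + ε / 2) → x ∈ ball d ε := fun hx => by
          rw [mem_ball, Real.dist_eq, abs_lt]
          constructor <;> linarith [hx.1, hx.2]
        have h1 := h.leaves_atTop hF hK fun q hq =>
          ⟨(hball _ (hin hq.1)).2, ha.trans_le hq.2.1⟩
        have h2 := hlim.eventually (Icc_mem_nhds (show d - ε / 2 < d by linarith)
          (show d < d + ε / 2 by linarith))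
        obtain ⟨t, ht1, ht2⟩ := (h1.and h2).exists
        exact ht1 ⟨ht2, (hball _ (hin ht2)).1 _ (h.mapsTo t.2).2 (h.solution t.2).2⟩
      rcases hdich d hd with hev | hev
      · exact ⟨𝓝[>] d, Or.inl (Or.inr ⟨d, mem_insert_of_mem _ hexc, rfl⟩),
          tendsto_nhdsWithin_iff.2 ⟨hlim, hev⟩⟩
      · exact ⟨𝓝[<] d, Or.inr ⟨d, hexc, rfl⟩, tendsto_nhdsWithin_iff.2 ⟨hlim, hev⟩⟩
  · refine ⟨atTop, Or.inl (Or.inl rfl), tendsto_atTop.2 fun x => ?_⟩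
    obtain ⟨y, hy, hxy⟩ := not_bddAbove_iff.1 hbdd x
    exact hy.2.mono fun t ht => (hxy.trans ht).le

lemma finite_curveImages (hF : HessianAssumption e₁ e₂) : (curveImages e₁ e₂).Finite := by
  refine (finite_endFilters.biUnion fun l hl =>
    finite_curveImages_of_end hF (isOneSided_of_mem_endFilters hl)).subset ?_
  rintro T ⟨I, γ, h, rfl⟩
  obtain ⟨l, hl, ht⟩ := h.exists_end hF
  exact mem_biUnion hl ⟨I, γ, h, rfl, ht⟩

theorem exists_finite_parametrization (hF : HessianAssumption e₁ e₂) :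
    ∃ (n : ℕ) (I : Fin n → Set ℝ) (γ : Fin n → ℝ → ℝ × ℝ),
      (∀ i, IsInextendibleCurve (I i) (γ i)) ∧ solutionSet e₁ e₂ = ⋃ i, γ i '' I i := by
  have hfin := finite_curveImages hF
  have := hfin.fintype
  let E := Fintype.equivFin (curveImages e₁ e₂)
  choose I γ hγ hT using fun T : curveImages e₁ e₂ => T.2
  refine ⟨_, fun i => I (E.symm i), fun i => γ (E.symm i), fun i =>
    ⟨(hγ _).toIsUnitCurve.isRegularCurve, (hγ _).not_extendible⟩, ?_⟩
  ext q
  simp only [mem_iUnion]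
  constructor
  · intro hq
    obtain ⟨T, hTc, hqT⟩ := exists_curveImage hF hq
    refine ⟨E ⟨T, hTc⟩, ?_⟩
    rw [E.symm_apply_apply, ← hT]
    exact hqT
  · rintro ⟨i, t, ht, rfl⟩
    exact (hγ _).solution ht

end
end DeSitter

/-! ### Components of the solution set are tree-like. -/

namespace DeSitter
noncomputable section
open Filter Metric

variable {e₁ e₂ : ℝ} {p : ℝ × ℝ}

/-- The side `0 < σ * r` of the `i`-th branch. -/
def Branches.arm (b : Branches e₁ e₂ p) (i : Bool) (σ : ℝ) : Set (ℝ × ℝ) :=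
  b.η i '' (b.J i ∩ {r | 0 < σ * r})

lemma Branches.isPathConnected_arm (b : Branches e₁ e₂ p) {i : Bool} {σ : ℝ}
    (hne : (b.arm i σ).Nonempty) : IsPathConnected (b.arm i σ) := by
  have hconv : Convex ℝ (b.J i ∩ {r | 0 < σ * r}) :=
    (b.unit i).ordConnected.convex.inter (convex_halfSpace_gt (IsLinearMap.isLinearMap_smul σ) 0)
  exact (hconv.isPathConnected hne.of_image).image'
    ((b.unit i).analytic.continuousOn.mono inter_subset_left)

lemma Branches.arm_subset (b : Branches e₁ e₂ p) {i : Bool} (hi : i ∈ b.B) (σ : ℝ) :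
    b.arm i σ ⊆ pathComponentIn (solutionSet e₁ e₂) p \ {p} := by
  have hpc : IsPathConnected (b.η i '' b.J i) :=
    ((b.unit i).ordConnected.convex.isPathConnected (b.unit i).nonempty).image'
      (b.unit i).analytic.continuousOn
  rintro _ ⟨r, ⟨hr, hσ⟩, rfl⟩
  refine ⟨hpc.subset_pathComponentIn ⟨0, b.zero_mem i, b.base i⟩ (b.mapsTo i hi).image_subset
    ⟨r, hr, rfl⟩, fun h => ?_⟩
  rw [b.eq_zero_of_eq_base hr h] at hσ
  simp at hσ

lemma Branches.exists_mem_arm (b : Branches e₁ e₂ p) : ∃ r > 0, ∀ i, ∀ σ : ℝ, σ ^ 2 = 1 →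
    σ * r ∈ b.J i ∧ 0 < σ * (σ * r) := by
  have h : ∀ᶠ r in 𝓝 (0 : ℝ), ∀ i, r ∈ b.J i :=
    Filter.eventually_all.2 fun i => (b.unit i).isOpen.mem_nhds (b.zero_mem i)
  obtain ⟨ε, hε, hball⟩ := Metric.eventually_nhds_iff_ball.1 h
  refine ⟨ε / 2, half_pos hε, fun i σ hσ => ⟨hball _ ?_ i, ?_⟩⟩
  · have : |σ| = 1 := by rw [← sq_eq_sq₀ (abs_nonneg σ) one_pos.le, sq_abs, hσ, one_pow]
    rw [mem_ball_zero_iff, norm_mul, Real.norm_eq_abs, this, one_mul,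
      Real.norm_of_nonneg (by positivity)]
    linarith
  · rw [← mul_assoc, ← sq, hσ, one_mul]; exact half_pos hε

/-- Every point of a component of the solution set can be joined to the branches at `p` without
passing through `p`. -/
lemma Branches.exists_joinedIn (b : Branches e₁ e₂ p) {y : ℝ × ℝ}
    (hy : y ∈ pathComponentIn (solutionSet e₁ e₂) p) (hyp : y ≠ p) :
    ∃ i ∈ b.B, ∃ σ : ℝ, σ ^ 2 = 1 ∧ ∃ q ∈ b.arm i σ,
      JoinedIn (pathComponentIn (solutionSet e₁ e₂) p \ {p}) y q := by
  set S := solutionSet e₁ e₂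
  have hpS : p ∈ S := b.base false ▸ b.mapsTo false b.false_mem (b.zero_mem false)
  obtain ⟨γ, hγ⟩ := (isPathConnected_pathComponentIn hpS).joinedIn y hy p (mem_pathComponentIn_self hpS)
  have hcont : Continuous γ.extend := γ.continuous_extend
  have hmem : ∀ t, γ.extend t ∈ pathComponentIn S p := fun t => hγ _
  have hZ : IsCompact (Icc (0 : ℝ) 1 ∩ γ.extend ⁻¹' {p}) :=
    isCompact_Icc.inter_right (isClosed_singleton.preimage hcont)
  -- The first time the path meets `p`. Shortly before it, the path is in the neighbourhood `b.U`
  -- and therefore on an arm, still without having touched `p`.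
  obtain ⟨t₀, ⟨ht₀, hp₀⟩, hmin⟩ := hZ.exists_isLeast ⟨1, by simp⟩
  have hpos : 0 < t₀ := ht₀.1.lt_of_ne (by rintro rfl; exact hyp (by simpa using hp₀))
  have hev : ∀ᶠ t in 𝓝[<] t₀, γ.extend t ∈ b.U :=
    (hcont.continuousAt.eventually_mem (b.isOpen.mem_nhds
      (by rw [mem_singleton_iff.1 hp₀]; exact b.mem))).filter_mono nhdsWithin_le_nhds
  obtain ⟨t, htU, ht⟩ := (hev.and (Ioo_mem_nhdsLT hpos)).exists
  have hne : ∀ u ∈ Icc 0 t, γ.extend u ≠ p := fun u hu h =>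
    not_lt.2 (hmin ⟨⟨hu.1, hu.2.trans (ht.2.le.trans ht₀.2)⟩, h⟩) (hu.2.trans_lt ht.2)
  have htI : t ∈ Icc 0 t := right_mem_Icc.2 ht.1.le
  obtain ⟨i, hi, r, hr, hrt⟩ := b.cover _ htU (pathComponentIn_subset (hmem t))
  have hr0 : r ≠ 0 := by rintro rfl; exact hne t htI (hrt ▸ b.base i)
  have hj : JoinedIn (pathComponentIn S p \ {p}) y (γ.extend t) := by
    have := ((convex_Icc 0 t).isPathConnected ⟨t, htI⟩).image hcont
    refine (this.joinedIn y ⟨0, left_mem_Icc.2 ht.1.le, by simp⟩ _ ⟨t, htI, rfl⟩).mono ?_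
    rintro _ ⟨u, hu, rfl⟩
    exact ⟨hmem u, hne u hu⟩
  rcases hr0.lt_or_gt with h | h
  · exact ⟨i, hi, -1, by norm_num, _, ⟨r, ⟨hr, by simpa using h⟩, hrt⟩, hj⟩
  · exact ⟨i, hi, 1, by norm_num, _, ⟨r, ⟨hr, by simpa using h⟩, hrt⟩, hj⟩

/-- The two arms of a single branch lie in different components, because the range of a path between
them would be a compact connected set violating `separated`. Every component contains one of the at
most four arms. -/
theorem isTreeLike_pathComponentIn (hF : HessianAssumption e₁ e₂) {x : ℝ × ℝ}
    (hx : x ∈ solutionSet e₁ e₂) : IsTreeLike (pathComponentIn (solutionSet e₁ e₂) x) := by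
  refine ⟨fun q hq => (pathComponentIn_subset hq).1, isPathConnected_pathComponentIn hx,
    fun p hp => ?_⟩
  have hpS : p ∈ solutionSet e₁ e₂ := pathComponentIn_subset hp
  obtain ⟨b⟩ := nonempty_branches hF hpS
  rw [← pathComponentIn_congr hp]
  set T := pathComponentIn (solutionSet e₁ e₂) p
  obtain ⟨r, hr, hra⟩ := b.exists_mem_arm
  have hmem : ∀ i, ∀ σ : ℝ, σ ^ 2 = 1 → b.η i (σ * r) ∈ b.arm i σ := fun i σ hσ =>
    ⟨_, hra i σ hσ, rfl⟩
  constructor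
  · have h1 : (1 : ℝ) ^ 2 = 1 := by norm_num
    have h2 : (-1 : ℝ) ^ 2 = 1 := by norm_num
    have m1 := b.arm_subset b.false_mem 1 (hmem false 1 h1)
    have m2 := b.arm_subset b.false_mem (-1) (hmem false (-1) h2)
    refine ⟨_, ⟨_, m1, rfl⟩, _, ⟨_, m2, rfl⟩, fun he => ?_⟩
    have hj : b.η false (-1 * r) ∈ pathComponentIn (T \ {p}) (b.η false (1 * r)) := by
      rw [he]; exact mem_pathComponentIn_self m2
    obtain ⟨γ, hγ⟩ := hj
    refine b.separated false b.false_mem false b.false_mem 1 (-1) h1 h2 (by norm_num) (range γ)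
      (isCompact_range γ.continuous) (isPreconnected_range γ.continuous) ?_
      (1 * r) (hra false 1 h1).1 (hra false 1 h1).2 ⟨0, γ.source⟩
      (-1 * r) (hra false (-1) h2).1 (hra false (-1) h2).2 ⟨1, γ.target⟩
    rintro _ ⟨t, rfl⟩
    exact ⟨pathComponentIn_subset (hγ t).1, (hγ t).2⟩
  · refine ((Set.toFinite (univ ×ˢ {1, -1} : Set (Bool × ℝ))).image
      fun v => pathComponentIn (T \ {p}) (b.η v.1 (v.2 * r))).subset ?_
    rintro _ ⟨y, hy, rfl⟩
    obtain ⟨i, hi, σ, hσ, q, hq, hyq⟩ := b.exists_joinedIn hy.1 hy.2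
    have hqa := ((b.isPathConnected_arm ⟨q, hq⟩).joinedIn q hq _ (hmem i σ hσ)).mono
      (b.arm_subset hi σ)
    refine ⟨(i, σ), ⟨mem_univ _, mul_self_eq_one_iff.1 (by rw [← sq, hσ])⟩, ?_⟩
    exact pathComponentIn_congr (hyq.trans hqa)

lemma pairwiseDisjoint_components (S : Set (ℝ × ℝ)) : (components S).PairwiseDisjoint id := by
  rintro _ ⟨x, -, rfl⟩ _ ⟨y, -, rfl⟩ hne
  refine Set.disjoint_left.2 fun z hz hz' => hne ?_
  rw [← pathComponentIn_congr hz, ← pathComponentIn_congr hz']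

lemma sUnion_components (S : Set (ℝ × ℝ)) : ⋃₀ components S = S := by
  refine (sUnion_subset ?_).antisymm fun x hx => ⟨_, ⟨x, hx, rfl⟩, mem_pathComponentIn_self hx⟩
  rintro _ ⟨x, -, rfl⟩
  exact pathComponentIn_subset

end
end DeSitter

theorem theorem4p3 (e₁ e₂ : ℝ) (hF : DeSitter.HessianAssumption e₁ e₂) :
    -- the solution set is parameterized by finitely many inextendible analytic curves
    (∃ (n : ℕ) (I : Fin n → Set ℝ) (γ : Fin n → ℝ → ℝ × ℝ),
      (∀ i, DeSitter.IsInextendibleCurve (I i) (γ i)) ∧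
        DeSitter.solutionSet e₁ e₂ = ⋃ i, γ i '' I i) ∧
    -- every inextendible analytic solution curve leaves all compact subsets at both ends
    (∀ (I : Set ℝ) (γ : ℝ → ℝ × ℝ), DeSitter.IsInextendibleCurve I γ →
      γ '' I ⊆ DeSitter.solutionSet e₁ e₂ → DeSitter.LeavesCompacts I γ) ∧
    -- the solution set is the disjoint union of its components, and these are tree-like
    ((DeSitter.components (DeSitter.solutionSet e₁ e₂)).PairwiseDisjoint id ∧
      ⋃₀ DeSitter.components (DeSitter.solutionSet e₁ e₂) = DeSitter.solutionSet e₁ e₂ ∧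
      ∀ T ∈ DeSitter.components (DeSitter.solutionSet e₁ e₂), DeSitter.IsTreeLike T) :=
  ⟨DeSitter.exists_finite_parametrization hF, fun _ _ h hS => DeSitter.leavesCompacts hF h hS,
    DeSitter.pairwiseDisjoint_components _, DeSitter.sUnion_components _, by
      rintro _ ⟨x, hx, rfl⟩
      exact DeSitter.isTreeLike_pathComponentIn hF hx⟩
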